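/- Let $p\ge 1$ and let $n_1,\dots,n_p>1$ be integers that are independent, i.e. $\log n_1,\dots,\log n_p$ are linearly independent over $\mathbb{Q}$. Let $\langle n_i\rangle\subset\mathbb{R}_{>0}$ be the multiplicative group generated by the $n_i$, let $A=\mathbb{Z}[\frac1{n_1},\dots,\frac1{n_p}]$, and let $d=\gcd(n_1-1,\dots,n_p-1)$. For $r\in A$, $r>0$ (for instance a positive integer), let $S_r=\mathbb{R}/r\mathbb{Z}$, and let $T_{r,(n_i)}$ be the group of orientation preserving homeomorphisms $f$ of $S_r$ that have a lift $F:\mathbb{R}\to\mathbb{R}$ and a subdivision $0=a_0<a_1<\dots<a_k=r$ such that all $a_j$ and $F(a_j)$ lie in $A$ and $F$ is affine with slope in $\langle n_i\rangle$ on each $[a_j,a_{j+1}]$. The rotation number of an orientation preserving homeomorphism $f$ of $S_r$ with lift $F$ is $\rho(f)=\lim_{m\to\infty}F^m(0)/(rm)$ modulo $1$. A group of homeomorphisms acts freely if none of its elements other than the identity has a fixed point. Let $G=T_{r,(n_i)}$. Then: (A) $G$ contains a free abelian group of rank $p-1$ acting freely on $S_r$. Equivalently, $G$ contains $p-1$ commuting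 homeomorphisms with irrational rotation numbers $\rho_1,\dots,\rho_{p-1}$ such that $1,\rho_1,\dots,\rho_{p-1}$ are linearly independent over $\mathbb{Q}$. (More generally, for each $k\geq 0$, $G$ contains a free abelian group of rank $k$ acting freely if and only if it contains $k$ commuting homeomorphisms with irrational rotation numbers that together with $1$ are linearly independent over $\mathbb{Q}$.) (B) $G$ contains no free abelian group of rank $p$ acting freely on $S_r$. (C) The rotation number of any element of a free abelian subgroup of rank $2$ of $G$ is, modulo $1$, of the form $\frac{\log\alpha}{\log\beta}$ with $\alpha,\beta\in\langle n_i\rangle$, $\beta\neq1$. (C') Every number $\frac{\log\alpha}{\log\beta}\in[0,1)$ with $\alpha,\beta\in\langle n_i\rangle$, $\beta\ne1$, is the rotation number of an element of $T_{d,(n_i)}$. -/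

import Mathlib

open Filter Topology

namespace ThompsonStein

/-- The multiplicative group `⟨n₁, …, n_p⟩` generated by the integers `n i`, as a set of
positive real numbers. -/
def slopeGroup {p : ℕ} (n : Fin p → ℕ) : Set ℝ :=
  {x | ∃ k : Fin p → ℤ, x = ∏ i, (n i : ℝ) ^ k i}

/-- The ring `ℤ[1/n₁, …, 1/n_p]`, as a subring of the reals. -/
def breakRing {p : ℕ} (n : Fin p → ℕ) : Subring ℝ :=
  Subring.closure (Set.range fun i => (n i : ℝ)⁻¹)

/-- `F` is a lift to the real line of the orientation preserving homeomorphism `f` of the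
circle `ℝ / rℤ` of length `r`. -/
structure IsLift {r : ℝ} (f : AddCircle r ≃ₜ AddCircle r) (F : ℝ → ℝ) : Prop where
  continuous : Continuous F
  strictMono : StrictMono F
  map_add_period : ∀ x, F (x + r) = F x + r
  coe_map : ∀ x : ℝ, ((F x : ℝ) : AddCircle r) = f (x : AddCircle r)

/-- `T_{r,Λ,A}`: the orientation preserving homeomorphisms `f` of `ℝ / rℤ` that have a lift `F`
and a finite subdivision `0 = a 0 < a 1 < ⋯ < a k = r` such that the points `a i` and their
images lie in `A`, and `F` is affine with slope in `Λ` on each `[a i, a (i + 1)]`.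
The base point `0` counts as a subdivision point, so its image lies in `A` as well. -/
def plGroup (r : ℝ) (Λ A : Set ℝ) : Set (AddCircle r ≃ₜ AddCircle r) :=
  {f | ∃ F : ℝ → ℝ, IsLift f F ∧
    ∃ (k : ℕ) (a : Fin (k + 1) → ℝ), StrictMono a ∧ a 0 = 0 ∧ a (Fin.last k) = r ∧
      (∀ i, a i ∈ A ∧ F (a i) ∈ A) ∧
      ∀ i : Fin k, ∃ c ∈ Λ, ∃ b : ℝ,
        ∀ x ∈ Set.Icc (a i.castSucc) (a i.succ), F x = c * x + b}

/-- The Thompson-Stein group `T_{r,(n₁,…,n_p)}`. -/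
def thompsonStein {p : ℕ} (n : Fin p → ℕ) (r : ℝ) : Set (AddCircle r ≃ₜ AddCircle r) :=
  plGroup r (slopeGroup n) (breakRing n : Set ℝ)

/-- The rotation number of `f`, which is the class modulo `1` of
`lim F^m(0) / (r m)` for a lift `F` of `f`, is the class of the real number `ρ`. -/
def HasRotationNumber {r : ℝ} (f : AddCircle r ≃ₜ AddCircle r) (ρ : ℝ) : Prop :=
  ∃ (F : ℝ → ℝ) (τ : ℝ), IsLift f F ∧
    Tendsto (fun m : ℕ => F^[m] 0 / (r * m)) atTop (𝓝 τ) ∧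
    (τ : AddCircle (1 : ℝ)) = (ρ : AddCircle (1 : ℝ))

/-- A group of homeomorphisms acts freely: only the identity has fixed points. -/
def ActsFreely {X : Type*} [TopologicalSpace X] (H : Subgroup (X ≃ₜ X)) : Prop :=
  ∀ h ∈ H, ∀ x : X, h x = x → h = 1

/-- The group `H` is free abelian of rank `k`. -/
def IsFreeAbelianOfRank {G : Type*} [Group G] (H : Subgroup G) (k : ℕ) : Prop :=
  Nonempty (H ≃* Multiplicative (Fin k → ℤ))

/-- The set of homeomorphisms `G` contains a free abelian group of rank `k` acting freely. -/
def ContainsFreeAction {X : Type*} [TopologicalSpace X] (G : Set (X ≃ₜ X)) (k : ℕ) : Prop :=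
  ∃ H : Subgroup (X ≃ₜ X), (H : Set (X ≃ₜ X)) ⊆ G ∧ IsFreeAbelianOfRank H k ∧ ActsFreely H

/-- `G` contains `k` commuting homeomorphisms with irrational rotation numbers `ρ i` such that
`1` and the `ρ i` are linearly independent over `ℚ`. -/
def ContainsIndependentRotations {r : ℝ} (G : Set (AddCircle r ≃ₜ AddCircle r)) (k : ℕ) : Prop :=
  ∃ (g : Fin k → (AddCircle r ≃ₜ AddCircle r)) (ρ : Fin k → ℝ),
    (∀ i, g i ∈ G) ∧ (∀ i j, Commute (g i) (g j)) ∧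
    (∀ i, HasRotationNumber (g i) (ρ i)) ∧ (∀ i, Irrational (ρ i)) ∧
    LinearIndependent ℚ (Fin.cons 1 ρ : Fin (k + 1) → ℝ)

end ThompsonStein

namespace ThompsonStein

/-! ### The slope group and the break ring -/

section Arithmetic

variable {p : ℕ} {n : Fin p → ℕ}

/-! Write `A` for the break ring. Rotation numbers are additive on commuting homeomorphisms, and
rotation number zero means a fixed point. Hence a free action of `ℤ^k` amounts to `k` commuting
elements whose rotation numbers are independent together with 1 (`containsFreeAction_iff`), and (A)
and (B) become statements about rotation numbers.

Rank two. Let `f` have no periodic point and let `f`, `g` generate `ℤ²`. An element of the group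
that commutes with `f` and fixes a point is trivial, because the frontier of its fixed set is finite
and `f`-invariant (`eq_one_of_commute_of_fixedPoint`); so the action is free. The logarithmic jumps
of the derivative form a finitely supported cocycle, and over a free `ℤ²` action such a cocycle is a
coboundary: the jumps of `f` are `u - u ∘ f` with `u` finitely supported (`exists_coboundary`). The
same `u` serves every element of the centralizer of `f` (`coboundary_of_commute`). Let `W` be a step
function on the line with jumps `u`, and let `C` be the total mass of `u`. A primitive of `exp W`
conjugates the lifts to affine maps, and the translation by `r` to an affine map of slope `exp C`.
If `C ≠ 0`, a logarithm centred at the common fixed point of these maps shows that the rotation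
number is `l / C`, with `exp l` and `exp C` in the slope group. If `C = 0`, the rotation number is
rational, so `f` has a periodic point (`exists_rotationNumber_of_coboundary`). This gives (C),
rational rotation numbers being logarithmic quotients anyway. It gives (B) for `p ≥ 2`: with the
common denominator `C`, the numbers 1, `ρ₁`, …, `ρ_p` lie in a rational space spanned by `p`
elements.

For `p = 1` every element has a periodic point (`exists_periodicPoint`). Otherwise the orbit of 0 is
infinite in `A` modulo `r`, so the exponents of the denominators tend to infinity along it in both
directions. Where this exponent is large, the logarithm of the slope is exactly its drop times `log
n₁`. So the slopes of `f^m` and `f^(-m)` at 0 both tend to zero, against Denjoy's inequality at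
closest return times (`exists_denjoy_bound`).

Constructions. An identification of the circle with the quotient of the positive reals by powers of
a slope `c` turns multiplication by `l` into a homeomorphism with rotation number `log l / log c`
(`exists_multiplications`). For (A), `c` is one of the generators and the `l` are powers of the
others. For (C'), `c = β`, and the fundamental interval is matched with `[0, d]` by
`PLEquiv.gcd_mul`. -/

theorem slopeGroup_pos (hn : ∀ i, 1 < n i) {x : ℝ} (hx : x ∈ slopeGroup n) : 0 < x := by
  obtain ⟨k, rfl⟩ := hx
  exact Finset.prod_pos fun i _ => zpow_pos (by exact_mod_cast (hn i).le) _

theorem slopeGroup_one : (1 : ℝ) ∈ slopeGroup n := ⟨0, by simp⟩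

theorem slopeGroup_mul (hn : ∀ i, 1 < n i) {x y : ℝ} (hx : x ∈ slopeGroup n)
    (hy : y ∈ slopeGroup n) : x * y ∈ slopeGroup n := by
  obtain ⟨k, rfl⟩ := hx
  obtain ⟨l, rfl⟩ := hy
  refine ⟨k + l, ?_⟩
  rw [← Finset.prod_mul_distrib]
  refine Finset.prod_congr rfl fun i _ => ?_
  rw [Pi.add_apply, zpow_add₀]
  have := hn i
  positivity

theorem slopeGroup_inv {x : ℝ} (hx : x ∈ slopeGroup n) : x⁻¹ ∈ slopeGroup n := by
  obtain ⟨k, rfl⟩ := hx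
  exact ⟨-k, by simp⟩

theorem slopeGroup_div (hn : ∀ i, 1 < n i) {x y : ℝ} (hx : x ∈ slopeGroup n)
    (hy : y ∈ slopeGroup n) : x / y ∈ slopeGroup n := by
  rw [div_eq_mul_inv]
  exact slopeGroup_mul hn hx (slopeGroup_inv hy)

theorem slopeGroup_gen (i : Fin p) : (n i : ℝ) ∈ slopeGroup n := by
  refine ⟨Pi.single i 1, ?_⟩
  rw [Finset.prod_eq_single i] <;> simp +contextual

theorem slopeGroup_pow (hn : ∀ i, 1 < n i) {x : ℝ} (hx : x ∈ slopeGroup n) (k : ℕ) :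
    x ^ k ∈ slopeGroup n := by
  induction k with
  | zero => simpa using slopeGroup_one
  | succ k ih => rw [pow_succ]; exact slopeGroup_mul hn ih hx

theorem slopeGroup_zpow (hn : ∀ i, 1 < n i) {x : ℝ} (hx : x ∈ slopeGroup n) (k : ℤ) :
    x ^ k ∈ slopeGroup n := by
  cases k with
  | ofNat k => simpa using slopeGroup_pow hn hx k
  | negSucc k => rw [zpow_negSucc]; exact slopeGroup_inv (slopeGroup_pow hn hx _)

theorem inv_mem_breakRing (i : Fin p) : (n i : ℝ)⁻¹ ∈ breakRing n :=
  Subring.subset_closure ⟨i, rfl⟩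

theorem slopeGroup_subset {x : ℝ} (hx : x ∈ slopeGroup n) :
    x ∈ breakRing n := by
  obtain ⟨k, rfl⟩ := hx
  refine prod_mem fun i _ => ?_
  rcases k i with k | k
  · simpa using pow_mem (natCast_mem (breakRing n) (n i)) k
  · rw [zpow_negSucc, ← inv_pow]
    exact pow_mem (inv_mem_breakRing i) _

/-- Slopes are units of the break ring. -/
theorem slope_mul_mem_iff (hn : ∀ i, 1 < n i) {c x : ℝ} (hc : c ∈ slopeGroup n) :
    c * x ∈ breakRing n ↔ x ∈ breakRing n := by
  refine ⟨fun h => ?_, fun h => mul_mem (slopeGroup_subset hc) h⟩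
  have := mul_mem (slopeGroup_subset (slopeGroup_inv hc)) h
  rwa [inv_mul_cancel_left₀ (slopeGroup_pos hn hc).ne'] at this

theorem exists_rat_of_mem_breakRing {x : ℝ} (hx : x ∈ breakRing n) : ∃ q : ℚ, (q : ℝ) = x := by
  have : breakRing n ≤ (Rat.castHom ℝ).range := by
    refine Subring.closure_le.2 ?_
    rintro _ ⟨i, rfl⟩
    exact ⟨(n i : ℚ)⁻¹, by simp⟩
  exact this hx

/-- Elements of the break ring have a power of `∏ i, n i` as denominator. -/
theorem exists_pow_mul_eq_int (hn : ∀ i, 1 < n i) {x : ℝ} (hx : x ∈ breakRing n) :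
    ∃ (N : ℕ) (z : ℤ), (∏ i, (n i : ℝ)) ^ N * x = z := by
  induction hx using Subring.closure_induction with
  | mem x hx =>
    obtain ⟨i, rfl⟩ := hx
    refine ⟨1, ∏ j ∈ Finset.univ.erase i, (n j : ℤ), ?_⟩
    have : (n i : ℝ) ≠ 0 := by have := hn i; positivity
    rw [pow_one, ← Finset.mul_prod_erase _ _ (Finset.mem_univ i)]
    push_cast
    field_simp
  | zero => exact ⟨0, 0, by simp⟩
  | one => exact ⟨0, 1, by simp⟩
  | add x y _ _ hx hy =>
    obtain ⟨N, z, h⟩ := hx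
    obtain ⟨N', z', h'⟩ := hy
    refine ⟨N + N', (∏ i, (n i : ℤ)) ^ N' * z + (∏ i, (n i : ℤ)) ^ N * z', ?_⟩
    push_cast
    rw [← h, ← h']
    ring
  | neg x _ hx =>
    obtain ⟨N, z, h⟩ := hx
    exact ⟨N, -z, by push_cast; rw [← h]; ring⟩
  | mul x y _ _ hx hy =>
    obtain ⟨N, z, h⟩ := hx
    obtain ⟨N', z', h'⟩ := hy
    exact ⟨N + N', z * z', by push_cast; rw [← h, ← h']; ring⟩

end Arithmetic

/-! ### Germs of piecewise linear maps of the line -/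

section PiecewiseLinear

/-- `F` is affine with slope `a` on a left neighbourhood of `x`. -/
def AffL (F : ℝ → ℝ) (x a : ℝ) : Prop := ∀ᶠ y in 𝓝[≤] x, F y = F x + a * (y - x)

/-- `F` is affine with slope `a` on a right neighbourhood of `x`. -/
def AffR (F : ℝ → ℝ) (x a : ℝ) : Prop := ∀ᶠ y in 𝓝[≥] x, F y = F x + a * (y - x)

/-- The left slope of `F` at `x`. -/
noncomputable def ls (F : ℝ → ℝ) (x : ℝ) : ℝ := derivWithin F (Set.Iic x) x

/-- The right slope of `F` at `x`. -/
noncomputable def rs (F : ℝ → ℝ) (x : ℝ) : ℝ := derivWithin F (Set.Ici x) x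

/-- `F` is affine with slopes in `⟨n i⟩` on one-sided neighbourhoods of every point, it breaks
only at points of `ℤ[1/n i]`, and it maps `0` into `ℤ[1/n i]`. -/
structure IsPL {p : ℕ} (n : Fin p → ℕ) (F : ℝ → ℝ) : Prop where
  germ : ∀ x, ∃ a ∈ slopeGroup n, ∃ b ∈ slopeGroup n,
    AffL F x a ∧ AffR F x b ∧ (a ≠ b → x ∈ breakRing n)
  map_zero : F 0 ∈ breakRing n

variable {F G : ℝ → ℝ} {x a b : ℝ}

theorem AffR.hasDerivWithinAt (h : AffR F x b) : HasDerivWithinAt F b (Set.Ici x) x := by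
  have h1 : HasDerivWithinAt (fun y => F x + b * (y - x)) b (Set.Ici x) x := by
    simpa using (((hasDerivAt_id x).sub_const x).const_mul b).const_add (F x) |>.hasDerivWithinAt
  exact h1.congr_of_eventuallyEq h (by simp)

theorem AffL.hasDerivWithinAt (h : AffL F x b) : HasDerivWithinAt F b (Set.Iic x) x := by
  have h1 : HasDerivWithinAt (fun y => F x + b * (y - x)) b (Set.Iic x) x := by
    simpa using (((hasDerivAt_id x).sub_const x).const_mul b).const_add (F x) |>.hasDerivWithinAt
  exact h1.congr_of_eventuallyEq h (by simp)

theorem AffR.rs_eq (h : AffR F x b) : rs F x = b :=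
  h.hasDerivWithinAt.derivWithin (uniqueDiffOn_Ici x x Set.self_mem_Ici)

theorem AffL.ls_eq (h : AffL F x b) : ls F x = b :=
  h.hasDerivWithinAt.derivWithin (uniqueDiffOn_Iic x x Set.self_mem_Iic)

theorem affR_of_nhds (h : ∀ᶠ y in 𝓝 x, F y = F x + a * (y - x)) : AffR F x a :=
  h.filter_mono nhdsWithin_le_nhds

theorem affL_of_nhds (h : ∀ᶠ y in 𝓝 x, F y = F x + a * (y - x)) : AffL F x a :=
  h.filter_mono nhdsWithin_le_nhds

theorem AffR.eventually_right (h : AffR F x b) : ∀ᶠ y in 𝓝[>] x, AffL F y b ∧ AffR F y b := by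
  obtain ⟨u, hu, hs⟩ := mem_nhdsGE_iff_exists_Ico_subset.1 h
  filter_upwards [Ioo_mem_nhdsGT hu] with y hy
  have : ∀ᶠ z in 𝓝 y, F z = F y + b * (z - y) := by
    filter_upwards [Ioo_mem_nhds hy.1 hy.2] with z hz
    have h1 : F z = F x + b * (z - x) := hs ⟨hz.1.le, hz.2⟩
    have h2 : F y = F x + b * (y - x) := hs ⟨hy.1.le, hy.2⟩
    rw [h1, h2]; ring
  exact ⟨affL_of_nhds this, affR_of_nhds this⟩

theorem AffL.eventually_left (h : AffL F x b) : ∀ᶠ y in 𝓝[<] x, AffL F y b ∧ AffR F y b := by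
  obtain ⟨u, hu, hs⟩ := mem_nhdsLE_iff_exists_Ioc_subset.1 h
  filter_upwards [Ioo_mem_nhdsLT hu] with y hy
  have : ∀ᶠ z in 𝓝 y, F z = F y + b * (z - y) := by
    filter_upwards [Ioo_mem_nhds hy.1 hy.2] with z hz
    have h1 : F z = F x + b * (z - x) := hs ⟨hz.1, hz.2.le⟩
    have h2 : F y = F x + b * (y - x) := hs ⟨hy.1, hy.2.le⟩
    rw [h1, h2]; ring
  exact ⟨affL_of_nhds this, affR_of_nhds this⟩

theorem AffR.rs_eventually (h : AffR F x b) : ∀ᶠ y in 𝓝[>] x, rs F y = b :=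
  h.eventually_right.mono fun _ hy => hy.2.rs_eq

/-- There are no breaks just to the left of `x`, so right slopes there agree with the left slope at
`x`. Thus `rs F` is a right-continuous step function whose left limits are `ls F`. -/
theorem AffL.rs_eventually (h : AffL F x b) : ∀ᶠ y in 𝓝[<] x, rs F y = b :=
  h.eventually_left.mono fun _ hy => hy.2.rs_eq

theorem eventually_nhds_of_sides {P : ℝ → Prop} (hx : P x) (hl : ∀ᶠ y in 𝓝[<] x, P y)
    (hr : ∀ᶠ y in 𝓝[>] x, P y) : ∀ᶠ y in 𝓝 x, P y := by
  rw [eventually_nhdsWithin_iff] at hl hr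
  filter_upwards [hl, hr] with y h1 h2
  rcases lt_trichotomy y x with h | h | h
  · exact h1 h
  · exact h ▸ hx
  · exact h2 h

/-- A function on the line that is constant near every point, on either side, is constant. -/
theorem eq_of_locally_const {Y : Type*} {κ : ℝ → Y} (hl : ∀ x, ∀ᶠ y in 𝓝[<] x, κ y = κ x)
    (hr : ∀ x, ∀ᶠ y in 𝓝[>] x, κ y = κ x) (x y : ℝ) : κ x = κ y :=
  ((IsLocallyConstant.iff_eventually_eq κ).2 fun z =>
    eventually_nhds_of_sides rfl (hl z) (hr z)).apply_eq_of_preconnectedSpace x y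

theorem continuousAt_of_aff (hl : AffL F x a) (hr : AffR F x b) : ContinuousAt F x :=
  continuousAt_iff_continuous_left_right.2
    ⟨hl.hasDerivWithinAt.continuousWithinAt, hr.hasDerivWithinAt.continuousWithinAt⟩

theorem strictMono_of_affR (hc : Continuous F) (h : ∀ x, ∃ b, 0 < b ∧ AffR F x b) :
    StrictMono F := by
  have key : ∀ x, ∀ᶠ y in 𝓝[>] x, F x < F y := fun x => by
    obtain ⟨b, hb, hF⟩ := h x
    have := hF.filter_mono (nhdsWithin_mono x Set.Ioi_subset_Ici_self)
    filter_upwards [this, self_mem_nhdsWithin] with y hy hxy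
    rw [hy]
    have : 0 < b * (y - x) := mul_pos hb (sub_pos.2 hxy)
    linarith
  have mono : Monotone F := fun u v huv => by
    have hcl : IsClosed ({y | F u ≤ F y} ∩ Set.Icc u v) :=
      (isClosed_le continuous_const hc).inter isClosed_Icc
    -- Continuous induction along `[u, v]`: the set where `F u ≤ F y` is closed and can always be
    -- extended to the right.
    refine hcl.Icc_subset_of_forall_mem_nhdsWithin (le_refl (F u)) (fun x hx => ?_) ⟨huv, le_rfl⟩
    filter_upwards [key x] with y hy
    exact hx.1.trans hy.le
  intro u v huv
  obtain ⟨w, hw, h1, h2⟩ := ((key u).and (Ioo_mem_nhdsGT huv)).exists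
  exact hw.trans_le (mono h2.le)

theorem AffR.comp (hF : AffR F (G x) a) (hG : AffR G x b) (hb : 0 < b) :
    AffR (F ∘ G) x (a * b) := by
  have ht : Tendsto G (𝓝[≥] x) (𝓝[≥] G x) := by
    refine tendsto_nhdsWithin_iff.2 ⟨hG.hasDerivWithinAt.continuousWithinAt, ?_⟩
    filter_upwards [hG, self_mem_nhdsWithin] with y hy hxy
    rw [Set.mem_Ici, hy]
    have := mul_nonneg hb.le (sub_nonneg.2 hxy)
    linarith
  filter_upwards [ht.eventually hF, hG] with y h1 h2
  rw [Function.comp_apply, h1, h2, Function.comp_apply]; ring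

theorem AffL.comp (hF : AffL F (G x) a) (hG : AffL G x b) (hb : 0 < b) :
    AffL (F ∘ G) x (a * b) := by
  have ht : Tendsto G (𝓝[≤] x) (𝓝[≤] G x) := by
    refine tendsto_nhdsWithin_iff.2 ⟨hG.hasDerivWithinAt.continuousWithinAt, ?_⟩
    filter_upwards [hG, self_mem_nhdsWithin] with y hy hxy
    rw [Set.mem_Iic, hy]
    have := mul_nonneg hb.le (sub_nonneg.2 hxy)
    linarith
  filter_upwards [ht.eventually hF, hG] with y h1 h2
  rw [Function.comp_apply, h1, h2, Function.comp_apply]; ring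

theorem AffR.of_comp (hF : AffR F (G x) a) (h : AffR (F ∘ G) x b) (hc : Continuous G)
    (hm : Monotone G) (ha : 0 < a) : AffR G x (b / a) := by
  have ht : Tendsto G (𝓝[≥] x) (𝓝[≥] G x) :=
    tendsto_nhdsWithin_iff.2 ⟨hc.continuousWithinAt, by
      filter_upwards [self_mem_nhdsWithin] with y hy using hm hy⟩
  filter_upwards [ht.eventually hF, h] with y h1 h2
  rw [Function.comp_apply, h1, Function.comp_apply] at h2
  field_simp
  linarith

theorem AffL.of_comp (hF : AffL F (G x) a) (h : AffL (F ∘ G) x b) (hc : Continuous G)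
    (hm : Monotone G) (ha : 0 < a) : AffL G x (b / a) := by
  have ht : Tendsto G (𝓝[≤] x) (𝓝[≤] G x) :=
    tendsto_nhdsWithin_iff.2 ⟨hc.continuousWithinAt, by
      filter_upwards [self_mem_nhdsWithin] with y hy using hm hy⟩
  filter_upwards [ht.eventually hF, h] with y h1 h2
  rw [Function.comp_apply, h1, Function.comp_apply] at h2
  field_simp
  linarith

namespace IsPL

variable {p : ℕ} {n : Fin p → ℕ}

theorem affR (hF : IsPL n F) (x : ℝ) : AffR F x (rs F x) := by
  obtain ⟨a, _, b, _, _, h, _⟩ := hF.germ x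
  rwa [h.rs_eq]

theorem affL (hF : IsPL n F) (x : ℝ) : AffL F x (ls F x) := by
  obtain ⟨a, _, b, _, h, _⟩ := hF.germ x
  rwa [h.ls_eq]

theorem rs_mem (hF : IsPL n F) (x : ℝ) : rs F x ∈ slopeGroup n := by
  obtain ⟨a, _, b, hb, _, h, _⟩ := hF.germ x
  rwa [h.rs_eq]

theorem ls_mem (hF : IsPL n F) (x : ℝ) : ls F x ∈ slopeGroup n := by
  obtain ⟨a, ha, b, _, h, _⟩ := hF.germ x
  rwa [h.ls_eq]

theorem mem_of_ne (hF : IsPL n F) (h : ls F x ≠ rs F x) : x ∈ breakRing n := by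
  obtain ⟨a, _, b, _, h1, h2, h3⟩ := hF.germ x
  rw [h1.ls_eq, h2.rs_eq] at h
  exact h3 h

theorem continuous (hF : IsPL n F) : Continuous F :=
  continuous_iff_continuousAt.2 fun x => continuousAt_of_aff (hF.affL x) (hF.affR x)

theorem rs_pos (hn : ∀ i, 1 < n i) (hF : IsPL n F) (x : ℝ) : 0 < rs F x :=
  slopeGroup_pos hn (hF.rs_mem x)

theorem ls_pos (hn : ∀ i, 1 < n i) (hF : IsPL n F) (x : ℝ) : 0 < ls F x :=
  slopeGroup_pos hn (hF.ls_mem x)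

theorem strictMono (hn : ∀ i, 1 < n i) (hF : IsPL n F) : StrictMono F :=
  strictMono_of_affR hF.continuous fun x => ⟨_, hF.rs_pos hn x, hF.affR x⟩

/-- The intercept is constant on each affine piece. At a break `x` it changes by a difference of
slopes times `x`, which lies in `A` because `x` does. So its class modulo `A` is the class of `F 0`,
which is zero. -/
theorem sub_rs_mul_mem (hF : IsPL n F) (x : ℝ) :
    F x - rs F x * x ∈ breakRing n := by
  let A := (breakRing n).toAddSubgroup
  have h := eq_of_locally_const (κ := fun x => ((F x - rs F x * x : ℝ) : ℝ ⧸ A)) ?_ ?_ 0 x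
  · rw [QuotientAddGroup.eq] at h
    have h' : -(F 0 - rs F 0 * 0) + (F x - rs F x * x) ∈ breakRing n := h
    have := add_mem hF.map_zero h'
    simpa using this
  · intro x
    filter_upwards [(hF.affL x).rs_eventually,
      (hF.affL x).filter_mono (nhdsWithin_mono x Set.Iio_subset_Iic_self)] with y h1 h2
    rw [QuotientAddGroup.eq, h1, h2]
    change _ ∈ breakRing n
    by_cases hb : ls F x = rs F x
    · rw [← hb]
      ring_nf
      exact zero_mem _
    · have hx := hF.mem_of_ne hb
      have : -(F x + ls F x * (y - x) - ls F x * y) + (F x - rs F x * x)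
          = (ls F x - rs F x) * x := by ring
      rw [this]
      exact mul_mem (sub_mem (slopeGroup_subset (hF.ls_mem x))
        (slopeGroup_subset (hF.rs_mem x))) hx
  · intro x
    filter_upwards [(hF.affR x).rs_eventually,
      (hF.affR x).filter_mono (nhdsWithin_mono x Set.Ioi_subset_Ici_self)] with y h1 h2
    congr 1
    rw [h1, h2]
    ring

/-- The intercept at `x` lies in `A` and the slope is a unit of `A`. -/
theorem mem_iff (hn : ∀ i, 1 < n i) (hF : IsPL n F) {x : ℝ} :
    F x ∈ breakRing n ↔ x ∈ breakRing n := by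
  rw [← slope_mul_mem_iff (x := x) hn (hF.rs_mem x)]
  have h := hF.sub_rs_mul_mem x
  constructor <;> intro h'
  · simpa using sub_mem h' h
  · simpa using add_mem h h'

theorem affR_comp (hn : ∀ i, 1 < n i) (hF : IsPL n F) (hG : IsPL n G) (x : ℝ) :
    AffR (F ∘ G) x (rs F (G x) * rs G x) :=
  (hF.affR (G x)).comp (hG.affR x) (hG.rs_pos hn x)

theorem affL_comp (hn : ∀ i, 1 < n i) (hF : IsPL n F) (hG : IsPL n G) (x : ℝ) :
    AffL (F ∘ G) x (ls F (G x) * ls G x) :=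
  (hF.affL (G x)).comp (hG.affL x) (hG.ls_pos hn x)

theorem rs_comp (hn : ∀ i, 1 < n i) (hF : IsPL n F) (hG : IsPL n G) (x : ℝ) :
    rs (F ∘ G) x = rs F (G x) * rs G x := (hF.affR_comp hn hG x).rs_eq

theorem ls_comp (hn : ∀ i, 1 < n i) (hF : IsPL n F) (hG : IsPL n G) (x : ℝ) :
    ls (F ∘ G) x = ls F (G x) * ls G x := (hF.affL_comp hn hG x).ls_eq

theorem comp (hn : ∀ i, 1 < n i) (hF : IsPL n F) (hG : IsPL n G) : IsPL n (F ∘ G) where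
  germ x := by
    refine ⟨_, slopeGroup_mul hn (hF.ls_mem (G x)) (hG.ls_mem x), _,
      slopeGroup_mul hn (hF.rs_mem (G x)) (hG.rs_mem x), hF.affL_comp hn hG x,
      hF.affR_comp hn hG x, fun h => ?_⟩
    by_cases h1 : ls G x = rs G x
    · refine (hG.mem_iff hn).1 (hF.mem_of_ne fun h2 => h ?_)
      rw [h1, h2]
    · exact hG.mem_of_ne h1
  map_zero := (hF.mem_iff hn).2 hG.map_zero

/-- Left cancellation. It covers inverses, where `F ∘ G` is the identity, as well as maps known only
through a conjugacy, such as the multiplications read in a developing map. -/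
theorem of_comp (hn : ∀ i, 1 < n i) (hF : IsPL n F) (h : IsPL n (F ∘ G)) (hc : Continuous G)
    (hm : Monotone G) : IsPL n G where
  germ x := by
    refine ⟨_, slopeGroup_div hn (h.ls_mem x) (hF.ls_mem (G x)), _,
      slopeGroup_div hn (h.rs_mem x) (hF.rs_mem (G x)),
      (hF.affL (G x)).of_comp (h.affL x) hc hm (hF.ls_pos hn _),
      (hF.affR (G x)).of_comp (h.affR x) hc hm (hF.rs_pos hn _), fun h' => ?_⟩
    by_cases h1 : ls (F ∘ G) x = rs (F ∘ G) x
    · refine (h.mem_iff hn).1 ((hF.mem_iff hn).2 (hF.mem_of_ne fun h2 => h' ?_))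
      rw [h1, h2]
    · exact h.mem_of_ne h1
  map_zero := (hF.mem_iff hn).1 h.map_zero

theorem affine (c b : ℝ) (hc : c ∈ slopeGroup n) (hb : b ∈ breakRing n) :
    IsPL n (fun x => c * x + b) where
  germ x := by
    have : ∀ᶠ y in 𝓝 x, c * y + b = c * x + b + c * (y - x) :=
      Eventually.of_forall fun y => by ring
    exact ⟨c, hc, c, hc, affL_of_nhds this, affR_of_nhds this, fun h => absurd rfl h⟩
  map_zero := by simpa using hb

theorem id : IsPL n (id : ℝ → ℝ) := by
  have := affine (n := n) 1 0 slopeGroup_one (zero_mem _)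
  simpa [Function.id_def] using this

end IsPL

end PiecewiseLinear

/-! ### Lifts of circle homeomorphisms -/

section Lifts

variable {r : ℝ}

theorem coe_eq_coe_iff (x y : ℝ) : (x : AddCircle r) = y ↔ ∃ k : ℤ, y = x + k * r := by
  rw [QuotientAddGroup.eq, AddSubgroup.mem_zmultiples_iff]
  constructor
  · rintro ⟨k, hk⟩
    exact ⟨k, by rw [zsmul_eq_mul] at hk; linarith⟩
  · rintro ⟨k, hk⟩
    exact ⟨k, by rw [zsmul_eq_mul]; linarith⟩

theorem map_add_int_mul {F : ℝ → ℝ} (hF : ∀ x, F (x + r) = F x + r) (x : ℝ) (k : ℤ) :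
    F (x + k * r) = F x + k * r := by
  induction k with
  | zero => simp
  | succ k ih =>
    have := hF (x + k * r)
    push_cast at *
    rw [ih] at this
    rw [add_mul, one_mul, ← add_assoc, this]; ring
  | pred k ih =>
    have := hF (x + (-k - 1 : ℝ) * r)
    push_cast at *
    rw [show x + (-k - 1 : ℝ) * r + r = x + -k * r by ring, ih] at this
    linarith

namespace IsLift

variable {f g : AddCircle r ≃ₜ AddCircle r} {F G : ℝ → ℝ}

theorem map_add_int_mul (hF : IsLift f F) (x : ℝ) (k : ℤ) : F (x + k * r) = F x + k * r :=
  ThompsonStein.map_add_int_mul hF.map_add_period x k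

theorem id : IsLift (1 : AddCircle r ≃ₜ AddCircle r) (id : ℝ → ℝ) :=
  ⟨continuous_id, strictMono_id, fun _ => rfl, fun _ => rfl⟩

theorem comp (hF : IsLift f F) (hG : IsLift g G) : IsLift (f * g) (F ∘ G) where
  continuous := hF.continuous.comp hG.continuous
  strictMono := hF.strictMono.comp hG.strictMono
  map_add_period x := by simp [hG.map_add_period, hF.map_add_period]
  coe_map x := by
    rw [Function.comp_apply, hF.coe_map, hG.coe_map]; rfl

theorem surjective (hr : 0 < r) (hF : IsLift f F) : Function.Surjective F := by
  intro y
  obtain ⟨k, hk⟩ := exists_nat_gt (|y - F 0| / r)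
  rw [div_lt_iff₀ hr, abs_lt] at hk
  have h1 := hF.map_add_int_mul 0 k
  have h2 := hF.map_add_int_mul 0 (-k)
  push_cast at h1 h2
  exact mem_range_of_exists_le_of_exists_ge hF.continuous ⟨_, h2.le.trans (by linarith)⟩
    ⟨_, le_trans (by linarith) h1.ge⟩

theorem exists_inv (hr : 0 < r) (hF : IsLift f F) :
    ∃ G : ℝ → ℝ, IsLift f⁻¹ G ∧ (∀ x, F (G x) = x) ∧ ∀ x, G (F x) = x := by
  let e := hF.strictMono.orderIsoOfSurjective F (hF.surjective hr)
  have h1 : ∀ x, F (e.symm x) = x := fun x => e.apply_symm_apply x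
  have h2 : ∀ x, e.symm (F x) = x := fun x => e.symm_apply_apply x
  refine ⟨e.symm, ⟨e.symm.continuous, e.symm.strictMono, fun x => ?_, fun x => ?_⟩, h1, h2⟩
  · apply hF.strictMono.injective
    rw [h1, hF.map_add_period, h1]
  · apply f.injective
    rw [← hF.coe_map, h1]
    exact (f.apply_symm_apply _).symm

theorem exists_homeomorph (hr : 0 < r) (hc : Continuous F) (hm : StrictMono F)
    (hp : ∀ x, F (x + r) = F x + r) : ∃ f : AddCircle r ≃ₜ AddCircle r, IsLift f F := by
  have hk := ThompsonStein.map_add_int_mul hp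
  have hsurj : Function.Surjective F := by
    intro y
    obtain ⟨k, hk'⟩ := exists_nat_gt (|y - F 0| / r)
    rw [div_lt_iff₀ hr, abs_lt] at hk'
    have h1 := hk 0 k
    have h2 := hk 0 (-k)
    push_cast at h1 h2
    exact mem_range_of_exists_le_of_exists_ge hc ⟨_, h2.le.trans (by linarith)⟩
      ⟨_, le_trans (by linarith) h1.ge⟩
  let e := hm.orderIsoOfSurjective F hsurj
  have h1 : ∀ x, F (e.symm x) = x := fun x => e.apply_symm_apply x
  have h2 : ∀ x, e.symm (F x) = x := fun x => e.symm_apply_apply x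
  have hk2 : ∀ (x : ℝ) (k : ℤ), e.symm (x + k * r) = e.symm x + k * r := fun x k => by
    apply hm.injective
    rw [h1, hk, h1]
  have lift : ∀ K : ℝ → ℝ, (∀ (x : ℝ) (k : ℤ), K (x + k * r) = K x + k * r) →
      ∀ x y : ℝ, (QuotientAddGroup.leftRel (AddSubgroup.zmultiples r)) x y →
        ((K x : ℝ) : AddCircle r) = (K y : ℝ) := by
    intro K hK x y hxy
    have : (x : AddCircle r) = y := Quotient.sound hxy
    rw [coe_eq_coe_iff] at this ⊢
    obtain ⟨k, rfl⟩ := this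
    exact ⟨k, hK x k⟩
  refine ⟨{ toFun := Quotient.lift (fun x => ((F x : ℝ) : AddCircle r)) (lift F hk)
            invFun := Quotient.lift (fun x => ((e.symm x : ℝ) : AddCircle r)) (lift _ hk2)
            left_inv := ?_
            right_inv := ?_
            continuous_toFun := ?_
            continuous_invFun := ?_ }, ⟨hc, hm, hp, fun x => rfl⟩⟩
  · intro x
    induction x using QuotientAddGroup.induction_on with
    | H x => exact congrArg _ (h2 x)
  · intro x
    induction x using QuotientAddGroup.induction_on with
    | H x => exact congrArg _ (h1 x)
  · exact Continuous.quotient_lift ((AddCircle.continuous_mk' r).comp hc) _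
  · exact Continuous.quotient_lift ((AddCircle.continuous_mk' r).comp e.symm.continuous) _

end IsLift

end Lifts

/-! ### Subdivisions and germs; the Thompson-Stein group is a group -/

section Subdivision

variable {p : ℕ} {n : Fin p → ℕ} {r : ℝ}

/-- A piecewise linear map without breaks inside an interval is affine there. -/
theorem IsPL.eq_affine (hF : IsPL n F) {u v : ℝ} (huv : u < v)
    (h : ∀ x ∈ Set.Ioo u v, ls F x = rs F x) :
    ∀ x ∈ Set.Icc u v, F x = F u + rs F u * (x - u) := by
  have hrs : ∀ x ∈ Set.Ioo u v, rs F x = rs F u := by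
    obtain ⟨w, hw, hw1, hw2⟩ :=
      ((hF.affR u).rs_eventually.and (Ioo_mem_nhdsGT huv)).exists
    have hloc : ∀ x ∈ Set.Ioo u v, ∀ᶠ y in 𝓝 x, rs F y = rs F x := fun x hx =>
      eventually_nhds_of_sides rfl (h x hx ▸ (hF.affL x).rs_eventually)
        (hF.affR x).rs_eventually
    have hl : IsLocallyConstant fun x : Set.Ioo u v => rs F x :=
      (IsLocallyConstant.iff_eventually_eq _).2 fun x =>
        continuous_subtype_val.continuousAt.eventually (hloc x x.2)
    have : PreconnectedSpace (Set.Ioo u v) :=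
      Subtype.preconnectedSpace isPreconnected_Ioo
    intro x hx
    rw [← hw]
    exact hl.apply_eq_of_preconnectedSpace ⟨x, hx⟩ ⟨w, hw1, hw2⟩
  have hrs' : ∀ x ∈ Set.Ico u v, rs F x = rs F u := fun x hx => by
    rcases hx.1.eq_or_lt with rfl | h'
    · rfl
    · exact hrs x ⟨h', hx.2⟩
  have key := constant_of_has_deriv_right_zero (f := fun x => F x - rs F u * x) (a := u) (b := v)
    (hF.continuous.sub (continuous_const.mul continuous_id)).continuousOn (fun x hx => by
      have h1 := (hF.affR x).hasDerivWithinAt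
      rw [hrs' x hx] at h1
      have h2 := h1.sub ((hasDerivWithinAt_id x _).const_mul (rs F u))
      simp only [mul_one, sub_self] at h2
      exact h2)
  intro x hx
  have := key x hx
  linarith

/-- Breaks are isolated, since a one-sided affine germ has no break at nearby points of its side;
compactness does the rest. -/
theorem IsPL.finite_breaks (hF : IsPL n F) (u v : ℝ) :
    {x ∈ Set.Icc u v | ls F x ≠ rs F x}.Finite := by
  have hloc : ∀ x, ∀ᶠ y in 𝓝 x, y ≠ x → ls F y = rs F y := fun x => by
    refine eventually_nhds_of_sides (fun h => absurd rfl h) ?_ ?_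
    · filter_upwards [(hF.affL x).eventually_left] with y hy _
      rw [hy.1.ls_eq, hy.2.rs_eq]
    · filter_upwards [(hF.affR x).eventually_right] with y hy _
      rw [hy.1.ls_eq, hy.2.rs_eq]
  have : ∀ K : Set ℝ, IsCompact K → {x ∈ K | ls F x ≠ rs F x}.Finite := by
    intro K hK
    refine hK.induction_on (p := fun K => {x ∈ K | ls F x ≠ rs F x}.Finite) (by simp)
      (fun s t hst ht => ht.subset fun x hx => ⟨hst hx.1, hx.2⟩)
      (fun s t hs ht => (hs.union ht).subset ?_) (fun x _ => ?_)
    · rintro x ⟨hx | hx, h⟩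
      exacts [Or.inl ⟨hx, h⟩, Or.inr ⟨hx, h⟩]
    · refine ⟨_, mem_nhdsWithin_of_mem_nhds (hloc x), (Set.finite_singleton x).subset ?_⟩
      rintro y ⟨hy, h⟩
      by_contra hne
      exact h (hy hne)
  exact this _ isCompact_Icc

theorem IsPL.exists_subdivision (hn : ∀ i, 1 < n i) (hr : 0 < r) (hrA : r ∈ breakRing n)
    (hF : IsPL n F) :
    ∃ (k : ℕ) (a : Fin (k + 1) → ℝ), StrictMono a ∧ a 0 = 0 ∧ a (Fin.last k) = r ∧
      (∀ i, a i ∈ (breakRing n : Set ℝ) ∧ F (a i) ∈ (breakRing n : Set ℝ)) ∧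
      ∀ i : Fin k, ∃ c ∈ slopeGroup n, ∃ b : ℝ,
        ∀ x ∈ Set.Icc (a i.castSucc) (a i.succ), F x = c * x + b := by
  -- The endpoints and the breaks, listed in increasing order. No break can then lie strictly
  -- between consecutive points, as its index would lie between consecutive integers.
  let T : Finset ℝ := insert 0 (insert r (hF.finite_breaks 0 r).toFinset)
  have hT : ∀ x, x ∈ T ↔ x = 0 ∨ x = r ∨ (x ∈ Set.Icc 0 r ∧ ls F x ≠ rs F x) := fun x => by
    simp [T]
  have hT01 : ∀ x ∈ T, 0 ≤ x ∧ x ≤ r := by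
    intro x hx
    rcases (hT x).1 hx with rfl | rfl | h
    · exact ⟨le_rfl, hr.le⟩
    · exact ⟨hr.le, le_rfl⟩
    · exact h.1
  have hTA : ∀ x ∈ T, x ∈ breakRing n := by
    intro x hx
    rcases (hT x).1 hx with rfl | rfl | h
    · exact zero_mem _
    · exact hrA
    · exact hF.mem_of_ne h.2
  have h0 : (0 : ℝ) ∈ T := by simp [T]
  have hrT : r ∈ T := by simp [T]
  obtain ⟨k, hk⟩ : ∃ k, T.card = k + 1 :=
    Nat.exists_eq_add_one.2 (Finset.card_pos.2 ⟨0, h0⟩)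
  let a := T.orderEmbOfFin hk
  have hmem : ∀ i, a i ∈ T := fun i => T.orderEmbOfFin_mem hk i
  have hsurj : ∀ x ∈ T, ∃ i, a i = x := fun x hx => by
    have := T.range_orderEmbOfFin hk
    have hx' : x ∈ Set.range a := this ▸ hx
    exact hx'
  refine ⟨k, a, a.strictMono, ?_, ?_, fun i => ⟨hTA _ (hmem i), (hF.mem_iff hn).2 (hTA _ (hmem i))⟩,
    fun i => ⟨rs F (a i.castSucc), hF.rs_mem _,
      F (a i.castSucc) - rs F (a i.castSucc) * a i.castSucc, fun x hx => ?_⟩⟩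
  · obtain ⟨i, hi⟩ := hsurj 0 h0
    exact le_antisymm (hi ▸ a.monotone (Fin.zero_le i)) (hT01 _ (hmem 0)).1
  · obtain ⟨i, hi⟩ := hsurj r hrT
    exact le_antisymm (hT01 _ (hmem _)).2 (hi ▸ a.monotone (Fin.le_last i))
  · rw [hF.eq_affine (a.strictMono i.castSucc_lt_succ) (fun y hy => ?_) x hx]
    · ring
    · by_contra hne
      obtain ⟨j, hj⟩ := hsurj y ((hT y).2 (Or.inr (Or.inr
        ⟨⟨(hT01 _ (hmem _)).1.trans hy.1.le, hy.2.le.trans (hT01 _ (hmem _)).2⟩, hne⟩)))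
      rw [← hj] at hy
      have h1 := a.lt_iff_lt.1 hy.1
      have h2 := a.lt_iff_lt.1 hy.2
      rw [Fin.lt_def] at h1 h2
      simp at h1 h2
      omega

/-- In a subdivision, a half-open piece contains every given point. -/
theorem exists_piece {k : ℕ} {a : Fin (k + 1) → ℝ} {x : ℝ} (h0 : a 0 ≤ x)
    (hx : x < a (Fin.last k)) : ∃ i : Fin k, a i.castSucc ≤ x ∧ x < a i.succ := by
  by_contra! h
  have : ∀ i : Fin (k + 1), a i ≤ x := fun i => by
    induction i using Fin.induction with
    | zero => exact h0
    | succ i ih => exact h i ih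
  exact absurd hx (this _).not_gt

theorem isPL_of_subdivision (hr : 0 < r) (hrA : r ∈ breakRing n) {F : ℝ → ℝ}
    (hp : ∀ x, F (x + r) = F x + r) {k : ℕ} {a : Fin (k + 1) → ℝ} (ha : StrictMono a)
    (ha0 : a 0 = 0) (hak : a (Fin.last k) = r) (hA : ∀ i, a i ∈ breakRing n ∧ F (a i) ∈ breakRing n)
    (haff : ∀ i : Fin k, ∃ c ∈ slopeGroup n, ∃ b : ℝ,
        ∀ x ∈ Set.Icc (a i.castSucc) (a i.succ), F x = c * x + b) : IsPL n F := by
  have hk := map_add_int_mul hp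
  have tR : ∀ (x c : ℝ) (j : ℤ), AffR F x c → AffR F (x + j * r) c := by
    intro x c j h
    have ht : Tendsto (fun y => y - j * r) (𝓝[≥] (x + j * r)) (𝓝[≥] x) := by
      refine tendsto_nhdsWithin_iff.2 ⟨?_, ?_⟩
      · have : Tendsto (fun y => y - j * r) (𝓝 (x + j * r)) (𝓝 (x + j * r - j * r)) :=
          (continuous_id.sub continuous_const).tendsto _
        rw [add_sub_cancel_right] at this
        exact this.mono_left nhdsWithin_le_nhds
      · filter_upwards [self_mem_nhdsWithin] with y hy
        rw [Set.mem_Ici] at *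
        linarith
    filter_upwards [ht.eventually h] with y hy
    have h1 := hk (y - j * r) j
    rw [sub_add_cancel] at h1
    rw [h1, hy, hk]
    ring
  have tL : ∀ (x c : ℝ) (j : ℤ), AffL F x c → AffL F (x + j * r) c := by
    intro x c j h
    have ht : Tendsto (fun y => y - j * r) (𝓝[≤] (x + j * r)) (𝓝[≤] x) := by
      refine tendsto_nhdsWithin_iff.2 ⟨?_, ?_⟩
      · have : Tendsto (fun y => y - j * r) (𝓝 (x + j * r)) (𝓝 (x + j * r - j * r)) :=
          (continuous_id.sub continuous_const).tendsto _
        rw [add_sub_cancel_right] at this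
        exact this.mono_left nhdsWithin_le_nhds
      · filter_upwards [self_mem_nhdsWithin] with y hy
        rw [Set.mem_Iic] at *
        linarith
    filter_upwards [ht.eventually h] with y hy
    have h1 := hk (y - j * r) j
    rw [sub_add_cancel] at h1
    rw [h1, hy, hk]
    ring
  have pR : ∀ (i : Fin k) (c b x : ℝ), (∀ y ∈ Set.Icc (a i.castSucc) (a i.succ), F y = c * y + b) →
      a i.castSucc ≤ x → x < a i.succ → AffR F x c := by
    intro i c b x h h1 h2
    filter_upwards [Ico_mem_nhdsGE h2] with y hy
    rw [h y ⟨h1.trans hy.1, hy.2.le⟩, h x ⟨h1, h2.le⟩]; ring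
  have pL : ∀ (i : Fin k) (c b x : ℝ), (∀ y ∈ Set.Icc (a i.castSucc) (a i.succ), F y = c * y + b) →
      a i.castSucc < x → x ≤ a i.succ → AffL F x c := by
    intro i c b x h h1 h2
    filter_upwards [Ioc_mem_nhdsLE h1] with y hy
    rw [h y ⟨hy.1.le, hy.2.trans h2⟩, h x ⟨h1.le, h2⟩]; ring
  have main : ∀ x, 0 ≤ x → x < r → ∃ u ∈ slopeGroup n, ∃ v ∈ slopeGroup n,
      AffL F x u ∧ AffR F x v ∧ (u ≠ v → x ∈ breakRing n) := by
    intro x hx0 hxr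
    obtain ⟨i, h1, h2⟩ := exists_piece (ha0 ▸ hx0) (hak ▸ hxr)
    obtain ⟨c, hc, b, hF⟩ := haff i
    rcases h1.eq_or_lt with h1' | h1'
    · obtain ⟨m, rfl⟩ : ∃ m, k = m + 1 := Nat.exists_eq_add_one.2 i.pos
      have hxA : x ∈ breakRing n := h1' ▸ (hA _).1
      -- At the left end of a piece the left germ comes from the preceding piece; at 0 it comes from
      -- the last piece, moved back by one period.
      by_cases hi : i.castSucc = 0
      · obtain ⟨c', hc', b', hF'⟩ := haff (Fin.last m)
        refine ⟨c', hc', c, hc, ?_, pR i c b x hF h1 h2, fun _ => hxA⟩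
        have := tL r c' (-1) (pL _ _ _ r hF' (hak ▸ ha (Fin.castSucc_lt_last _)) ?_)
        · rw [← h1', hi, ha0]
          simpa using this
        · rw [← hak]; exact le_rfl
      · have : i ≠ 0 := fun h => hi (by rw [h]; rfl)
        obtain ⟨j, hj⟩ := Fin.exists_succ_eq_of_ne_zero hi
        obtain ⟨c', hc', b', hF'⟩ := haff j
        refine ⟨c', hc', c, hc, pL j c' b' x hF' ?_ ?_, pR i c b x hF h1 h2, fun _ => hxA⟩
        · rw [← h1', ← hj]; exact ha j.castSucc_lt_succ
        · rw [← h1', ← hj]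
    · exact ⟨c, hc, c, hc, pL i c b x hF h1' h2.le, pR i c b x hF h1 h2, fun h => absurd rfl h⟩
  refine ⟨fun x => ?_, ?_⟩
  · have hx := Int.sub_floor_div_mul_nonneg x hr
    have hx' := Int.sub_floor_div_mul_lt x hr
    obtain ⟨u, hu, v, hv, h1, h2, h3⟩ := main _ hx hx'
    have h1 := tL _ _ ⌊x / r⌋ h1
    have h2 := tR _ _ ⌊x / r⌋ h2
    rw [sub_add_cancel] at h1 h2
    refine ⟨u, hu, v, hv, h1, h2, fun h => ?_⟩
    have := add_mem (h3 h) (mul_mem (intCast_mem (breakRing n) ⌊x / r⌋) hrA)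
    rwa [sub_add_cancel] at this
  · simpa [ha0] using (hA 0).2

/-- Trades subdivisions for a condition on germs, which passes to compositions and inverses without
common refinements. -/
theorem mem_thompsonStein_iff (hn : ∀ i, 1 < n i) (hr : 0 < r) (hrA : r ∈ breakRing n)
    {f : AddCircle r ≃ₜ AddCircle r} :
    f ∈ thompsonStein n r ↔ ∃ F, IsLift f F ∧ IsPL n F := by
  constructor
  · rintro ⟨F, hF, k, a, ha, ha0, hak, hA, haff⟩
    exact ⟨F, hF, isPL_of_subdivision hr hrA hF.map_add_period ha ha0 hak hA haff⟩
  · rintro ⟨F, hF, hPL⟩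
    exact ⟨F, hF, hPL.exists_subdivision hn hr hrA⟩

theorem one_mem_thompsonStein (hn : ∀ i, 1 < n i) (hr : 0 < r) (hrA : r ∈ breakRing n) :
    1 ∈ thompsonStein n r :=
  (mem_thompsonStein_iff hn hr hrA).2 ⟨id, IsLift.id, IsPL.id⟩

theorem mul_mem_thompsonStein (hn : ∀ i, 1 < n i) (hr : 0 < r) (hrA : r ∈ breakRing n)
    {f g : AddCircle r ≃ₜ AddCircle r} (hf : f ∈ thompsonStein n r) (hg : g ∈ thompsonStein n r) :
    f * g ∈ thompsonStein n r := by
  obtain ⟨F, hF, hF'⟩ := (mem_thompsonStein_iff hn hr hrA).1 hf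
  obtain ⟨G, hG, hG'⟩ := (mem_thompsonStein_iff hn hr hrA).1 hg
  exact (mem_thompsonStein_iff hn hr hrA).2 ⟨_, hF.comp hG, hF'.comp hn hG'⟩

theorem inv_mem_thompsonStein (hn : ∀ i, 1 < n i) (hr : 0 < r) (hrA : r ∈ breakRing n)
    {f : AddCircle r ≃ₜ AddCircle r} (hf : f ∈ thompsonStein n r) : f⁻¹ ∈ thompsonStein n r := by
  obtain ⟨F, hF, hF'⟩ := (mem_thompsonStein_iff hn hr hrA).1 hf
  obtain ⟨G, hG, h1, h2⟩ := hF.exists_inv hr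
  refine (mem_thompsonStein_iff hn hr hrA).2 ⟨G, hG, hF'.of_comp hn ?_ hG.continuous
    hG.strictMono.monotone⟩
  convert IsPL.id
  exact funext h1

/-- The Thompson-Stein group as a subgroup of the homeomorphism group of the circle. -/
def thompsonSteinSubgroup (hn : ∀ i, 1 < n i) (hr : 0 < r) (hrA : r ∈ breakRing n) :
    Subgroup (AddCircle r ≃ₜ AddCircle r) where
  carrier := thompsonStein n r
  one_mem' := one_mem_thompsonStein hn hr hrA
  mul_mem' := mul_mem_thompsonStein hn hr hrA
  inv_mem' := inv_mem_thompsonStein hn hr hrA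

end Subdivision

/-! ### Rotation numbers through translation numbers -/

section RotationNumber

variable {r : ℝ} {f g : AddCircle r ≃ₜ AddCircle r}

/-- `Φ` is, after rescaling by `r`, a lift of the homeomorphism `f` of the circle of length `r`. -/
def IsUnitLift (f : AddCircle r ≃ₜ AddCircle r) (Φ : CircleDeg1Liftˣ) : Prop :=
  ∀ x : ℝ, ((r * Φ x : ℝ) : AddCircle r) = f ((r * x : ℝ) : AddCircle r)

theorem continuous_unit (Φ : CircleDeg1Liftˣ) : Continuous Φ := by
  have := (CircleDeg1Lift.toOrderIso Φ).continuous
  rwa [CircleDeg1Lift.coe_toOrderIso] at this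

theorem strictMono_unit (Φ : CircleDeg1Liftˣ) : StrictMono Φ := by
  have := (CircleDeg1Lift.toOrderIso Φ).strictMono
  rwa [CircleDeg1Lift.coe_toOrderIso] at this

/-- Rescaling to period one makes the theory of `CircleDeg1Lift.translationNumber` applicable. -/
theorem IsLift.exists_unit (hr : 0 < r) {F : ℝ → ℝ} (hF : IsLift f F) :
    ∃ Φ : CircleDeg1Liftˣ, IsUnitLift f Φ ∧ ∀ x, r * Φ x = F (r * x) := by
  let φ : CircleDeg1Lift := ⟨⟨fun x => F (r * x) / r, fun x y hxy => by
    have := hF.strictMono.monotone (mul_le_mul_of_nonneg_left hxy hr.le)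
    dsimp only
    gcongr⟩, fun x => by
      have := hF.map_add_period (r * x)
      simp only [mul_add, mul_one, this]
      field_simp⟩
  have hφ : ∀ x, φ x = F (r * x) / r := fun x => rfl
  have hu : IsUnit φ := CircleDeg1Lift.isUnit_iff_bijective.2 ⟨fun x y h => by
    rw [hφ, hφ, div_left_inj' hr.ne'] at h
    exact mul_left_cancel₀ hr.ne' (hF.strictMono.injective h), fun y => by
    obtain ⟨x, hx⟩ := hF.surjective hr (r * y)
    refine ⟨x / r, ?_⟩
    rw [hφ, mul_div_cancel₀ _ hr.ne', hx, mul_div_cancel_left₀ _ hr.ne']⟩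
  obtain ⟨Φ, hΦ⟩ := hu
  have h : ∀ x, r * Φ x = F (r * x) := fun x => by
    rw [hΦ, hφ, mul_div_cancel₀ _ hr.ne']
  exact ⟨Φ, fun x => by rw [h, hF.coe_map], h⟩

theorem IsUnitLift.isLift (hr : 0 < r) {Φ : CircleDeg1Liftˣ} (h : IsUnitLift f Φ) :
    IsLift f (fun x => r * Φ (x / r)) where
  continuous := continuous_const.mul ((continuous_unit Φ).comp (continuous_id.div_const r))
  strictMono x y hxy := by
    have := strictMono_unit Φ (div_lt_div_of_pos_right hxy hr)
    exact mul_lt_mul_of_pos_left this hr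
  map_add_period x := by
    rw [add_div, div_self hr.ne', CircleDeg1Lift.map_add_one, mul_add, mul_one]
  coe_map x := by rw [h, mul_div_cancel₀ _ hr.ne']

theorem IsUnitLift.one : IsUnitLift (1 : AddCircle r ≃ₜ AddCircle r) 1 := fun _ => rfl

theorem IsUnitLift.mul {Φ Ψ : CircleDeg1Liftˣ} (hf : IsUnitLift f Φ) (hg : IsUnitLift g Ψ) :
    IsUnitLift (f * g) (Φ * Ψ) := fun x => by
  rw [Units.val_mul, CircleDeg1Lift.mul_apply, hf, hg]; rfl

theorem IsUnitLift.inv {Φ : CircleDeg1Liftˣ} (hf : IsUnitLift f Φ) :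
    IsUnitLift f⁻¹ Φ⁻¹ := fun x => by
  apply f.injective
  rw [← hf, CircleDeg1Lift.units_apply_inv_apply]
  exact (f.apply_symm_apply _).symm

theorem IsUnitLift.zpow {Φ : CircleDeg1Liftˣ} (hf : IsUnitLift f Φ) (k : ℤ) :
    IsUnitLift (f ^ k) (Φ ^ k) := by
  induction k with
  | zero => simpa using IsUnitLift.one
  | succ k ih => rw [zpow_add_one, zpow_add_one]; exact ih.mul hf
  | pred k ih => rw [zpow_sub_one, zpow_sub_one]; exact ih.mul hf.inv

/-- The difference of two lifts is continuous and integer valued, hence constant. -/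
theorem IsUnitLift.exists_int (hr : 0 < r) {Φ Ψ : CircleDeg1Liftˣ} (h : IsUnitLift f Φ)
    (h' : IsUnitLift f Ψ) : ∃ k : ℤ, ∀ x, Ψ x = Φ x + k := by
  have hk : ∀ x, ∃ k : ℤ, Ψ x = Φ x + k := fun x => by
    have := (h x).trans (h' x).symm
    rw [coe_eq_coe_iff] at this
    obtain ⟨k, hk⟩ := this
    exact ⟨k, mul_left_cancel₀ hr.ne' (by rw [hk]; ring)⟩
  choose k hk using hk
  have hc : Continuous fun x => (k x : ℝ) := by
    have : (fun x => (k x : ℝ)) = fun x => Ψ x - Φ x := funext fun x => by rw [hk]; ring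
    rw [this]
    exact (continuous_unit Ψ).sub (continuous_unit Φ)
  have hc' : Continuous k := Int.isClosedEmbedding_coe_real.isEmbedding.continuous_iff.2 hc
  refine ⟨k 0, fun x => ?_⟩
  rw [hk x, ((IsLocallyConstant.iff_continuous k).2 hc').apply_eq_of_preconnectedSpace x 0]

/-- The two products lift the same map, so `Φ Ψ = Ψ Φ + k` with `k` an integer, that is, `Φ Ψ Φ⁻¹ =
Ψ + k`. Conjugation preserves the translation number, so `k = 0`. -/
theorem IsUnitLift.commute (hr : 0 < r) {Φ Ψ : CircleDeg1Liftˣ} (hf : IsUnitLift f Φ)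
    (hg : IsUnitLift g Ψ) (h : Commute f g) :
    Commute (Φ : CircleDeg1Lift) (Ψ : CircleDeg1Lift) := by
  have h1 := hf.mul hg
  have h2 := hg.mul hf
  rw [← h.eq] at h2
  obtain ⟨k, hk⟩ := h2.exists_int hr h1
  have e : (Φ * Ψ * Φ⁻¹ : CircleDeg1Lift) =
      (CircleDeg1Lift.translate (Multiplicative.ofAdd (k : ℝ)) : CircleDeg1Lift) * Ψ := by
    ext x
    have := hk ((Φ⁻¹ : CircleDeg1Liftˣ) x)
    simp only [Units.val_mul, CircleDeg1Lift.mul_apply, CircleDeg1Lift.units_apply_inv_apply]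
      at this
    simp only [CircleDeg1Lift.mul_apply, CircleDeg1Lift.translate_apply, this]
    ring
  have h3 := CircleDeg1Lift.translationNumber_conj_eq Φ Ψ
  rw [e, CircleDeg1Lift.translationNumber_mul_of_commute,
    CircleDeg1Lift.translationNumber_translate] at h3
  · have hk0 : (k : ℝ) = 0 := by linarith
    ext x
    have := hk x
    rwa [hk0, add_zero] at this
  · ext x
    simp [CircleDeg1Lift.mul_apply, CircleDeg1Lift.translate_apply]

theorem hasRotationNumber_iff (hr : 0 < r) {ρ : ℝ} : HasRotationNumber f ρ ↔
    ∃ Φ : CircleDeg1Liftˣ, IsUnitLift f Φ ∧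
      ((CircleDeg1Lift.translationNumber Φ : ℝ) : AddCircle (1 : ℝ)) = (ρ : AddCircle (1 : ℝ)) := by
  have key : ∀ (F : ℝ → ℝ) (Φ : CircleDeg1Liftˣ), (∀ x, r * Φ x = F (r * x)) →
      Tendsto (fun m : ℕ => F^[m] 0 / (r * m)) atTop
        (𝓝 (CircleDeg1Lift.translationNumber Φ)) := by
    intro F Φ h
    have hs : Function.Semiconj (fun x => r * x) Φ F := h
    have := CircleDeg1Lift.tendsto_translationNumber (Φ : CircleDeg1Lift) 0
    refine this.congr fun m => ?_
    have h1 := (hs.iterate_right m) 0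
    simp only [mul_zero] at h1
    rw [← h1, CircleDeg1Lift.coe_pow, sub_zero, mul_div_mul_left _ _ hr.ne']
  constructor
  · rintro ⟨F, τ, hF, ht, hρ⟩
    obtain ⟨Φ, hΦ, h⟩ := hF.exists_unit hr
    refine ⟨Φ, hΦ, ?_⟩
    rw [← hρ, tendsto_nhds_unique ht (key F Φ h)]
  · rintro ⟨Φ, hΦ, hρ⟩
    exact ⟨_, _, hΦ.isLift hr, key _ Φ fun x => by rw [mul_div_cancel_left₀ _ hr.ne'], hρ⟩

theorem HasRotationNumber.congr {ρ ρ' : ℝ} (h : HasRotationNumber f ρ)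
    (e : (ρ : AddCircle (1 : ℝ)) = (ρ' : AddCircle (1 : ℝ))) : HasRotationNumber f ρ' := by
  obtain ⟨F, τ, hF, ht, hρ⟩ := h
  exact ⟨F, τ, hF, ht, hρ.trans e⟩

theorem HasRotationNumber.mul (hr : 0 < r) {ρ ρ' : ℝ} (hf : HasRotationNumber f ρ)
    (hg : HasRotationNumber g ρ') (h : Commute f g) : HasRotationNumber (f * g) (ρ + ρ') := by
  rw [hasRotationNumber_iff hr] at *
  obtain ⟨Φ, hΦ, e⟩ := hf
  obtain ⟨Ψ, hΨ, e'⟩ := hg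
  refine ⟨_, hΦ.mul hΨ, ?_⟩
  rw [Units.val_mul, CircleDeg1Lift.translationNumber_mul_of_commute (hΦ.commute hr hΨ h),
    AddCircle.coe_add, AddCircle.coe_add, e, e']

theorem HasRotationNumber.zpow (hr : 0 < r) {ρ : ℝ} (hf : HasRotationNumber f ρ) (k : ℤ) :
    HasRotationNumber (f ^ k) (k * ρ) := by
  rw [hasRotationNumber_iff hr] at *
  obtain ⟨Φ, hΦ, e⟩ := hf
  refine ⟨_, hΦ.zpow k, ?_⟩
  rw [CircleDeg1Lift.translationNumber_zpow, ← zsmul_eq_mul, ← zsmul_eq_mul,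
    AddCircle.coe_zsmul, AddCircle.coe_zsmul, e]

theorem hasRotationNumber_one (hr : 0 < r) :
    HasRotationNumber (1 : AddCircle r ≃ₜ AddCircle r) 0 :=
  (hasRotationNumber_iff hr).2 ⟨1, IsUnitLift.one, by simp⟩

theorem IsLift.exists_rotationNumber (hr : 0 < r) {F : ℝ → ℝ} (hF : IsLift f F) :
    ∃ ρ, HasRotationNumber f ρ := by
  obtain ⟨Φ, hΦ, -⟩ := hF.exists_unit hr
  exact ⟨_, (hasRotationNumber_iff hr).2 ⟨Φ, hΦ, rfl⟩⟩

theorem HasRotationNumber.exists_fixedPoint (hr : 0 < r) (h : HasRotationNumber f 0) :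
    ∃ x, f x = x := by
  obtain ⟨Φ, hΦ, e⟩ := (hasRotationNumber_iff hr).1 h
  obtain ⟨m, hm⟩ := (coe_eq_coe_iff _ _).1 e.symm
  rw [zero_add, mul_one] at hm
  obtain ⟨x, hx⟩ := (CircleDeg1Lift.translationNumber_eq_int_iff _ (continuous_unit Φ)).1 hm
  refine ⟨(r * x : ℝ), ?_⟩
  rw [← hΦ x, coe_eq_coe_iff]
  exact ⟨-m, by rw [hx]; push_cast; ring⟩

theorem IsUnitLift.exists_eq_add_int (hr : 0 < r) {Φ : CircleDeg1Liftˣ} (hΦ : IsUnitLift f Φ)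
    {x : AddCircle r} (h : f x = x) : ∃ (y : ℝ) (m : ℤ), Φ y = y + m := by
  induction x using QuotientAddGroup.induction_on with
  | H x =>
    have h1 := hΦ (x / r)
    rw [mul_div_cancel₀ _ hr.ne'] at h1
    have h2 : ((x : ℝ) : AddCircle r) = ((r * Φ (x / r) : ℝ) : AddCircle r) := (h1.trans h).symm
    rw [coe_eq_coe_iff] at h2
    obtain ⟨m, hm⟩ := h2
    refine ⟨x / r, m, mul_left_cancel₀ hr.ne' ?_⟩
    rw [hm]
    field_simp

theorem HasRotationNumber.coe_eq_zero (hr : 0 < r) {ρ : ℝ} (h : HasRotationNumber f ρ)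
    {x : AddCircle r} (hx : f x = x) : (ρ : AddCircle (1 : ℝ)) = 0 := by
  obtain ⟨Φ, hΦ, e⟩ := (hasRotationNumber_iff hr).1 h
  obtain ⟨y, m, hm⟩ := hΦ.exists_eq_add_int hr hx
  rw [← e, CircleDeg1Lift.translationNumber_of_eq_add_int _ hm]
  have := (coe_eq_coe_iff (r := 1) 0 m).2 ⟨m, by simp⟩
  exact this.symm

/-- A semiconjugacy of a lift with a translation gives the rotation number. -/
theorem IsLift.hasRotationNumber_of_semiconj (hr : 0 < r) {F θ : ℝ → ℝ} {τ : ℝ} (hF : IsLift f F)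
    (hc : Continuous θ) (hθ : ∀ x, θ (x + r) = θ x + 1) (h : ∀ x, θ (F x) = θ x + τ) :
    HasRotationNumber f τ := by
  refine ⟨F, τ, hF, ?_, rfl⟩
  -- The function `x / r - θ x` is continuous and `r`-periodic, hence bounded, so `F^m(0) / r` and
  -- `θ (F^m(0))` have the same linear growth.
  obtain ⟨C, hC⟩ : ∃ C, ∀ x, |x / r - θ x| ≤ C := by
    have hcc : Continuous fun x => |x / r - θ x| :=
      ((continuous_id.div_const r).sub hc).abs
    obtain ⟨z, -, hz⟩ := isCompact_Icc.exists_isMaxOn (Set.nonempty_Icc.2 hr.le)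
      hcc.continuousOn (s := Set.Icc 0 r)
    have hper : Function.Periodic (fun x => |x / r - θ x|) r := fun x => by
      simp only [hθ]
      congr 1
      field_simp
      ring
    refine ⟨|z / r - θ z|, fun x => ?_⟩
    obtain ⟨y, hy, hxy⟩ := hper.exists_mem_Ico₀ hr x
    exact hxy.trans_le (hz ⟨hy.1, hy.2.le⟩)
  have hiter : ∀ m : ℕ, θ (F^[m] 0) = θ 0 + m * τ := fun m => by
    induction m with
    | zero => simp
    | succ m ih => rw [Function.iterate_succ_apply', h, ih]; push_cast; ring
  have hlim : Tendsto (fun m : ℕ => (C + |θ 0|) / (m : ℝ)) atTop (𝓝 0) :=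
    tendsto_const_nhds.div_atTop tendsto_natCast_atTop_atTop
  rw [tendsto_iff_norm_sub_tendsto_zero]
  refine squeeze_zero' (Eventually.of_forall fun _ => norm_nonneg _) ?_ hlim
  filter_upwards [eventually_gt_atTop 0] with m hm
  have hm' : (0 : ℝ) < m := by exact_mod_cast hm
  have e : F^[m] 0 / (r * m) - τ = ((F^[m] 0 / r - θ (F^[m] 0)) + θ 0) / m := by
    rw [hiter]
    field_simp
    ring
  rw [e, Real.norm_eq_abs, abs_div, abs_of_pos hm']
  gcongr
  exact (abs_add_le _ _).trans (by gcongr; exact hC _)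

end RotationNumber

/-! ### Free actions of free abelian groups and independent rotation numbers -/

section FreeActions

variable {r : ℝ}

theorem hasRotationNumber_hom (hr : 0 < r) {k : ℕ}
    (φ : Multiplicative (Fin k → ℤ) →* (AddCircle r ≃ₜ AddCircle r)) {ρ : Fin k → ℝ}
    (h : ∀ i, HasRotationNumber (φ (Multiplicative.ofAdd (Pi.single i 1))) (ρ i))
    (m : Fin k → ℤ) : HasRotationNumber (φ (Multiplicative.ofAdd m)) (∑ i, m i * ρ i) := by
  have key : ∀ s : Finset (Fin k), HasRotationNumber
      (φ (∏ i ∈ s, Multiplicative.ofAdd (Pi.single i 1 : Fin k → ℤ) ^ m i))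
      (∑ i ∈ s, m i * ρ i) := by
    intro s
    induction s using Finset.induction_on with
    | empty => simpa using hasRotationNumber_one hr
    | insert i s hi ih =>
      rw [Finset.prod_insert hi, Finset.sum_insert hi, map_mul, map_zpow]
      refine ((h i).zpow hr (m i)).mul hr ih ?_
      rw [← map_zpow]
      exact (Commute.all _ _).map φ
  have e : Multiplicative.ofAdd m =
      ∏ i, Multiplicative.ofAdd (Pi.single i 1 : Fin k → ℤ) ^ m i := by
    simp_rw [← ofAdd_zsmul]
    rw [← ofAdd_sum]
    congr 1
    ext j
    simp [Finset.sum_apply, Pi.single_apply]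
  rw [e]
  exact key _

/-- Clearing denominators leaves only integer relations to test; the coefficient of 1 is moved to
the right-hand side. -/
theorem linearIndependent_cons_iff {k : ℕ} {ρ : Fin k → ℝ} :
    LinearIndependent ℚ (Fin.cons 1 ρ : Fin (k + 1) → ℝ) ↔
      ∀ (m : Fin k → ℤ) (c : ℤ), ∑ i, m i * ρ i = c → m = 0 := by
  rw [← LinearIndependent.iff_fractionRing ℤ ℚ, Fintype.linearIndependent_iff]
  constructor
  · intro h m c hm
    have := h (Fin.cons (-c) m) (by
      rw [Fin.sum_univ_succ]
      simp [hm])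
    ext i
    simpa using this i.succ
  · intro h g hg
    rw [Fin.sum_univ_succ] at hg
    simp only [Fin.cons_zero, Fin.cons_succ, zsmul_eq_mul, mul_one] at hg
    have h1 := h (fun i => g i.succ) (-g 0) (by push_cast; linarith)
    have h2 : g 0 = 0 := by
      have h3 : ∀ i : Fin k, g i.succ = 0 := fun i => congrFun h1 i
      simpa [h3] using hg
    intro i
    refine Fin.cases h2 (fun i => congrFun h1 i) i

/-- An integer relation exhibits a group element whose rotation number is zero modulo 1. It has a
fixed point, so freeness makes it trivial and the relation with it. -/
theorem linearIndependent_of_actsFreely (hr : 0 < r) {k : ℕ}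
    {H : Subgroup (AddCircle r ≃ₜ AddCircle r)} (e : H ≃* Multiplicative (Fin k → ℤ)) (hH : ActsFreely H) {ρ : Fin k → ℝ}
    (h : ∀ i, HasRotationNumber
      (e.symm (Multiplicative.ofAdd (Pi.single i 1)) : AddCircle r ≃ₜ AddCircle r) (ρ i)) :
    LinearIndependent ℚ (Fin.cons 1 ρ : Fin (k + 1) → ℝ) := by
  rw [linearIndependent_cons_iff]
  intro m c hm
  have h1 := hasRotationNumber_hom hr (H.subtype.comp e.symm.toMonoidHom) h m
  have h2 := h1.congr (ρ' := 0) ((coe_eq_coe_iff _ _).2 ⟨-c, by rw [hm]; simp⟩)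
  obtain ⟨x, hx⟩ := h2.exists_fixedPoint hr
  have h3 := hH _ (e.symm (Multiplicative.ofAdd m)).2 x hx
  have h4 : e.symm (Multiplicative.ofAdd m) = 1 := Subtype.ext h3
  rw [MulEquiv.map_eq_one_iff] at h4
  exact h4

theorem irrational_of_linearIndependent {k : ℕ} {ρ : Fin k → ℝ}
    (h : LinearIndependent ℚ (Fin.cons 1 ρ : Fin (k + 1) → ℝ)) (i : Fin k) :
    Irrational (ρ i) := by
  rintro ⟨q, hq⟩
  rw [linearIndependent_cons_iff] at h
  have := h (Pi.single i (q.den : ℤ)) q.num (by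
    rw [Finset.sum_eq_single i]
    · rw [Pi.single_eq_same, ← hq]
      exact_mod_cast Rat.den_mul_eq_num q
    · intro j _ hj
      simp [hj]
    · simp)
  have := congrFun this i
  simp at this

theorem containsFreeAction_iff (hr : 0 < r) (G : Subgroup (AddCircle r ≃ₜ AddCircle r))
    (hG : ∀ f ∈ G, ∃ F, IsLift f F) (k : ℕ) :
    ContainsFreeAction (G : Set (AddCircle r ≃ₜ AddCircle r)) k ↔
      ContainsIndependentRotations (G : Set (AddCircle r ≃ₜ AddCircle r)) k := by
  constructor
  · rintro ⟨H, hHG, ⟨e⟩, hfree⟩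
    have hρ : ∀ i, ∃ ρ, HasRotationNumber (e.symm (Multiplicative.ofAdd (Pi.single i 1)) :
        AddCircle r ≃ₜ AddCircle r) ρ := fun i => by
      obtain ⟨F, hF⟩ := hG _ (hHG (e.symm (Multiplicative.ofAdd (Pi.single i 1))).2)
      exact hF.exists_rotationNumber hr
    choose ρ hρ using hρ
    have hli := linearIndependent_of_actsFreely hr e hfree hρ
    refine ⟨fun i => e.symm (Multiplicative.ofAdd (Pi.single i 1)), ρ, fun i => hHG (Subtype.mem _),
      fun i j => ?_, hρ, irrational_of_linearIndependent hli, hli⟩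
    exact (Commute.all (Multiplicative.ofAdd (Pi.single i 1 : Fin k → ℤ))
      (Multiplicative.ofAdd (Pi.single j 1))).map (H.subtype.comp e.symm.toMonoidHom)
  · rintro ⟨g, ρ, hgG, hcomm, hρ, -, hli⟩
    -- The subgroup generated by commuting elements is commutative, so products of powers of the `g
    -- i` define a homomorphism from `ℤ^k`.
    let C := Subgroup.closure (Set.range g)
    have : IsMulCommutative C := Subgroup.isMulCommutative_closure (by
      rintro _ ⟨i, rfl⟩ _ ⟨j, rfl⟩
      exact hcomm i j)
    let : CommGroup C :=
      { (inferInstance : Group C) with mul_comm := this.is_comm.comm }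
    let γ : Fin k → C := fun i => ⟨g i, Subgroup.subset_closure ⟨i, rfl⟩⟩
    let ψ : Multiplicative (Fin k → ℤ) →* C :=
      { toFun := fun m => ∏ i, γ i ^ (m.toAdd i)
        map_one' := by simp
        map_mul' := fun m m' => by
          rw [← Finset.prod_mul_distrib]
          exact Finset.prod_congr rfl fun i _ => zpow_add _ _ _ }
    let φ : Multiplicative (Fin k → ℤ) →* (AddCircle r ≃ₜ AddCircle r) := C.subtype.comp ψ
    have hφ : ∀ i, φ (Multiplicative.ofAdd (Pi.single i 1)) = g i := fun i => by
      change C.subtype (∏ j, γ j ^ ((Pi.single i 1 : Fin k → ℤ) j)) = g i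
      rw [Finset.prod_eq_single i]
      · simp [γ]
      · intro j _ hj
        simp [hj]
      · simp
    have hrot := hasRotationNumber_hom hr φ (ρ := ρ) (fun i => by rw [hφ]; exact hρ i)
    have hfix : ∀ m : Fin k → ℤ, ∀ x, φ (Multiplicative.ofAdd m) x = x → m = 0 := by
      intro m x hx
      have h1 := (hrot m).coe_eq_zero hr hx
      obtain ⟨c, hc⟩ := (coe_eq_coe_iff _ _).1 h1.symm
      exact linearIndependent_cons_iff.1 hli m c (by simpa using hc)
    -- A kernel element fixes every point, in particular 0.
    have hinj : Function.Injective φ := by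
      rw [injective_iff_map_eq_one]
      intro m hm
      exact hfix m.toAdd 0 (by
        have : φ (Multiplicative.ofAdd m.toAdd) = 1 := hm
        rw [this]; rfl)
    refine ⟨φ.range, ?_, ⟨(MonoidHom.ofInjective hinj).symm⟩, ?_⟩
    · rintro _ ⟨m, rfl⟩
      have : C ≤ G := (Subgroup.closure_le G).2 (by
        rintro _ ⟨i, rfl⟩
        exact hgG i)
      exact this (ψ m).2
    · rintro _ ⟨m, rfl⟩ x hx
      have : m.toAdd = 0 := hfix m.toAdd x hx
      have h1 : m = 1 := this
      rw [h1, map_one]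

end FreeActions

/-! ### Finitely supported cocycles over free actions -/

section Cocycles

variable {S : Type*} {f g h : Equiv.Perm S} {s t u : S → ℝ}

theorem finite_support_orbit (hf : ∀ (i : ℤ) x, (f ^ i) x = x → i = 0)
    (hs : (Function.support s).Finite) (x : S) :
    (Function.support fun i : ℤ => s ((f ^ i) x)).Finite := by
  refine Set.Finite.preimage (f := fun i : ℤ => (f ^ i) x) ?_ hs
  intro i _ j _ hij
  have hij : (f ^ i) x = (f ^ j) x := hij
  have : (f ^ (i - j)) x = x := by
    rw [sub_eq_neg_add, zpow_add, Equiv.Perm.mul_apply, hij, ← Equiv.Perm.mul_apply, ← zpow_add]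
    simp
  have := hf _ _ this
  omega

/-- A finitely supported additive cocycle over a free action of `ℤ²` is a coboundary. -/
theorem exists_coboundary (hfg : Commute f g)
    (hfree : ∀ (i j : ℤ) x, (f ^ i * g ^ j) x = x → i = 0 ∧ j = 0)
    (hs : (Function.support s).Finite) (ht : (Function.support t).Finite)
    (hst : ∀ x, s (g x) + t x = t (f x) + s x) :
    ∃ u : S → ℝ, (Function.support u).Finite ∧ (∀ x, s x = u x - u (f x)) ∧
      (∀ L : AddSubgroup ℝ, (∀ x, s x ∈ L) → ∀ x, u x ∈ L) ∧
      ∀ x, u x ≠ 0 → ∃ i : ℤ, s ((f ^ i) x) ≠ 0 := by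
  have hf : ∀ (i : ℤ) x, (f ^ i) x = x → i = 0 := fun i x hx =>
    (hfree i 0 x (by simpa using hx)).1
  have hfs := finite_support_orbit hf hs
  have hft := finite_support_orbit hf ht
  have shift : ∀ a : ℤ → ℝ, ∑ᶠ i, a (i + 1) = ∑ᶠ i, a i := fun a =>
    finsum_comp_equiv (Equiv.addRight (1 : ℤ)) (f := a)
  have hsucc : ∀ (i : ℤ) x, (f ^ i) (f x) = (f ^ (i + 1)) x := fun i x => by
    rw [zpow_add_one, Equiv.Perm.mul_apply]
  -- the total mass of an orbit is invariant under `g`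
  let c : S → ℝ := fun x => ∑ᶠ i : ℤ, s ((f ^ i) x)
  have hcg : ∀ x, c (g x) = c x := fun x => by
    -- By the cocycle identity the sums over the orbits of `g x` and of `x` differ by a telescoping
    -- sum of `t`.
    have e : ∀ i : ℤ, s ((f ^ i) (g x)) =
        s ((f ^ i) x) + (t ((f ^ (i + 1)) x) - t ((f ^ i) x)) := fun i => by
      have h1 := hst ((f ^ i) x)
      have h2 : g ((f ^ i) x) = (f ^ i) (g x) := by
        rw [← Equiv.Perm.mul_apply, ← Equiv.Perm.mul_apply, (hfg.zpow_left i).eq]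
      have h3 : f ((f ^ i) x) = (f ^ (i + 1)) x := by
        rw [add_comm, zpow_one_add, Equiv.Perm.mul_apply]
      rw [h2, h3] at h1
      linarith
    have hft1 : (Function.support fun i : ℤ => t ((f ^ (i + 1)) x)).Finite := by
      simp_rw [← hsucc]
      exact hft (f x)
    have hft2 : (Function.support fun i : ℤ => t ((f ^ (i + 1)) x) - t ((f ^ i) x)).Finite :=
      (hft1.union (hft x)).subset (Function.support_sub _ _)
    change ∑ᶠ i : ℤ, s ((f ^ i) (g x)) = _
    simp_rw [e]
    rw [finsum_add_distrib (hfs x) hft2, finsum_sub_distrib hft1 (hft x),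
      shift fun i => t ((f ^ i) x), sub_self, add_zero]
  have hcgj : ∀ (j : ℤ) x, c ((g ^ j) x) = c x := fun j x => by
    induction j with
    | zero => simp
    | succ j ih => rw [add_comm, zpow_one_add, Equiv.Perm.mul_apply, hcg, ih]
    | pred j ih =>
      rw [← hcg, ← Equiv.Perm.mul_apply, ← zpow_one_add, add_sub_cancel, ih]
  have hc : ∀ x, c x = 0 := by
    intro x
    by_contra hx
    -- If the mass at `x` were nonzero, the `f`-orbit of every `g^j x` would meet the support of
    -- `s`. By freeness these orbits yield infinitely many distinct points of a finite set.
    have hex : ∀ j : ℤ, ∃ i : ℤ, s ((f ^ i) ((g ^ j) x)) ≠ 0 := fun j => by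
      by_contra! h0
      rw [← hcgj j x] at hx
      exact hx (by simp only [c, h0, finsum_zero])
    choose i hi using hex
    refine Set.infinite_of_injective_forall_mem (f := fun j => (f ^ i j) ((g ^ j) x)) ?_ hi hs
    intro j j' hjj
    have hjj : (f ^ i j * g ^ j) x = (f ^ i j' * g ^ j') x := hjj
    have e : f ^ (i j - i j') * g ^ (j - j') = (f ^ i j' * g ^ j')⁻¹ * (f ^ i j * g ^ j) := by
      have h1 := (hfg.zpow_zpow (i j - i j') j').eq
      rw [mul_inv_rev, mul_assoc, ← mul_assoc (f ^ i j')⁻¹, ← zpow_neg, ← zpow_neg, ← zpow_add,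
        neg_add_eq_sub, sub_eq_neg_add j, zpow_add, ← mul_assoc, ← mul_assoc,
        (hfg.zpow_zpow (i j - i j') (-j')).eq]
    have := (hfree (i j - i j') (j - j') x (by
      rw [e, Equiv.Perm.mul_apply, hjj]; exact Equiv.symm_apply_apply _ _)).2
    omega
  -- The potential is the sum of `s` over the forward orbit. As full orbit sums vanish, `u x ≠ 0`
  -- forces a point of the support of `s` both ahead of `x` and strictly behind it.
  let u : S → ℝ := fun x => ∑ᶠ i : ℤ, if 0 ≤ i then s ((f ^ i) x) else 0
  have hfin : ∀ (P : ℤ → Prop) [DecidablePred P] x,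
      (Function.support fun i : ℤ => if P i then s ((f ^ i) x) else 0).Finite :=
    fun P _ x => (hfs x).subset fun i hi => by
      simp only [Function.mem_support, ne_eq, ite_eq_right_iff, not_forall] at hi
      exact hi.2
  have hu1 : ∀ x, u x ≠ 0 → ∃ i : ℤ, 0 ≤ i ∧ s ((f ^ i) x) ≠ 0 := fun x hx => by
    by_contra! h0
    refine hx ?_
    have : ∀ i : ℤ, (if 0 ≤ i then s ((f ^ i) x) else 0) = 0 := fun i => by
      split_ifs with hi
      exacts [h0 i hi, rfl]
    simp only [u, this, finsum_zero]
  have hu2 : ∀ x, u x ≠ 0 → ∃ i : ℤ, i < 0 ∧ s ((f ^ i) x) ≠ 0 := fun x hx => by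
    by_contra! h0
    refine hx ?_
    rw [← hc x]
    refine finsum_congr fun i => ?_
    split_ifs with hi
    exacts [rfl, (h0 i (not_le.1 hi)).symm]
  refine ⟨u, ?_, ?_, ?_, fun x hx => (hu1 x hx).imp fun i hi => hi.2⟩
  -- `X a b` is the segment of orbit from `b` to `a`; it is finite because orbits are infinite.
  -- Finitely many such segments cover the support of `u`.
  · let X : S → S → Set S := fun a b =>
      {x | ∃ i k : ℤ, 0 ≤ i ∧ 0 ≤ k ∧ (f ^ i) x = a ∧ (f ^ k) b = x}
    have hX : ∀ a b, (X a b).Finite := by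
      intro a b
      rcases (X a b).eq_empty_or_nonempty with h0 | ⟨x₀, i₀, k₀, -, -, h1, h2⟩
      · rw [h0]; exact Set.finite_empty
      · refine ((Set.finite_Icc (0 : ℤ) (i₀ + k₀)).image fun k => (f ^ k) b).subset ?_
        rintro x ⟨i, k, hi, hk, h3, h4⟩
        refine ⟨k, ⟨hk, ?_⟩, h4⟩
        have h5 : (f ^ (i + k)) b = (f ^ (i₀ + k₀)) b := by
          rw [zpow_add, zpow_add, Equiv.Perm.mul_apply, Equiv.Perm.mul_apply, h4, h2, h3, h1]
        have h6 : (f ^ (i + k - (i₀ + k₀))) b = b := by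
          rw [sub_eq_neg_add, zpow_add, Equiv.Perm.mul_apply, h5, ← Equiv.Perm.mul_apply,
            ← zpow_add]
          simp
        have := hf _ _ h6
        omega
    refine (hs.biUnion fun a _ => hs.biUnion fun b _ => hX a b).subset fun x hx => ?_
    obtain ⟨i, hi, hi'⟩ := hu1 x hx
    obtain ⟨k, hk, hk'⟩ := hu2 x hx
    simp only [Set.mem_iUnion]
    refine ⟨_, hi', _, hk', i, -k, hi, by omega, rfl, ?_⟩
    rw [← Equiv.Perm.mul_apply, ← zpow_add]
    simp
  · intro x
    have e : u (f x) = ∑ᶠ i : ℤ, if 1 ≤ i then s ((f ^ i) x) else 0 := by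
      rw [← shift]
      refine finsum_congr fun i => ?_
      rw [hsucc]
      simp
    rw [e, ← finsum_sub_distrib (hfin _ x) (hfin _ x), finsum_eq_single _ 0]
    · simp
    · intro i hi
      split_ifs <;> first | omega | simp
  · intro L hL x
    refine finsum_induction (· ∈ L) (zero_mem L) (fun _ _ => add_mem) fun i => ?_
    split_ifs
    exacts [hL _, zero_mem L]

/-- A cocycle that is a coboundary for `f` is a coboundary, with the same potential, for every
`h` that commutes with `f`. -/
theorem coboundary_of_commute (hf : ∀ (i : ℤ) x, (f ^ i) x = x → i = 0) (hfh : Commute f h)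
    (hu : (Function.support u).Finite) (hs : ∀ x, s x = u x - u (f x))
    (ht : (Function.support t).Finite) (hst : ∀ x, s (h x) + t x = t (f x) + s x) (x : S) :
    t x = u x - u (h x) := by
  -- The defect `v` is `f`-invariant and finitely supported. All `f`-orbits being infinite, it
  -- vanishes.
  let v : S → ℝ := fun x => t x - u x + u (h x)
  have hv : ∀ x, v (f x) = v x := fun x => by
    have h1 := hst x
    rw [hs, hs] at h1
    have h2 : h (f x) = f (h x) := by
      rw [← Equiv.Perm.mul_apply, ← Equiv.Perm.mul_apply, hfh.eq]
    simp only [v, h2]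
    linarith
  have hvi : ∀ (i : ℕ) x, v ((f ^ i) x) = v x := fun i x => by
    induction i with
    | zero => simp
    | succ i ih => rw [pow_succ', Equiv.Perm.mul_apply, hv, ih]
  have hfin : (Function.support v).Finite := by
    refine ((ht.union hu).union (hu.preimage h.injective.injOn)).subset fun y hy => ?_
    by_contra hc
    simp only [Set.mem_union, Set.mem_preimage, Function.mem_support, not_or, not_not] at hc
    exact hy (by simp only [v, hc.1.1, hc.1.2, hc.2]; norm_num)
  by_contra hx
  refine Set.infinite_of_injective_forall_mem (f := fun i : ℕ => (f ^ i) x) ?_ (fun i => ?_) hfin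
  · intro i j hij
    have hij : (f ^ i) x = (f ^ j) x := hij
    have : (f ^ ((i : ℤ) - j)) x = x := by
      rw [sub_eq_neg_add, zpow_add, Equiv.Perm.mul_apply, zpow_natCast, hij, ← zpow_natCast,
        ← Equiv.Perm.mul_apply, ← zpow_add]
      simp
    have := hf _ _ this
    omega
  · rw [Function.mem_support, hvi]
    intro h0
    exact hx (by simp only [v] at h0; linarith)

end Cocycles

/-! ### Step functions on the line with prescribed jumps -/

section StepFunctions

theorem eq_of_affR_zero {κ : ℝ → ℝ} (hc : Continuous κ) (h : ∀ x, AffR κ x 0) (x : ℝ) :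
    κ x = κ 0 := by
  have key : ∀ a b, a ≤ b → κ b = κ a := fun a b hab =>
    constant_of_has_deriv_right_zero hc.continuousOn (fun y _ => (h y).hasDerivWithinAt) b
      ⟨hab, le_rfl⟩
  rcases le_total 0 x with hx | hx
  exacts [key _ _ hx, (key _ _ hx).symm]

/-- A step function has a piecewise linear primitive. -/
theorem exists_primitive {w : ℝ → ℝ} (hr : ∀ x, ∀ᶠ y in 𝓝[>] x, w y = w x)
    (hl : ∀ x, ∃ a, ∀ᶠ y in 𝓝[<] x, w y = a) :
    ∃ φ : ℝ → ℝ, φ 0 = 0 ∧ (∀ x, AffR φ x (w x)) ∧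
      ∀ x a, (∀ᶠ y in 𝓝[<] x, w y = a) → AffL φ x a := by
  have hloc : MeasureTheory.LocallyIntegrable w MeasureTheory.volume := by
    intro x
    obtain ⟨v, hv, hv'⟩ := mem_nhdsGT_iff_exists_Ioo_subset.1 (hr x)
    obtain ⟨a, ha⟩ := hl x
    obtain ⟨u, hu, hu'⟩ := mem_nhdsLT_iff_exists_Ioo_subset.1 ha
    have i1 : MeasureTheory.IntegrableOn w (Set.Ioo u x) :=
      (MeasureTheory.integrableOn_const (C := a) (by simp)).congr_fun
        (fun y hy => (hu' hy).symm) measurableSet_Ioo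
    have i2 : MeasureTheory.IntegrableOn w (Set.Ico x v) :=
      (MeasureTheory.integrableOn_const (C := w x) (by simp)).congr_fun
        (fun y hy => by
          rcases hy.1.eq_or_lt with rfl | h
          · rfl
          · exact (hv' ⟨h, hy.2⟩).symm) measurableSet_Ico
    refine ⟨Set.Ioo u v, Ioo_mem_nhds hu hv, ?_⟩
    refine (i1.union i2).mono_set fun y hy => ?_
    rcases lt_or_ge y x with h | h
    exacts [Or.inl ⟨hy.1, h⟩, Or.inr ⟨h, hy.2⟩]
  have hint : ∀ a b, IntervalIntegrable w MeasureTheory.volume a b := fun a b =>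
    (hloc.integrableOn_isCompact isCompact_uIcc).intervalIntegrable
  have hadd : ∀ x y, ∫ t in (0 : ℝ)..y, w t = (∫ t in (0 : ℝ)..x, w t) + ∫ t in x..y, w t :=
    fun x y => (intervalIntegral.integral_add_adjacent_intervals (hint 0 x) (hint x y)).symm
  refine ⟨fun x => ∫ t in (0 : ℝ)..x, w t, by simp, fun x => ?_, fun x a ha => ?_⟩
  · obtain ⟨v, hv, hv'⟩ := mem_nhdsGT_iff_exists_Ioo_subset.1 (hr x)
    filter_upwards [Ico_mem_nhdsGE hv] with y hy
    rw [hadd x y, intervalIntegral.integral_congr_Ioo_of_le hy.1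
      (g := fun _ => w x) fun t ht => hv' ⟨ht.1, ht.2.trans hy.2⟩]
    simp [mul_comm]
  · obtain ⟨u, hu, hu'⟩ := mem_nhdsLT_iff_exists_Ioo_subset.1 ha
    filter_upwards [Ioc_mem_nhdsLE hu] with y hy
    rw [hadd x y, intervalIntegral.integral_symm y x, intervalIntegral.integral_congr_Ioo_of_le hy.2
      (g := fun _ => a) fun t ht => hu' ⟨hy.1.trans ht.1, ht.2⟩]
    simp
    ring

variable {r : ℝ}

/-- The step function on the line with jump `u b` at the points above `b`. -/
noncomputable def stepFun (u : AddCircle r → ℝ) (B : Finset (AddCircle r)) (x : ℝ) : ℝ :=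
  ∑ b ∈ B, ⌊(x - b.out) / r⌋ * u b

theorem coe_out (b : AddCircle r) : ((b.out : ℝ) : AddCircle r) = b := Quotient.out_eq' b

theorem stepFun_add_period (hr : 0 < r) (u : AddCircle r → ℝ) (B : Finset (AddCircle r)) (x : ℝ) :
    stepFun u B (x + r) = stepFun u B x + ∑ b ∈ B, u b := by
  rw [stepFun, stepFun, ← Finset.sum_add_distrib]
  refine Finset.sum_congr rfl fun b _ => ?_
  have : (x + r - b.out) / r = (x - b.out) / r + 1 := by field_simp; ring
  rw [this, Int.floor_add_one]
  push_cast
  ring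

theorem stepFun_right (hr : 0 < r) (u : AddCircle r → ℝ) (B : Finset (AddCircle r)) (x : ℝ) :
    ∀ᶠ y in 𝓝[>] x, stepFun u B y = stepFun u B x := by
  have h : ∀ b ∈ B, ∀ᶠ y in 𝓝[>] x, ⌊(y - b.out) / r⌋ = ⌊(x - b.out) / r⌋ := fun b _ => by
    have ht : Tendsto (fun y => (y - b.out) / r) (𝓝[>] x) (𝓝[≥] ((x - b.out) / r)) := by
      refine tendsto_nhdsWithin_iff.2 ⟨?_, ?_⟩
      · exact ((continuous_id.sub continuous_const).div_const r).continuousAt.mono_left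
          nhdsWithin_le_nhds
      · filter_upwards [self_mem_nhdsWithin] with y hy
        rw [Set.mem_Ioi] at hy
        rw [Set.mem_Ici]
        gcongr
    exact tendsto_pure.1 ((tendsto_floor_right_pure_floor _).comp ht)
  filter_upwards [(Finset.eventually_all B).2 h] with y hy
  exact Finset.sum_congr rfl fun b hb => by rw [hy b hb]

/-- Just to the left of `x` each floor becomes the ceiling at `x` minus one. This differs from the
floor at `x` only when the quotient is an integer, that is, when `x` lies above `b`. -/
theorem stepFun_left (hr : 0 < r) (u : AddCircle r → ℝ) (B : Finset (AddCircle r))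
    (hB : ∀ b, u b ≠ 0 → b ∈ B) (x : ℝ) :
    ∀ᶠ y in 𝓝[<] x, stepFun u B y = stepFun u B x - u x := by
  classical
  have h : ∀ b ∈ B, ∀ᶠ y in 𝓝[<] x, ⌊(y - b.out) / r⌋ = ⌈(x - b.out) / r⌉ - 1 := fun b _ => by
    have ht : Tendsto (fun y => (y - b.out) / r) (𝓝[<] x) (𝓝[<] ((x - b.out) / r)) := by
      refine tendsto_nhdsWithin_iff.2 ⟨?_, ?_⟩
      · exact ((continuous_id.sub continuous_const).div_const r).continuousAt.mono_left
          nhdsWithin_le_nhds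
      · filter_upwards [self_mem_nhdsWithin] with y hy
        rw [Set.mem_Iio] at hy
        rw [Set.mem_Iio]
        gcongr
    exact tendsto_pure.1 ((tendsto_floor_left_pure_ceil_sub_one _).comp ht)
  have hfc : ∀ b : AddCircle r, ((⌈(x - b.out) / r⌉ - 1 : ℤ) : ℝ) =
      ⌊(x - b.out) / r⌋ - if b = x then 1 else 0 := fun b => by
    by_cases hb : b = x
    · rw [if_pos hb]
      have h1 : ((b.out : ℝ) : AddCircle r) = x := (coe_out b).trans hb
      obtain ⟨k, hk⟩ := (coe_eq_coe_iff _ _).1 h1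
      have : (x - b.out) / r = k := by
        rw [hk]; field_simp; ring
      rw [this]
      simp
    · rw [if_neg hb]
      have : ⌈(x - b.out) / r⌉ = ⌊(x - b.out) / r⌋ + 1 := by
        refine le_antisymm (Int.ceil_le_floor_add_one _) (Int.add_one_le_iff.2 ?_)
        refine lt_of_le_of_ne (Int.floor_le_ceil _) fun he => hb ?_
        rw [← coe_out b, coe_eq_coe_iff]
        refine ⟨⌊(x - b.out) / r⌋, ?_⟩
        have h1 := Int.floor_le ((x - b.out) / r)
        have h2 := Int.le_ceil ((x - b.out) / r)
        rw [← he] at h2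
        have h3 := le_antisymm h1 h2
        rw [h3]
        field_simp
        ring
      rw [this]
      simp
  filter_upwards [(Finset.eventually_all B).2 h] with y hy
  have e : stepFun u B y = ∑ b ∈ B, (⌊(x - b.out) / r⌋ * u b - if b = x then u b else 0) :=
    Finset.sum_congr rfl fun b hb => by
      rw [hy b hb, hfc, sub_mul, ite_mul, one_mul, zero_mul]
  rw [e, Finset.sum_sub_distrib, Finset.sum_ite_eq']
  congr 1
  split_ifs with hx
  · rfl
  · by_contra h0
    exact hx (hB _ fun h => h0 h.symm)

theorem stepFun_mem {L : AddSubgroup ℝ} {u : AddCircle r → ℝ} (hu : ∀ b, u b ∈ L)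
    (B : Finset (AddCircle r)) (x : ℝ) : stepFun u B x ∈ L :=
  sum_mem fun b _ => by
    rw [← zsmul_eq_mul]
    exact zsmul_mem (hu b) _

end StepFunctions

/-! ### Logarithmic jumps of the derivative -/

section Jumps

variable {p : ℕ} {n : Fin p → ℕ} {r : ℝ}

/-- The additive group of the logarithms of the slopes. -/
noncomputable def logGroup (hn : ∀ i, 1 < n i) : AddSubgroup ℝ where
  carrier := {x | Real.exp x ∈ slopeGroup n}
  zero_mem' := by simpa using slopeGroup_one
  add_mem' {a b} ha hb := by
    change Real.exp (a + b) ∈ slopeGroup n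
    rw [Real.exp_add]
    exact slopeGroup_mul hn ha hb
  neg_mem' {a} ha := by
    change Real.exp (-a) ∈ slopeGroup n
    rw [Real.exp_neg]
    exact slopeGroup_inv ha

theorem log_mem_logGroup (hn : ∀ i, 1 < n i) {x : ℝ} (hx : x ∈ slopeGroup n) :
    Real.log x ∈ logGroup hn := by
  change Real.exp (Real.log x) ∈ slopeGroup n
  rwa [Real.exp_log (slopeGroup_pos hn hx)]

/-- The logarithm of the jump of the derivative. -/
noncomputable def jump (F : ℝ → ℝ) (x : ℝ) : ℝ := Real.log (rs F x) - Real.log (ls F x)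

/-- The chain rule on both sides; it makes the jump an additive cocycle. -/
theorem IsPL.jump_comp (hn : ∀ i, 1 < n i) {F G : ℝ → ℝ} (hF : IsPL n F) (hG : IsPL n G) (x : ℝ) :
    jump (F ∘ G) x = jump F (G x) + jump G x := by
  have h1 := hF.rs_pos hn (G x)
  have h2 := hF.ls_pos hn (G x)
  have h3 := hG.rs_pos hn x
  have h4 := hG.ls_pos hn x
  rw [jump, jump, jump, hF.rs_comp hn hG, hF.ls_comp hn hG, Real.log_mul h1.ne' h3.ne',
    Real.log_mul h2.ne' h4.ne']
  ring

variable {f g : AddCircle r ≃ₜ AddCircle r} {F G : ℝ → ℝ}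

theorem IsPL.add_period (hn : ∀ i, 1 < n i) (hrA : r ∈ breakRing n) (hf : IsLift f F)
    (hF : IsPL n F) (x : ℝ) : rs F (x + r) = rs F x ∧ ls F (x + r) = ls F x := by
  have hT : IsPL n fun x : ℝ => 1 * x + r := IsPL.affine 1 r slopeGroup_one hrA
  have hTn : ∀ y, ∀ᶠ z in 𝓝 y, 1 * z + r = (1 * y + r) + 1 * (z - y) := fun y =>
    Eventually.of_forall fun z => by ring
  have e : F ∘ (fun x : ℝ => 1 * x + r) = (fun x : ℝ => 1 * x + r) ∘ F :=
    funext fun x => by simp [hf.map_add_period]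
  have hr1 : ∀ y, rs (fun x : ℝ => 1 * x + r) y = 1 := fun y => (affR_of_nhds (hTn y)).rs_eq
  have hl1 : ∀ y, ls (fun x : ℝ => 1 * x + r) y = 1 := fun y => (affL_of_nhds (hTn y)).ls_eq
  have h1 := hF.rs_comp hn hT x
  have h2 := hF.ls_comp hn hT x
  rw [e, hT.rs_comp hn hF, hr1, hr1] at h1
  rw [e, hT.ls_comp hn hF, hl1, hl1] at h2
  simp only [one_mul, mul_one] at h1 h2
  exact ⟨h1.symm, h2.symm⟩

/-- The logarithmic jumps of the derivative as a function on the circle. -/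
theorem exists_jump (hn : ∀ i, 1 < n i) (hr : 0 < r) (hrA : r ∈ breakRing n) (hf : IsLift f F)
    (hF : IsPL n F) : ∃ s : AddCircle r → ℝ, (∀ x : ℝ, s x = jump F x) ∧
      (Function.support s).Finite ∧ (∀ x, s x ∈ logGroup hn) ∧
      ∀ x : ℝ, s x ≠ 0 → x ∈ breakRing n := by
  have hper : Function.Periodic (jump F) r := fun x => by
    rw [jump, jump, (hF.add_period hn hrA hf x).1, (hF.add_period hn hrA hf x).2]
  have hne : ∀ x, jump F x ≠ 0 → ls F x ≠ rs F x := fun x hx h => hx (by rw [jump, h, sub_self])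
  refine ⟨hper.lift, fun x => hper.lift_coe x, ?_, fun x => ?_, fun x hx => ?_⟩
  · refine ((hF.finite_breaks 0 r).image fun x : ℝ => (x : AddCircle r)).subset fun x hx => ?_
    induction x using QuotientAddGroup.induction_on with
    | H x =>
      obtain ⟨y, hy, hxy⟩ := hper.exists_mem_Ico₀ hr x
      have hx : jump F x ≠ 0 := hx
      refine ⟨toIcoMod hr 0 x, ⟨⟨?_, ?_⟩, hne _ ?_⟩, ?_⟩
      · exact (toIcoMod_mem_Ico hr 0 x).1
      · have := (toIcoMod_mem_Ico hr 0 x).2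
        linarith
      · rw [toIcoMod, hper.sub_zsmul_eq]; exact hx
      · change ((toIcoMod hr 0 x : ℝ) : AddCircle r) = x
        rw [coe_eq_coe_iff]
        exact ⟨toIcoDiv hr 0 x, by rw [toIcoMod, zsmul_eq_mul]; ring⟩
  · induction x using QuotientAddGroup.induction_on with
    | H x => exact sub_mem (log_mem_logGroup hn (hF.rs_mem x)) (log_mem_logGroup hn (hF.ls_mem x))
  · exact hF.mem_of_ne (hne x hx)

theorem IsLift.commute (hr : 0 < r) (hf : IsLift f F) (hg : IsLift g G) (h : Commute f g) :
    F ∘ G = G ∘ F := by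
  obtain ⟨Φ, hΦ, hF⟩ := hf.exists_unit hr
  obtain ⟨Ψ, hΨ, hG⟩ := hg.exists_unit hr
  have hc := hΦ.commute hr hΨ h
  funext x
  have h1 : (Φ * Ψ : CircleDeg1Lift) (x / r) = (Ψ * Φ : CircleDeg1Lift) (x / r) := by rw [hc.eq]
  rw [CircleDeg1Lift.mul_apply, CircleDeg1Lift.mul_apply] at h1
  have h2 := hF (Ψ (x / r))
  have h3 := hG (Φ (x / r))
  rw [hG, mul_div_cancel₀ _ hr.ne'] at h2
  rw [hF, mul_div_cancel₀ _ hr.ne', ← h1, h2] at h3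
  exact h3

/-- A function with the jumps of a cocycle potential has constant ratio with its translate. -/
theorem exists_log_multiplier (hn : ∀ i, 1 < n i) (hr : 0 < r) (hf : IsLift f F) (hF : IsPL n F)
    {u : AddCircle r → ℝ} {B : Finset (AddCircle r)} (hB : ∀ b, u b ≠ 0 → b ∈ B)
    (hu : ∀ x, u x ∈ logGroup hn) (hs : ∀ x : ℝ, jump F x = u x - u (f x)) :
    ∃ l ∈ logGroup hn, ∀ x, stepFun u B (F x) + Real.log (rs F x) = stepFun u B x + l := by
  let κ : ℝ → ℝ := fun x => stepFun u B (F x) + Real.log (rs F x) - stepFun u B x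
  have hmono := hf.strictMono
  refine ⟨κ 0, sub_mem (add_mem (stepFun_mem hu B _) (log_mem_logGroup hn (hF.rs_mem 0)))
    (stepFun_mem hu B _), fun x => ?_⟩
  -- `κ` is a step function, and its jump at `x` is `u (f x) + jump F x - u x = 0`.
  have : κ x = κ 0 := by
    refine eq_of_locally_const (κ := κ) (fun x => ?_) (fun x => ?_) x 0
    · have ht : Tendsto F (𝓝[<] x) (𝓝[<] F x) := tendsto_nhdsWithin_iff.2
        ⟨hf.continuous.continuousAt.mono_left nhdsWithin_le_nhds, by
          filter_upwards [self_mem_nhdsWithin] with y hy using hmono hy⟩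
      filter_upwards [ht.eventually (stepFun_left hr u B hB (F x)), stepFun_left hr u B hB x,
        (hF.affL x).rs_eventually] with y h1 h2 h3
      have h4 := hs x
      rw [jump, ← hf.coe_map] at h4
      simp only [κ, h1, h2, h3]
      linarith
    · have ht : Tendsto F (𝓝[>] x) (𝓝[>] F x) := tendsto_nhdsWithin_iff.2
        ⟨hf.continuous.continuousAt.mono_left nhdsWithin_le_nhds, by
          filter_upwards [self_mem_nhdsWithin] with y hy using hmono hy⟩
      filter_upwards [ht.eventually (stepFun_right hr u B (F x)), stepFun_right hr u B x,
        (hF.affR x).rs_eventually] with y h1 h2 h3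
      simp only [κ, h1, h2, h3]
  rw [← this]
  simp only [κ]
  ring

end Jumps

/-! ### The affine structure defined by a potential -/

section RotationFormula

variable {p : ℕ} {n : Fin p → ℕ} {r : ℝ} {f : AddCircle r ≃ₜ AddCircle r} {F : ℝ → ℝ}

/-- If the jumps of `f` are the coboundary of `u`, the rotation number of `f` is `l / C`, where `C`
is the total mass of `u`, as soon as `C ≠ 0`; and it is rational if `C = 0`. -/
theorem exists_rotationNumber_of_coboundary (hn : ∀ i, 1 < n i) (hr : 0 < r)
    (hrA : r ∈ breakRing n) (hf : IsLift f F) (hF : IsPL n F) {u : AddCircle r → ℝ}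
    {B : Finset (AddCircle r)} (hB : ∀ b, u b ≠ 0 → b ∈ B) (hu : ∀ x, u x ∈ logGroup hn)
    (huA : ∀ x : ℝ, u x ≠ 0 → x ∈ breakRing n)
    (hs : ∀ x : ℝ, jump F x = u x - u (f x)) :
    (∑ b ∈ B, u b ≠ 0 → ∃ l ∈ logGroup hn, HasRotationNumber f (l / ∑ b ∈ B, u b)) ∧
    (∑ b ∈ B, u b = 0 → ∃ q : ℚ, HasRotationNumber f q) := by
  obtain ⟨l, hl, hW⟩ := exists_log_multiplier hn hr hf hF hB hu hs
  set C := ∑ b ∈ B, u b with hC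
  set w : ℝ → ℝ := fun x => Real.exp (stepFun u B x) with hw
  have hwR : ∀ x, ∀ᶠ y in 𝓝[>] x, w y = w x := fun x =>
    (stepFun_right hr u B x).mono fun y hy => by simp only [hw, hy]
  have hwL : ∀ x, ∀ᶠ y in 𝓝[<] x, w y = Real.exp (stepFun u B x - u x) := fun x =>
    (stepFun_left hr u B hB x).mono fun y hy => by simp only [hw, hy]
  obtain ⟨φ, hφ0, hφR, hφL⟩ := exists_primitive hwR fun x => ⟨_, hwL x⟩
  have hφL := fun x => hφL x _ (hwL x)
  -- The slopes of the primitive are exponentials of elements of the logarithmic slope group, and it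
  -- breaks only where `u ≠ 0`, hence in `A`.
  have hφPL : IsPL n φ := by
    refine ⟨fun x => ⟨_, ?_, _, ?_, hφL x, hφR x, fun h => huA x fun h0 => h ?_⟩, ?_⟩
    · exact sub_mem (stepFun_mem hu B x) (hu x)
    · exact stepFun_mem hu B x
    · rw [h0, sub_zero]
    · rw [hφ0]; exact zero_mem _
  have hφc := hφPL.continuous
  have hφm := hφPL.strictMono hn
  have affine_of : ∀ (ψ : ℝ → ℝ) (c : ℝ), Continuous ψ → (∀ x, AffR ψ x (c * w x)) →
      ∀ x, ψ x = c * φ x + ψ 0 := by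
    intro ψ c hψ hψR x
    have := eq_of_affR_zero (κ := fun x => ψ x - c * φ x) (hψ.sub (continuous_const.mul hφc))
      (fun x => by
        filter_upwards [hψR x, hφR x] with y h1 h2
        rw [h1, h2]; ring) x
    rw [hφ0] at this
    linarith
  -- The relation `W (F x) + log (rs F x) = W x + l`, with `W` the step function, says that `φ ∘ F`
  -- has slope `exp l` times that of `φ`.
  have hφF : ∀ x, φ (F x) = Real.exp l * φ x + φ (F 0) := by
    refine affine_of (φ ∘ F) _ (hφc.comp hf.continuous) fun x => ?_
    have := (hφR (F x)).comp (hF.affR x) (hF.rs_pos hn x)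
    convert this using 1
    rw [← Real.exp_log (hF.rs_pos hn x), ← Real.exp_add, ← Real.exp_add, hW, add_comm]
  have hφr : ∀ x, φ (x + r) = Real.exp C * φ x + φ r := by
    intro x
    have hT : ∀ y : ℝ, AffR (fun x => x + r) y 1 := fun y =>
      Eventually.of_forall fun z => by ring
    have := affine_of (φ ∘ fun x => x + r) (Real.exp C) (hφc.comp (continuous_id.add continuous_const))
      (fun x => by
        have := AffR.comp (G := fun x => x + r) (hφR (x + r)) (hT x) one_pos
        convert this using 1
        simp only [hw]
        rw [mul_one, ← Real.exp_add, stepFun_add_period hr, add_comm]) x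
    simpa using this
  have hφr0 : 0 < φ r := by
    have := hφm hr
    rwa [hφ0] at this
  -- the two affine maps commute
  have hcomm : (Real.exp l - 1) * φ r = (Real.exp C - 1) * φ (F 0) := by
    have h1 := hφF (0 + r)
    rw [hf.map_add_period, hφr, hφr, hφ0] at h1
    linarith
  constructor
  · intro hC0
    refine ⟨l, hl, ?_⟩
    have hC1 : Real.exp C - 1 ≠ 0 := by
      rw [sub_ne_zero]
      simpa using hC0
    -- `-E` is the fixed point of the affine map induced by the translation by `r`. The other affine
    -- map commutes with it, so it fixes `-E` too.
    set E := φ r / (Real.exp C - 1) with hE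
    have hE1 : (Real.exp C - 1) * E = φ r := by rw [hE]; field_simp
    have hΦr : ∀ x, φ (x + r) + E = Real.exp C * (φ x + E) := fun x => by
      rw [hφr, ← hE1]; ring
    have hΦF : ∀ x, φ (F x) + E = Real.exp l * (φ x + E) := fun x => by
      have : φ (F 0) = (Real.exp l - 1) * E := by
        rw [hE, mul_div_assoc', hcomm]
        field_simp
      rw [hφF, this]; ring
    -- A zero of `φ + E` would recur one period later, against strict monotonicity.
    have hne : ∀ x, φ x + E ≠ 0 := fun x hx => by
      have h1 := hΦr x
      rw [hx, mul_zero] at h1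
      have h2 := hφm (show x < x + r by linarith)
      linarith
    refine hf.hasRotationNumber_of_semiconj hr (θ := fun x => Real.log (φ x + E) / C)
      (((hφc.add continuous_const).log hne).div_const C) (fun x => ?_) (fun x => ?_)
    · rw [hΦr, Real.log_mul (Real.exp_ne_zero _) (hne x), Real.log_exp]
      field_simp
      ring
    · rw [hΦF, Real.log_mul (Real.exp_ne_zero _) (hne x), Real.log_exp]
      field_simp
      ring
  -- Now the translation by `r` becomes a translation, and commutation forces `l = 0`. So `φ`
  -- conjugates `F` to a translation too, and the rotation number is a quotient of two elements of
  -- `A`.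
  · intro hC0
    rw [hC0, Real.exp_zero, sub_self, zero_mul] at hcomm
    have hl1 : Real.exp l = 1 := by
      have := (mul_eq_zero.1 hcomm).resolve_right hφr0.ne'
      linarith
    have hA : φ (F 0) ∈ breakRing n := (hφPL.mem_iff hn).2 hF.map_zero
    obtain ⟨a, ha⟩ := exists_rat_of_mem_breakRing hA
    obtain ⟨b, hb⟩ := exists_rat_of_mem_breakRing ((hφPL.mem_iff hn).2 hrA)
    refine ⟨a / b, ?_⟩
    rw [Rat.cast_div, ha, hb]
    refine hf.hasRotationNumber_of_semiconj hr (θ := fun x => φ x / φ r)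
      (hφc.div_const _) (fun x => ?_) (fun x => ?_)
    · rw [hφr, hC0, Real.exp_zero]
      field_simp
    · rw [hφF, hl1]
      field_simp

end RotationFormula

/-! ### Fixed points in the centralizer of an element without periodic points -/

section FixedPoints

variable {p : ℕ} {n : Fin p → ℕ} {r : ℝ} {f h : AddCircle r ≃ₜ AddCircle r}

theorem map_coe_nhds (x : ℝ) : Filter.map ((↑) : ℝ → AddCircle r) (𝓝 x) = 𝓝 (x : AddCircle r) :=
  QuotientAddGroup.isOpenQuotientMap_mk.map_nhds_eq x

/-- Next to a fixed point, on either side, the displacement is `(b - 1) (y - x)` up to a multiple of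
`r`. It vanishes identically if `b = 1`, and otherwise is nonzero and smaller than `r`. So frontier
points of the fixed set are isolated. -/
theorem eventually_fixed_or_not {H : ℝ → ℝ} (hr : 0 < r) (hH : IsLift h H) (hPL : IsPL n H)
    (x : ℝ) : ∀ᶠ y in 𝓝 x, y ≠ x →
      h y ≠ y ∨ ∀ᶠ t in 𝓝 (y : AddCircle r), h t = t := by
  by_cases hx : h x = x
  · rw [← hH.coe_map] at hx
    obtain ⟨k, hk⟩ := (coe_eq_coe_iff _ _).1 hx.symm
    -- a one-sided germ of slope `b` at `x`
    have main : ∀ b y : ℝ, H y = H x + b * (y - x) → AffL H y b → AffR H y b →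
        |(b - 1) * (y - x)| < r → y ≠ x →
        h y ≠ y ∨ ∀ᶠ t in 𝓝 (y : AddCircle r), h t = t := by
      intro b y hy hL hR hlt hne
      by_cases hb : b = 1
      · right
        subst hb
        rw [← map_coe_nhds, eventually_map]
        refine eventually_nhds_of_sides ?_ ?_ ?_
        · rw [← hH.coe_map, eq_comm, coe_eq_coe_iff]
          exact ⟨k, by rw [hy, hk]; ring⟩
        · filter_upwards [hL.filter_mono (nhdsWithin_mono _ Set.Iio_subset_Iic_self)] with t ht
          rw [← hH.coe_map, eq_comm, coe_eq_coe_iff]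
          exact ⟨k, by rw [ht, hy, hk]; ring⟩
        · filter_upwards [hR.filter_mono (nhdsWithin_mono _ Set.Ioi_subset_Ici_self)] with t ht
          rw [← hH.coe_map, eq_comm, coe_eq_coe_iff]
          exact ⟨k, by rw [ht, hy, hk]; ring⟩
      · left
        rw [← hH.coe_map, ne_comm, Ne, coe_eq_coe_iff]
        rintro ⟨j, hj⟩
        have e : (b - 1) * (y - x) = (j - k : ℤ) * r := by
          push_cast
          rw [hy, hk] at hj
          linarith
        rw [e, abs_mul, abs_of_pos hr, mul_lt_iff_lt_one_left hr] at hlt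
        have h0 : j - k = 0 := Int.abs_lt_one_iff.1 (by exact_mod_cast hlt)
        rw [h0, Int.cast_zero, zero_mul] at e
        rcases mul_eq_zero.1 e with h1 | h1
        · exact hb (by linarith)
        · exact hne (by linarith)
    have hsmall : ∀ b : ℝ, ∀ᶠ y in 𝓝 x, |(b - 1) * (y - x)| < r := fun b => by
      have : Continuous fun y => |(b - 1) * (y - x)| := by fun_prop
      exact (this.tendsto' x 0 (by simp)).eventually (gt_mem_nhds hr)
    refine eventually_nhds_of_sides (fun h0 => absurd rfl h0) ?_ ?_
    · filter_upwards [(hPL.affL x).eventually_left, (hsmall _).filter_mono nhdsWithin_le_nhds,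
        (hPL.affL x).filter_mono (nhdsWithin_mono _ Set.Iio_subset_Iic_self)] with y h1 h2 h3
      exact main _ y h3 h1.1 h1.2 h2
    · filter_upwards [(hPL.affR x).eventually_right, (hsmall _).filter_mono nhdsWithin_le_nhds,
        (hPL.affR x).filter_mono (nhdsWithin_mono _ Set.Ioi_subset_Ici_self)] with y h1 h2 h3
      exact main _ y h3 h1.1 h1.2 h2
  · have hop : IsOpen {t : AddCircle r | h t ≠ t} :=
      isOpen_ne_fun h.continuous continuous_id
    have := hop.mem_nhds (x := (x : AddCircle r)) hx
    rw [← map_coe_nhds] at this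
    filter_upwards [this] with y hy _
    exact Or.inl hy

/-- A piecewise linear homeomorphism with a fixed point that commutes with one without periodic
points is the identity. -/
theorem eq_one_of_commute_of_fixedPoint (hn : ∀ i, 1 < n i) (hr : 0 < r) (hrA : r ∈ breakRing n)
    (hf : ∀ (i : ℤ) x, (f ^ i) x = x → i = 0) (hh : h ∈ thompsonStein n r) (hc : Commute f h)
    {x : AddCircle r} (hx : h x = x) : h = 1 := by
  have : Fact (0 < r) := ⟨hr⟩
  obtain ⟨H, hH, hPL⟩ := (mem_thompsonStein_iff hn hr hrA).1 hh
  -- The frontier of the fixed set is finite by compactness and `f`-invariant by commutation. As `f`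
  -- has only infinite orbits, it is empty, so the fixed set is open and closed.
  let D : Set (AddCircle r) := {s | h s = s ∧ ¬ ∀ᶠ t in 𝓝 s, h t = t}
  have hfin : D.Finite := by
    have key : ∀ K : Set (AddCircle r), IsCompact K → (D ∩ K).Finite := by
      intro K hK
      refine hK.induction_on (p := fun K => (D ∩ K).Finite) (by simp)
        (fun s t hst ht => ht.subset (Set.inter_subset_inter_right _ hst))
        (fun s t hs ht => by rw [Set.inter_union_distrib_left]; exact hs.union ht)
        (fun s _ => ?_)
      induction s using QuotientAddGroup.induction_on with
      | H s =>
        have h1 := eventually_fixed_or_not hr hH hPL s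
        refine ⟨((↑) : ℝ → AddCircle r) '' {y | y ≠ s →
          h y ≠ y ∨ ∀ᶠ t in 𝓝 (y : AddCircle r), h t = t}, ?_, ?_⟩
        · refine mem_nhdsWithin_of_mem_nhds ?_
          change _ ∈ 𝓝 (s : AddCircle r)
          rw [← map_coe_nhds]
          exact image_mem_map h1
        · refine (Set.finite_singleton (s : AddCircle r)).subset ?_
          rintro _ ⟨⟨hy1, hy2⟩, y, hy, rfl⟩
          by_contra hne
          have hys : y ≠ s := fun h0 => hne (by rw [h0]; rfl)
          rcases hy hys with h3 | h3
          exacts [h3 hy1, hy2 h3]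
    simpa using key _ isCompact_univ
  have hcx : ∀ s, h (f s) = f (h s) := fun s => (DFunLike.congr_fun hc.eq s).symm
  have hinv : ∀ s ∈ D, f s ∈ D := by
    rintro s ⟨h1, h2⟩
    refine ⟨by rw [hcx, h1], fun h3 => h2 ?_⟩
    filter_upwards [f.continuous.continuousAt.eventually h3] with t ht
    rw [hcx] at ht
    exact f.injective ht
  have hempty : D = ∅ := by
    by_contra hne
    obtain ⟨s, hs⟩ := Set.nonempty_iff_ne_empty.2 hne
    refine Set.infinite_of_injective_forall_mem (f := fun i : ℕ => (f ^ i) s) ?_ (fun i => ?_) hfin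
    · intro i j hij
      have hij : (f ^ i) s = (f ^ j) s := hij
      have e : f ^ ((i : ℤ) - j) = (f ^ j)⁻¹ * f ^ i := by
        rw [sub_eq_neg_add, zpow_add, zpow_neg, zpow_natCast, zpow_natCast]
      have := hf ((i : ℤ) - j) s (by
        rw [e]
        change (f ^ j).symm ((f ^ i) s) = s
        rw [hij, Homeomorph.symm_apply_apply])
      omega
    · induction i with
      | zero => exact hs
      | succ i ih =>
        have : (f ^ (i + 1)) s = f ((f ^ i) s) := by rw [pow_succ']; rfl
        rw [this]
        exact hinv _ ih
  have hopen : IsOpen {s | h s = s} := isOpen_iff_mem_nhds.2 fun s hs => by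
    by_contra hcon
    have : s ∈ D := ⟨hs, hcon⟩
    rw [hempty] at this
    exact this
  have hclosed : IsClosed {s | h s = s} := isClosed_eq h.continuous continuous_id
  have hpre : PreconnectedSpace (AddCircle r) :=
    ⟨by
      rw [← (QuotientAddGroup.mk_surjective (s := AddSubgroup.zmultiples r)).range_eq]
      exact isPreconnected_range (AddCircle.continuous_mk' r)⟩
  have huniv := IsClopen.eq_univ ⟨hclosed, hopen⟩ ⟨x, hx⟩
  ext s
  exact huniv.ge (Set.mem_univ s)

end FixedPoints

/-! ### Free abelian groups of rank two; the upper bound for `p ≥ 2` -/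

section RankTwo

variable {p : ℕ} {n : Fin p → ℕ} {r : ℝ} {f g : AddCircle r ≃ₜ AddCircle r}

/-- The underlying permutation of a homeomorphism, as a homomorphism. -/
def homeoToPerm (X : Type*) [TopologicalSpace X] : (X ≃ₜ X) →* Equiv.Perm X where
  toFun f := f.toEquiv
  map_one' := rfl
  map_mul' _ _ := rfl

/-- The rotation numbers of the centralizer of an element without periodic points that lies in a
free abelian group of rank two. -/
theorem exists_log_rotationNumber (hn : ∀ i, 1 < n i) (hr : 0 < r) (hrA : r ∈ breakRing n)
    (hf : f ∈ thompsonStein n r) (hg : g ∈ thompsonStein n r) (hfg : Commute f g)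
    (hper : ∀ (i : ℤ) x, (f ^ i) x = x → i = 0)
    (hrank : ∀ i j : ℤ, f ^ i * g ^ j = 1 → i = 0 ∧ j = 0) :
    ∃ β ∈ slopeGroup n, β ≠ 1 ∧ ∀ h ∈ thompsonStein n r, Commute f h →
      ∃ α ∈ slopeGroup n, HasRotationNumber h (Real.log α / Real.log β) := by
  classical
  let ι := homeoToPerm (AddCircle r)
  have hjump : ∀ h ∈ thompsonStein n r, ∃ (H : ℝ → ℝ) (s : AddCircle r → ℝ), IsLift h H ∧
      IsPL n H ∧ (∀ x : ℝ, s x = jump H x) ∧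
      (Function.support s).Finite ∧ (∀ x, s x ∈ logGroup hn) ∧
      ∀ x : ℝ, s x ≠ 0 → x ∈ breakRing n := fun h hh => by
    obtain ⟨H, hH, hPL⟩ := (mem_thompsonStein_iff hn hr hrA).1 hh
    obtain ⟨s, hs⟩ := exists_jump hn hr hrA hH hPL
    exact ⟨H, s, hH, hPL, hs⟩
  obtain ⟨F, s, hF, hFPL, hs, hsfin, hsL, hsA⟩ := hjump f hf
  have hcoc : ∀ (h : AddCircle r ≃ₜ AddCircle r) (H : ℝ → ℝ) (t : AddCircle r → ℝ), IsLift h H →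
      IsPL n H → (∀ x : ℝ, t x = jump H x) → Commute f h →
      ∀ x, s (h x) + t x = t (f x) + s x := by
    intro h H t hH hPL ht hc x
    induction x using QuotientAddGroup.induction_on with
    | H x =>
      have h1 := hFPL.jump_comp hn hPL x
      have h2 := hPL.jump_comp hn hFPL x
      rw [hF.commute hr hH hc, h2] at h1
      have h3 : s (h x) = jump F (H x) := by rw [← hH.coe_map, hs]
      have h4 : t (f x) = jump H (F x) := by rw [← hF.coe_map, ht]
      have h5 : t (x : ℝ) = jump H x := ht x
      have h6 : s (x : ℝ) = jump F x := hs x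
      change s (h (x : ℝ)) + t (x : ℝ) = t (f (x : ℝ)) + s (x : ℝ)
      rw [h3, h4, h5, h6, h1]
  obtain ⟨G, t, hG, hGPL, ht, htfin, -, -⟩ := hjump g hg
  have hmem : ∀ i j : ℤ, f ^ i * g ^ j ∈ thompsonStein n r := fun i j =>
    (mul_mem (zpow_mem (show f ∈ thompsonSteinSubgroup hn hr hrA from hf) i)
      (zpow_mem (show g ∈ thompsonSteinSubgroup hn hr hrA from hg) j))
  -- An element of the group generated by `f` and `g` that fixes a point is the identity, so having
  -- rank two already means acting freely.
  have hfree : ∀ (i j : ℤ) x, (ι f ^ i * ι g ^ j) x = x → i = 0 ∧ j = 0 := by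
    intro i j x hx
    rw [← map_zpow, ← map_zpow, ← map_mul] at hx
    refine hrank i j (eq_one_of_commute_of_fixedPoint hn hr hrA hper (hmem i j) ?_ hx)
    exact ((Commute.refl f).zpow_right i).mul_right (hfg.zpow_right j)
  have hper' : ∀ (i : ℤ) x, (ι f ^ i) x = x → i = 0 := fun i x hx => by
    rw [← map_zpow] at hx
    exact hper i x hx
  obtain ⟨u, hufin, hus, huL, hune⟩ := exists_coboundary (hfg.map ι) hfree hsfin htfin
    (hcoc g G t hG hGPL ht hfg)
  have huL := huL _ hsL
  -- Where `u` is nonzero the orbit meets a break of `f`, and powers of `f` preserve membership in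
  -- `A` both ways.
  have huA : ∀ x : ℝ, u x ≠ 0 → x ∈ breakRing n := by
    intro x hx
    obtain ⟨i, hi⟩ := hune _ hx
    rw [← map_zpow] at hi
    obtain ⟨K, hK, hKPL⟩ := (mem_thompsonStein_iff hn hr hrA).1
      (show f ^ i ∈ thompsonStein n r by simpa using hmem i 0)
    have hi : s ((f ^ i) x) ≠ 0 := hi
    rw [← hK.coe_map] at hi
    exact (hKPL.mem_iff hn).1 (hsA _ hi)
  have hB : ∀ b, u b ≠ 0 → b ∈ hufin.toFinset := fun b hb => by simpa using hb
  set C := ∑ b ∈ hufin.toFinset, u b with hC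
  have hCL : C ∈ logGroup hn := sum_mem fun b _ => huL b
  -- Mass zero would give a rational rotation number `q`, and then the power of `f` with exponent
  -- `q.den` would have a fixed point.
  have hC0 : C ≠ 0 := by
    intro h0
    obtain ⟨q, hq⟩ := (exists_rotationNumber_of_coboundary hn hr hrA hF hFPL hB huL huA
      (fun x => by rw [← hs, hus]; rfl)).2 h0
    have h1 := (hq.zpow hr q.den).congr (ρ' := 0) (by
      have : ((q.den : ℤ) : ℝ) * q = q.num := by exact_mod_cast Rat.den_mul_eq_num q
      rw [this, coe_eq_coe_iff]
      exact ⟨-q.num, by simp⟩)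
    obtain ⟨x, hx⟩ := h1.exists_fixedPoint hr
    have := hper _ x hx
    simp at this
  refine ⟨Real.exp C, hCL, by simpa using hC0, fun h hh hc => ?_⟩
  obtain ⟨H, v, hH, hHPL, hv, hvfin, -, -⟩ := hjump h hh
  have hvu := coboundary_of_commute hper' (hc.map ι) hufin hus hvfin (hcoc h H v hH hHPL hv hc)
  obtain ⟨l, hl, hrot⟩ := (exists_rotationNumber_of_coboundary hn hr hrA hH hHPL hB huL huA
      (fun x => by rw [← hv, hvu]; rfl)).1 hC0
  exact ⟨Real.exp l, hl, by rwa [Real.log_exp, Real.log_exp]⟩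

/-- The rotation number is a rational `c / i`, which is the quotient of the logarithms of the powers
`c` and `i` of a single generator. -/
theorem exists_log_of_periodicPoint (hn : ∀ i, 1 < n i) (hr : 0 < r) (j : Fin p) {F : ℝ → ℝ}
    (hF : IsLift f F) {i : ℤ} (hi : i ≠ 0) {x : AddCircle r} (hx : (f ^ i) x = x) :
    ∃ α ∈ slopeGroup n, ∃ β ∈ slopeGroup n,
      β ≠ 1 ∧ HasRotationNumber f (Real.log α / Real.log β) := by
  obtain ⟨ρ, hρ⟩ := hF.exists_rotationNumber hr
  obtain ⟨c, hc⟩ := (coe_eq_coe_iff _ _).1 ((hρ.zpow hr i).coe_eq_zero hr hx).symm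
  have h1 : (1 : ℝ) < n j := by exact_mod_cast hn j
  have hlog := Real.log_pos h1
  refine ⟨(n j : ℝ) ^ c, slopeGroup_zpow hn (slopeGroup_gen j) c, (n j : ℝ) ^ i,
    slopeGroup_zpow hn (slopeGroup_gen j) i, fun h0 => ?_, ?_⟩
  · have := congrArg Real.log h0
    rw [Real.log_zpow, Real.log_one, mul_eq_zero] at this
    rcases this with h2 | h2
    · exact hi (by exact_mod_cast h2)
    · exact hlog.ne' h2
  · convert hρ using 1
    have hi' : (i : ℝ) ≠ 0 := by exact_mod_cast hi
    rw [Real.log_zpow, Real.log_zpow]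
    field_simp
    linarith

/-- Elements of free abelian subgroups of rank two have logarithmic rotation numbers. -/
theorem exists_log_of_rank_two (hn : ∀ i, 1 < n i) (hr : 0 < r) (hrA : r ∈ breakRing n)
    (j : Fin p) {H : Subgroup (AddCircle r ≃ₜ AddCircle r)}
    (hH : (H : Set (AddCircle r ≃ₜ AddCircle r)) ⊆ thompsonStein n r)
    (hrk : IsFreeAbelianOfRank H 2) (hf : f ∈ H) :
    ∃ α ∈ slopeGroup n, ∃ β ∈ slopeGroup n,
      β ≠ 1 ∧ HasRotationNumber f (Real.log α / Real.log β) := by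
  by_cases hper : ∀ (i : ℤ) x, (f ^ i) x = x → i = 0
  · obtain ⟨e⟩ := hrk
    let φ : Multiplicative (Fin 2 → ℤ) →* (AddCircle r ≃ₜ AddCircle r) :=
      H.subtype.comp e.symm.toMonoidHom
    have hφ : Function.Injective φ := H.subtype_injective.comp e.symm.injective
    let a : Fin 2 → ℤ := (e ⟨f, hf⟩).toAdd
    have hfa : φ (Multiplicative.ofAdd a) = f := by
      change ((e.symm (e ⟨f, hf⟩) : H) : AddCircle r ≃ₜ AddCircle r) = f
      rw [e.symm_apply_apply]
    -- A vector orthogonal to `a`: the determinant of the pair is `a 0 ^ 2 + a 1 ^ 2`, so the two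
    -- elements are independent.
    let b : Fin 2 → ℤ := ![-a 1, a 0]
    have hfg : Commute f (φ (Multiplicative.ofAdd b)) := by
      rw [← hfa]
      exact (Commute.all _ _).map φ
    have ha : a ≠ 0 := by
      intro h0
      have h1 : f = 1 := by rw [← hfa, h0]; exact map_one φ
      have := hper 1 0 (by rw [h1]; rfl)
      exact one_ne_zero this
    obtain ⟨β, hβ, hβ1, hall⟩ := exists_log_rotationNumber hn hr hrA (hH hf)
      (hH (e.symm (Multiplicative.ofAdd b)).2) hfg hper (fun i j hij => by
        change f ^ i * φ (Multiplicative.ofAdd b) ^ j = 1 at hij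
        nth_rw 1 [← hfa] at hij
        rw [← map_zpow φ, ← map_zpow φ, ← map_mul φ, ← map_one φ, ← ofAdd_zsmul, ← ofAdd_zsmul,
          ← ofAdd_add] at hij
        have h0 : i • a + j • b = 0 := hφ hij
        have h1 : i * a 0 + j * (-a 1) = 0 := by simpa [b] using congrFun h0 0
        have h2 : i * a 1 + j * a 0 = 0 := by simpa [b] using congrFun h0 1
        have h3 : a 0 ^ 2 + a 1 ^ 2 ≠ 0 := fun h3 => ha (by
          have h4 : a 0 = 0 := by nlinarith [sq_nonneg (a 0), sq_nonneg (a 1)]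
          have h5 : a 1 = 0 := by nlinarith [sq_nonneg (a 0), sq_nonneg (a 1)]
          ext k
          fin_cases k <;> assumption)
        constructor
        · refine (mul_eq_zero.1 (?_ : i * (a 0 ^ 2 + a 1 ^ 2) = 0)).resolve_right h3
          linear_combination a 0 * h1 + a 1 * h2
        · refine (mul_eq_zero.1 (?_ : j * (a 0 ^ 2 + a 1 ^ 2) = 0)).resolve_right h3
          linear_combination a 0 * h2 - a 1 * h1)
    obtain ⟨α, hα, hrot⟩ := hall f (hH hf) (Commute.refl f)
    exact ⟨α, hα, β, hβ, hβ1, hrot⟩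
  · push Not at hper
    obtain ⟨i, x, hx, hi⟩ := hper
    obtain ⟨F, hF, -⟩ := hH hf
    exact exists_log_of_periodicPoint hn hr j hF hi hx

theorem log_slope_mem_span (hn : ∀ i, 1 < n i) {α : ℝ} (hα : α ∈ slopeGroup n) (c : ℝ) :
    Real.log α * c ∈ Submodule.span ℚ (Set.range fun i => Real.log (n i) * c) := by
  obtain ⟨k, rfl⟩ := hα
  rw [Real.log_prod fun i _ => zpow_ne_zero _ (by have := hn i; positivity), Finset.sum_mul]
  refine sum_mem fun i _ => ?_
  have : Real.log ((n i : ℝ) ^ k i) * c = (k i : ℚ) • (Real.log (n i) * c) := by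
    rw [Real.log_zpow, Rat.smul_def]
    push_cast
    ring
  rw [this]
  exact Submodule.smul_mem _ _ (Submodule.subset_span ⟨i, rfl⟩)

/-- Two basis elements supply the pair of rank two, and the resulting `β` serves the whole group. So
the `p + 1` independent numbers 1, `ρ i` would lie in the rational span of the `p` numbers `log (n
i) / log β`. -/
theorem not_containsFreeAction_of_two_le (hn : ∀ i, 1 < n i) (hr : 0 < r) (hrA : r ∈ breakRing n)
    (hp : 2 ≤ p) : ¬ ContainsFreeAction (thompsonStein n r) p := by
  rintro ⟨H, hH, ⟨e⟩, hfree⟩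
  let φ : Multiplicative (Fin p → ℤ) →* (AddCircle r ≃ₜ AddCircle r) :=
    H.subtype.comp e.symm.toMonoidHom
  have hφ : Function.Injective φ := H.subtype_injective.comp e.symm.injective
  let i₀ : Fin p := ⟨0, by omega⟩
  let i₁ : Fin p := ⟨1, by omega⟩
  have hne : i₀ ≠ i₁ := fun h => by simpa [i₀, i₁] using congrArg Fin.val h
  let b : Fin p → Multiplicative (Fin p → ℤ) := fun i => Multiplicative.ofAdd (Pi.single i 1)
  have hmem : ∀ m, φ m ∈ H := fun m => (e.symm m).2
  have hrank : ∀ i j : ℤ, φ (b i₀) ^ i * φ (b i₁) ^ j = 1 → i = 0 ∧ j = 0 := by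
    intro i j hij
    rw [← map_zpow φ, ← map_zpow φ, ← map_mul φ, ← map_one φ] at hij
    have h0 : i • (Pi.single i₀ 1 : Fin p → ℤ) + j • (Pi.single i₁ 1 : Fin p → ℤ) = 0 := hφ hij
    have h1 := congrFun h0 i₀
    have h2 := congrFun h0 i₁
    simp only [Pi.add_apply, Pi.smul_apply, Pi.single_eq_same, Pi.single_eq_of_ne hne,
      Pi.single_eq_of_ne hne.symm, Pi.zero_apply] at h1 h2
    simp at h1 h2
    exact ⟨h1, h2⟩
  have hper : ∀ (i : ℤ) x, (φ (b i₀) ^ i) x = x → i = 0 := fun i x hx =>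
    (hrank i 0 (by rw [zpow_zero, mul_one]; exact hfree _ (zpow_mem (hmem _) i) x hx)).1
  obtain ⟨β, hβ, hβ1, hall⟩ := exists_log_rotationNumber hn hr hrA (hH (hmem (b i₀)))
    (hH (hmem (b i₁))) ((Commute.all _ _).map φ) hper hrank
  choose α hα hrot using fun i => hall _ (hH (hmem (b i))) ((Commute.all _ _).map φ)
  have hli := linearIndependent_of_actsFreely hr e hfree hrot
  have hβ0 : Real.log β ≠ 0 := by
    have := slopeGroup_pos hn hβ
    refine Real.log_ne_zero_of_pos_of_ne_one this hβ1
  have hcard := linearIndependent_le_span_aux' _ hli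
    (Set.range fun i => Real.log (n i) * (Real.log β)⁻¹) (by
      rintro _ ⟨i, rfl⟩
      refine Fin.cases ?_ (fun i => ?_) i
      · rw [Fin.cons_zero, ← mul_inv_cancel₀ hβ0]
        exact log_slope_mem_span hn hβ _
      · rw [Fin.cons_succ, div_eq_mul_inv]
        exact log_slope_mem_span hn (hα i) _)
  have h2 := Fintype.card_range_le (fun i => Real.log (n i) * (Real.log β)⁻¹)
  rw [Fintype.card_fin] at hcard h2
  omega

end RankTwo

/-! ### Multiplications on the positive reals modulo a slope -/

section MultiplicationMaps

variable {p : ℕ} {n : Fin p → ℕ} {r : ℝ}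

/-- This number is the constant term of the `k`-th iterate of the affine map of slope `c` that fixes
`-E`. -/
theorem zpow_sub_one_mul_mem {c E : ℝ} (hn : ∀ i, 1 < n i) (hc : c ∈ slopeGroup n)
    (hE : (c - 1) * E ∈ breakRing n) (k : ℤ) : (c ^ k - 1) * E ∈ breakRing n := by
  have hc0 := (slopeGroup_pos hn hc).ne'
  induction k with
  | zero => simp
  | succ k ih =>
    have e : (c ^ ((k : ℤ) + 1) - 1) * E = c * ((c ^ (k : ℤ) - 1) * E) + (c - 1) * E := by
      rw [zpow_add_one₀ hc0]; ring
    rw [e]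
    exact add_mem (mul_mem (slopeGroup_subset hc) ih) hE
  | pred k ih =>
    have e : (c ^ (-(k : ℤ) - 1) - 1) * E = c⁻¹ * ((c ^ (-(k : ℤ)) - 1) * E - (c - 1) * E) := by
      rw [zpow_sub_one₀ hc0]
      field_simp
      ring
    rw [e]
    exact mul_mem (slopeGroup_subset (slopeGroup_inv hc)) (sub_mem ih hE)

/-- The developing map of an affine structure on the circle of length `r` with holonomy `c`. -/
theorem exists_developing_map (hn : ∀ i, 1 < n i) (hr : 0 < r) (hrA : r ∈ breakRing n) {c E : ℝ}
    (hc : c ∈ slopeGroup n) (hc1 : 1 < c) (hE : 0 < E) {ψ : ℝ → ℝ} (hψ : IsPL n ψ)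
    (hψ0 : ψ 0 = 0) (hψr : ψ r = (c - 1) * E) :
    ∃ φ : ℝ → ℝ, IsPL n φ ∧ (∀ x, φ (x + r) + E = c * (φ x + E)) ∧ (∀ x, 0 < φ x + E) ∧
      ∀ y, 0 < y → ∃ x, φ x + E = y := by
  have hc0 : 0 < c := zero_lt_one.trans hc1
  have hEA : (c - 1) * E ∈ breakRing n := hψr ▸ (hψ.mem_iff hn).2 hrA
  -- On the `k`-th period the developing map is a copy of `ψ` followed by the `k`-th power of the
  -- holonomy, which multiplies distances to `-E` by `c`.
  let Φ : ℤ → ℝ → ℝ := fun k x => c ^ k * (ψ (x - k * r) + E) - E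
  let φ : ℝ → ℝ := fun x => Φ ⌊x / r⌋ x
  have hkr : ∀ k : ℤ, (k : ℝ) * r ∈ breakRing n := fun k => mul_mem (intCast_mem _ k) hrA
  have hΦPL : ∀ k, IsPL n (Φ k) := fun k => by
    have h1 := (IsPL.affine (n := n) (c ^ k) ((c ^ k - 1) * E) (slopeGroup_zpow hn hc k)
      (zpow_sub_one_mul_mem hn hc hEA k)).comp hn
      (hψ.comp hn (IsPL.affine (n := n) 1 (-(k * r)) slopeGroup_one (neg_mem (hkr k))))
    convert h1 using 1
    funext x
    simp only [Φ, Function.comp_apply]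
    rw [one_mul, ← sub_eq_add_neg]
    ring
  have hfl : ∀ (k : ℤ) x, k * r ≤ x → x < (k + 1) * r → ⌊x / r⌋ = k := fun k x h1 h2 => by
    rw [Int.floor_eq_iff, le_div_iff₀ hr, div_lt_iff₀ hr]
    exact ⟨h1, h2⟩
  have hΦk : ∀ k : ℤ, Φ k (k * r) = c ^ k * E - E := fun k => by
    simp only [Φ, sub_self, hψ0, zero_add]
  have hΦk1 : ∀ k : ℤ, Φ k ((k + 1) * r) = c ^ (k + 1) * E - E := fun k => by
    have : ((k : ℝ) + 1) * r - k * r = r := by ring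
    simp only [Φ, this, hψr]
    rw [zpow_add_one₀ hc0.ne']
    ring
  have hφk : ∀ k : ℤ, φ (k * r) = c ^ k * E - E := fun k => by
    have : ⌊(k : ℝ) * r / r⌋ = k := by rw [mul_div_cancel_right₀ _ hr.ne', Int.floor_intCast]
    simp only [φ, this, hΦk]
  have hφΦ : ∀ (k : ℤ) x, k * r ≤ x → x ≤ (k + 1) * r → φ x = Φ k x := fun k x h1 h2 => by
    rcases h2.eq_or_lt with h3 | h3
    · have := hφk (k + 1)
      push_cast at this
      rw [h3, this, hΦk1]
    · simp only [φ, hfl k x h1 h3]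
  have hφPL : IsPL n φ := by
    refine ⟨fun x => ?_, ?_⟩
    · set k := ⌊x / r⌋ with hk
      -- The period whose half-open interval `(k' r, (k' + 1) r]` contains `x` governs the left
      -- germ. It differs from `k` only at multiples of `r`, which lie in `A`.
      set k' := ⌈x / r⌉ - 1 with hk'
      have h1 : k * r ≤ x := (le_div_iff₀ hr).1 (Int.floor_le _)
      have h2 : x < (k + 1) * r := (div_lt_iff₀ hr).1 (Int.lt_floor_add_one _)
      have h3 : k' * r < x := by
        rw [← lt_div_iff₀ hr, hk']
        have := Int.ceil_lt_add_one (x / r)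
        push_cast
        linarith
      have h4 : x ≤ (k' + 1) * r := by
        rw [← div_le_iff₀ hr, hk']
        have := Int.le_ceil (x / r)
        push_cast
        linarith
      have hR : AffR φ x (rs (Φ k) x) := by
        filter_upwards [(hΦPL k).affR x, Ico_mem_nhdsGE h2] with y hy hy'
        rw [hφΦ k y (h1.trans hy'.1) hy'.2.le, hφΦ k x h1 h2.le, hy]
      have hL : AffL φ x (ls (Φ k') x) := by
        filter_upwards [(hΦPL k').affL x, Ioc_mem_nhdsLE h3] with y hy hy'
        rw [hφΦ k' y hy'.1.le (hy'.2.trans h4), hφΦ k' x h3.le h4, hy]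
      refine ⟨_, (hΦPL k').ls_mem x, _, (hΦPL k).rs_mem x, hL, hR, fun hne => ?_⟩
      by_cases hkk : k' = k
      · rw [hkk] at hne
        exact (hΦPL k).mem_of_ne hne
      · have h5 : (k' : ℝ) < k + 1 := by
          have := h3.trans h2
          exact lt_of_mul_lt_mul_right this hr.le
        have h6 : (k : ℝ) ≤ k' + 1 := by
          have := h1.trans h4
          exact le_of_mul_le_mul_right this hr
        have h7 : k = k' + 1 := by
          have h8 : k' < k + 1 := by exact_mod_cast h5
          have h9 : k ≤ k' + 1 := by exact_mod_cast h6
          omega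
        have h8 : x = k * r := by
          refine le_antisymm ?_ h1
          rw [h7]; push_cast; exact h4
        rw [h8]
        exact hkr k
    · have := hφk 0
      simp only [Int.cast_zero, zero_mul, zpow_zero, one_mul, sub_self] at this
      rw [this]
      exact zero_mem _
  have hmono := hφPL.strictMono hn
  refine ⟨φ, hφPL, fun x => ?_, fun x => ?_, fun y hy => ?_⟩
  · have h1 : ⌊(x + r) / r⌋ = ⌊x / r⌋ + 1 := by
      rw [add_div, div_self hr.ne', Int.floor_add_one]
    have h2 : x + r - ((⌊x / r⌋ + 1 : ℤ) : ℝ) * r = x - ⌊x / r⌋ * r := by push_cast; ring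
    simp only [φ, Φ, h1, h2]
    rw [zpow_add_one₀ hc0.ne']
    ring
  · have h1 : ⌊x / r⌋ * r ≤ x := (le_div_iff₀ hr).1 (Int.floor_le _)
    have h2 := hmono.monotone h1
    rw [hφk] at h2
    have : 0 < c ^ ⌊x / r⌋ * E := by positivity
    linarith
  · obtain ⟨k, hk⟩ := exists_mem_Ico_zpow (x := y / E) (y := c) (by positivity) hc1
    rw [Set.mem_Ico, le_div_iff₀ hE, div_lt_iff₀ hE] at hk
    obtain ⟨x, hx⟩ := mem_range_of_exists_le_of_exists_ge (c := y - E) hφPL.continuous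
      ⟨k * r, by rw [hφk]; linarith⟩
      ⟨((k + 1 : ℤ) : ℝ) * r, by rw [hφk]; linarith⟩
    exact ⟨x, by rw [hx]; ring⟩

/-- Multiplications, read in the developing map, are elements of the Thompson-Stein group. -/
theorem exists_multiplications (hn : ∀ i, 1 < n i) (hr : 0 < r) (hrA : r ∈ breakRing n) {c E : ℝ}
    (hc : c ∈ slopeGroup n) (hc1 : 1 < c) (hE : 0 < E) {ψ : ℝ → ℝ} (hψ : IsPL n ψ)
    (hψ0 : ψ 0 = 0) (hψr : ψ r = (c - 1) * E) :
    ∃ φ : ℝ → ℝ, Function.Injective φ ∧ ∀ l ∈ slopeGroup n, (l - 1) * E ∈ breakRing n →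
      ∃ f ∈ thompsonStein n r, HasRotationNumber f (Real.log l / Real.log c) ∧
        ∃ F, IsLift f F ∧ ∀ x, φ (F x) = l * φ x := by
  obtain ⟨φ, hφ, hφr, hpos, hsurj⟩ := exists_developing_map hn hr hrA hc hc1 hE hψ hψ0 hψr
  have hmono := hφ.strictMono hn
  refine ⟨fun x => φ x + E, (hmono.add_const E).injective, fun l hl hlE => ?_⟩
  have hl0 := slopeGroup_pos hn hl
  -- `F` is multiplication by `l` conjugated by the developing map `φ + E`, a bijection onto the
  -- positive reals.
  choose F hF using fun x => hsurj (l * (φ x + E)) (mul_pos hl0 (hpos x))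
  have hFm : StrictMono F := fun x y hxy => by
    rw [← hmono.lt_iff_lt]
    have h1 := mul_lt_mul_of_pos_left (hmono hxy) hl0
    have h2 := hF x
    have h3 := hF y
    linarith
  have hFs : Function.Surjective F := fun y => by
    obtain ⟨x, hx⟩ := hsurj (l⁻¹ * (φ y + E)) (mul_pos (inv_pos.2 hl0) (hpos y))
    refine ⟨x, hmono.injective ?_⟩
    have := hF x
    rw [hx, mul_inv_cancel_left₀ hl0.ne'] at this
    linarith
  have hFc : Continuous F := hFm.monotone.continuous_of_surjective hFs
  have hFp : ∀ x, F (x + r) = F x + r := fun x => by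
    apply hmono.injective
    have h1 := hF (x + r)
    have h2 := hφr (F x)
    rw [hφr] at h1
    rw [hF] at h2
    linarith
  obtain ⟨f, hf⟩ := IsLift.exists_homeomorph hr hFc hFm hFp
  have hPL : IsPL n F := by
    refine hφ.of_comp hn ?_ hFc hFm.monotone
    convert (IsPL.affine (n := n) l ((l - 1) * E) hl hlE).comp hn hφ using 1
    funext x
    have := hF x
    simp only [Function.comp_apply]
    linarith
  refine ⟨f, (mem_thompsonStein_iff hn hr hrA).2 ⟨F, hf, hPL⟩, ?_, F, hf, hF⟩
  have hlc := (Real.log_pos hc1).ne'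
  refine hf.hasRotationNumber_of_semiconj hr (θ := fun x => Real.log (φ x + E) / Real.log c)
    (((hφ.continuous.add continuous_const).log fun x => (hpos x).ne').div_const _)
    (fun x => ?_) (fun x => ?_)
  · rw [hφr, Real.log_mul (slopeGroup_pos hn hc).ne' (hpos x).ne']
    field_simp
    ring
  · rw [hF, Real.log_mul hl0.ne' (hpos x).ne']
    ring

/-- By pigeonhole two powers of `n i` agree modulo `n j - 1`, so `n j - 1` divides `n i ^ b * (n i ^
K - 1)`. The first factor is a unit of `A`, so no coprimality is needed. -/
theorem exists_pow_sub_one_div_mem (hn : ∀ i, 1 < n i) (i j : Fin p) :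
    ∃ K : ℕ, 0 < K ∧ ((n i : ℝ) ^ K - 1) / ((n j : ℝ) - 1) ∈ breakRing n := by
  obtain ⟨q, hq⟩ : ∃ q, n j = q + 1 := Nat.exists_eq_add_one.2 (zero_lt_one.trans (hn j))
  have hq0 : 0 < q := by have := hn j; omega
  have : NeZero q := ⟨hq0.ne'⟩
  obtain ⟨a, b, hab, h⟩ :=
    Finite.exists_ne_map_eq_of_infinite fun a : ℕ => ((n i : ZMod q)) ^ a
  wlog hlt : b < a generalizing a b
  · exact this b a hab.symm h.symm (by omega)
  obtain ⟨K, rfl⟩ := Nat.exists_eq_add_of_lt hlt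
  refine ⟨K + 1, Nat.succ_pos K, ?_⟩
  have h1 : ((q : ℤ)) ∣ (n i : ℤ) ^ b * ((n i : ℤ) ^ (K + 1) - 1) := by
    rw [← ZMod.intCast_zmod_eq_zero_iff_dvd]
    push_cast
    rw [mul_sub, ← pow_add, mul_one, ← add_assoc]
    exact sub_eq_zero.2 h
  obtain ⟨z, hz⟩ := h1
  have hz' : (n i : ℝ) ^ b * ((n i : ℝ) ^ (K + 1) - 1) = q * z := by exact_mod_cast hz
  have hni : (n i : ℝ) ≠ 0 := by have := hn i; positivity
  have hq' : (q : ℝ) ≠ 0 := by exact_mod_cast hq0.ne'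
  have e : ((n i : ℝ) ^ (K + 1) - 1) / ((n j : ℝ) - 1) = (n i : ℝ)⁻¹ ^ b * z := by
    rw [hq]
    push_cast
    rw [add_sub_cancel_right, inv_pow]
    field_simp
    linarith
  rw [e]
  exact mul_mem (pow_mem (inv_mem_breakRing i) b) (intCast_mem _ z)

/-- Take holonomy `n 0` and the identity as `ψ`, which forces `E = r / (n 0 - 1)`. Multiplications
by suitable powers of the other generators commute, and their rotation numbers are positive integer
multiples of `log (n i) / log (n 0)`. -/
theorem containsIndependentRotations {m : ℕ} {n : Fin (m + 1) → ℕ} (hn : ∀ i, 1 < n i)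
    (hind : LinearIndependent ℚ fun i => Real.log (n i)) (hr : 0 < r) (hrA : r ∈ breakRing n) :
    ContainsIndependentRotations (thompsonStein n r) m := by
  have hc1 : (1 : ℝ) < n 0 := by exact_mod_cast hn 0
  have hc10 : (n 0 : ℝ) - 1 ≠ 0 := by linarith
  choose K hK hKA using fun i : Fin m => exists_pow_sub_one_div_mem hn i.succ 0
  obtain ⟨φ, hφ, hall⟩ := exists_multiplications hn hr hrA (E := r / (n 0 - 1)) (slopeGroup_gen 0)
    hc1 (div_pos hr (by linarith)) (IsPL.id (n := n)) rfl (by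
      rw [id, mul_div_cancel₀ _ hc10])
  choose f hf hrot F hF hφF using fun i : Fin m =>
    hall ((n i.succ : ℝ) ^ K i) (slopeGroup_pow hn (slopeGroup_gen _) _) (by
      have := mul_mem (hKA i) hrA
      rwa [div_mul_eq_mul_div, ← mul_div_assoc'] at this)
  have hlog : Real.log (n 0) ≠ 0 := (Real.log_pos hc1).ne'
  have hli : LinearIndependent ℚ (Fin.cons 1 fun i : Fin m =>
      Real.log ((n i.succ : ℝ) ^ K i) / Real.log (n 0) : Fin (m + 1) → ℝ) := by
    rw [linearIndependent_cons_iff]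
    intro a b hab
    rw [← LinearIndependent.iff_fractionRing ℤ ℚ, Fintype.linearIndependent_iff] at hind
    have := hind (Fin.cons (-b) fun i => a i * K i) (by
      rw [Fin.sum_univ_succ]
      simp only [Fin.cons_zero, Fin.cons_succ, zsmul_eq_mul]
      have e : ∀ i, ((a i * K i : ℤ) : ℝ) * Real.log (n i.succ) =
          (a i * (Real.log ((n i.succ : ℝ) ^ K i) / Real.log (n 0))) * Real.log (n 0) := fun i => by
        rw [Real.log_pow]
        push_cast
        field_simp
      simp_rw [e]
      rw [← Finset.sum_mul, hab]
      push_cast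
      ring)
    ext i
    have h1 := this i.succ
    simp only [Fin.cons_succ, mul_eq_zero, Nat.cast_eq_zero] at h1
    exact h1.resolve_right (hK i).ne'
  refine ⟨f, _, hf, fun i j => ?_, hrot, irrational_of_linearIndependent hli, hli⟩
  have hFF : ∀ x, F i (F j x) = F j (F i x) := fun x => by
    apply hφ
    rw [hφF, hφF, hφF, hφF]
    ring
  ext x
  induction x using QuotientAddGroup.induction_on with
  | H x =>
    change f i (f j (x : ℝ)) = f j (f i (x : ℝ))
    rw [← (hF j).coe_map, ← (hF i).coe_map, ← (hF i).coe_map, ← (hF j).coe_map, hFF]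

end MultiplicationMaps

/-! ### Piecewise linear equivalence of intervals; realizing logarithmic quotients -/

section Rescaling

variable {p : ℕ} {n : Fin p → ℕ}

/-- The interval `[0, x]` is carried onto `[0, y]` by a piecewise linear homeomorphism. -/
def PLEquiv (n : Fin p → ℕ) (x y : ℝ) : Prop :=
  ∃ ψ : ℝ → ℝ, IsPL n ψ ∧ Function.Surjective ψ ∧ ψ 0 = 0 ∧ ψ x = y

theorem PLEquiv.refl (x : ℝ) : PLEquiv n x x :=
  ⟨id, IsPL.id, Function.surjective_id, rfl, rfl⟩

theorem PLEquiv.trans (hn : ∀ i, 1 < n i) {x y z : ℝ} (h : PLEquiv n x y) (h' : PLEquiv n y z) :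
    PLEquiv n x z := by
  obtain ⟨ψ, h1, h2, h3, h4⟩ := h
  obtain ⟨χ, h1', h2', h3', h4'⟩ := h'
  exact ⟨χ ∘ ψ, h1'.comp hn h1, h2'.comp h2, by simp [h3, h3'], by simp [h4, h4']⟩

theorem PLEquiv.symm (hn : ∀ i, 1 < n i) {x y : ℝ} (h : PLEquiv n x y) : PLEquiv n y x := by
  obtain ⟨ψ, h1, h2, h3, h4⟩ := h
  have hm := h1.strictMono hn
  let e := hm.orderIsoOfSurjective ψ h2
  have he : ∀ x, ψ (e.symm x) = x := fun x => e.apply_symm_apply x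
  have he' : ∀ x, e.symm (ψ x) = x := fun x => e.symm_apply_apply x
  refine ⟨e.symm, h1.of_comp hn ?_ e.symm.continuous e.symm.monotone, e.symm.surjective, ?_, ?_⟩
  · convert IsPL.id (n := n)
    exact funext he
  · rw [← h3, he', h3]
  · rw [← h4, he']

/-- Stretch `[0, 1]` by the factor `n i` and translate everything to its right by `n i - 1`. -/
theorem PLEquiv.add_sub_one (hn : ∀ i, 1 < n i) (i : Fin p) {M : ℝ} (hM : 1 ≤ M) :
    PLEquiv n M (M + (n i - 1)) := by
  have hni : (1 : ℝ) < n i := by exact_mod_cast hn i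
  let θ : ℝ → ℝ := fun x => x + (n i - 1) * max 0 (min x 1)
  have h0 : ∀ x, x ≤ 0 → θ x = x := fun x hx => by
    simp [θ, min_eq_left (hx.trans zero_le_one), hx]
  have h1 : ∀ x, 0 ≤ x → x ≤ 1 → θ x = n i * x := fun x hx hx' => by
    simp only [θ, min_eq_left hx', max_eq_right hx]; ring
  have h2 : ∀ x, 1 ≤ x → θ x = x + (n i - 1) := fun x hx => by
    simp [θ, min_eq_right hx]
  have hθ : IsPL n θ := by
    have hL : ∀ x, ∃ a ∈ slopeGroup n, AffL θ x a ∧ (a = if 0 < x ∧ x ≤ 1 then (n i : ℝ) else 1) := by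
      intro x
      rcases le_or_gt x 0 with hx | hx
      · refine ⟨1, slopeGroup_one, ?_, by rw [if_neg fun h => absurd h.1 hx.not_gt]⟩
        filter_upwards [self_mem_nhdsWithin] with y hy
        rw [h0 x hx, h0 y (le_trans hy hx)]; ring
      · rcases le_or_gt x 1 with hx1 | hx1
        · refine ⟨n i, slopeGroup_gen i, ?_, by rw [if_pos ⟨hx, hx1⟩]⟩
          filter_upwards [Ioc_mem_nhdsLE hx] with y hy
          rw [h1 x hx.le hx1, h1 y hy.1.le (hy.2.trans hx1)]; ring
        · refine ⟨1, slopeGroup_one, ?_, by rw [if_neg fun h => absurd h.2 hx1.not_ge]⟩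
          filter_upwards [Ioc_mem_nhdsLE hx1] with y hy
          rw [h2 x hx1.le, h2 y hy.1.le]; ring
    have hR : ∀ x, ∃ a ∈ slopeGroup n, AffR θ x a ∧ (a = if 0 ≤ x ∧ x < 1 then (n i : ℝ) else 1) := by
      intro x
      rcases lt_or_ge x 0 with hx | hx
      · refine ⟨1, slopeGroup_one, ?_, by rw [if_neg fun h => absurd h.1 hx.not_ge]⟩
        filter_upwards [Ico_mem_nhdsGE hx] with y hy
        rw [h0 x hx.le, h0 y hy.2.le]; ring
      · rcases lt_or_ge x 1 with hx1 | hx1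
        · refine ⟨n i, slopeGroup_gen i, ?_, by rw [if_pos ⟨hx, hx1⟩]⟩
          filter_upwards [Ico_mem_nhdsGE hx1] with y hy
          rw [h1 x hx hx1.le, h1 y (hx.trans hy.1) hy.2.le]; ring
        · refine ⟨1, slopeGroup_one, ?_, by rw [if_neg fun h => absurd h.2 hx1.not_gt]⟩
          filter_upwards [self_mem_nhdsWithin] with y hy
          rw [h2 x hx1, h2 y (le_trans hx1 hy)]; ring
    refine ⟨fun x => ?_, by rw [h0 0 le_rfl]; exact zero_mem _⟩
    obtain ⟨a, ha, haL, hae⟩ := hL x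
    obtain ⟨b, hb, hbR, hbe⟩ := hR x
    refine ⟨a, ha, b, hb, haL, hbR, fun hne => ?_⟩
    by_contra hx
    have hx0 : x ≠ 0 := fun h => hx (h ▸ zero_mem _)
    have hx1 : x ≠ 1 := fun h => hx (h ▸ one_mem _)
    refine hne ?_
    rw [hae, hbe]
    congr 1
    rw [eq_iff_iff, lt_iff_le_and_ne, lt_iff_le_and_ne (b := (1 : ℝ))]
    exact ⟨fun h => ⟨h.1.1, h.2, hx1⟩, fun h => ⟨⟨h.1, hx0.symm⟩, h.2.1⟩⟩
  refine ⟨θ, hθ, fun y => ?_, h0 0 le_rfl, h2 M hM⟩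
  have hb0 : ∀ x : ℝ, 0 ≤ max 0 (min x 1) := fun x => le_max_left _ _
  have hb1 : ∀ x : ℝ, max 0 (min x 1) ≤ 1 := fun x => max_le zero_le_one (min_le_right _ _)
  refine mem_range_of_exists_le_of_exists_ge hθ.continuous ⟨y - (n i - 1), ?_⟩ ⟨y, ?_⟩
  · have := mul_le_mul_of_nonneg_left (hb1 (y - (n i - 1))) (show (0 : ℝ) ≤ n i - 1 by linarith)
    simp only [θ]
    linarith
  · have := mul_nonneg (show (0 : ℝ) ≤ n i - 1 by linarith) (hb0 y)
    simp only [θ]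
    linarith

theorem PLEquiv.add_sum (hn : ∀ i, 1 < n i) {M : ℝ} (hM : 1 ≤ M) (a : Fin p → ℕ) :
    PLEquiv n M (M + ∑ i, a i * ((n i : ℝ) - 1)) := by
  have hni : ∀ i, (0 : ℝ) ≤ n i - 1 := fun i => by
    have : (1 : ℝ) < n i := by exact_mod_cast hn i
    linarith
  have one : ∀ (i : Fin p) (M : ℝ), 1 ≤ M → ∀ k : ℕ, PLEquiv n M (M + k * ((n i : ℝ) - 1)) := by
    intro i M hM k
    induction k with
    | zero => simpa using PLEquiv.refl M
    | succ k ih =>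
      have h1 := PLEquiv.add_sub_one hn i (M := M + k * ((n i : ℝ) - 1))
        (by have := mul_nonneg (Nat.cast_nonneg (α := ℝ) k) (hni i); linarith)
      convert ih.trans hn h1 using 1
      push_cast
      ring
  have key : ∀ s : Finset (Fin p), PLEquiv n M (M + ∑ i ∈ s, a i * ((n i : ℝ) - 1)) := by
    intro s
    induction s using Finset.induction_on with
    | empty => simpa using PLEquiv.refl M
    | insert i s hi ih =>
      rw [Finset.sum_insert hi, add_comm (_ * _), ← add_assoc]
      refine ih.trans hn (one i _ ?_ _)
      have : 0 ≤ ∑ i ∈ s, a i * ((n i : ℝ) - 1) :=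
        Finset.sum_nonneg fun i _ => mul_nonneg (Nat.cast_nonneg _) (hni i)
      linarith
  exact key _

theorem exists_sum_eq_gcd (n : Fin p → ℕ) (hn : ∀ i, 1 < n i) :
    ∃ z : Fin p → ℤ, ((Finset.univ.gcd fun i => n i - 1 : ℕ) : ℤ) = ∑ i, z i * ((n i : ℤ) - 1) := by
  obtain ⟨g, hg⟩ := (IsPrincipalIdealRing.principal
    (Ideal.span (Set.range fun i => (n i : ℤ) - 1))).principal
  have hg' : Ideal.span (Set.range fun i => (n i : ℤ) - 1) = Ideal.span {g} := hg
  have hdvd : g ∣ ((Finset.univ.gcd fun i => n i - 1 : ℕ) : ℤ) := by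
    rw [Int.dvd_natCast]
    refine Finset.dvd_gcd fun i _ => ?_
    rw [← Int.dvd_natCast, Nat.cast_sub (hn i).le, Nat.cast_one, ← Ideal.mem_span_singleton, ← hg']
    exact Ideal.subset_span ⟨i, rfl⟩
  rw [← Ideal.mem_span_singleton, ← hg', Ideal.mem_span_range_iff_exists_fun] at hdvd
  obtain ⟨z, hz⟩ := hdvd
  exact ⟨z, hz.symm⟩

/-- By Bézout, `T d - d` is an integer combination of the numbers `n i - 1`. Lengths can only be
increased by these numbers, so the positive coefficients are added to `d`, the negative ones to `T
d`, and the two results agree. -/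
theorem PLEquiv.gcd_mul (hn : ∀ i, 1 < n i) {d : ℕ} (hd : d = Finset.univ.gcd fun i => n i - 1)
    (hd0 : 0 < d) {T : ℕ} (hT : 0 < T) : PLEquiv n d (T * d) := by
  obtain ⟨z, hz⟩ := exists_sum_eq_gcd n hn
  rw [← hd] at hz
  have hz' : (d : ℝ) = ∑ i, z i * ((n i : ℝ) - 1) := by exact_mod_cast hz
  have h1 := PLEquiv.add_sum hn (M := d) (by exact_mod_cast hd0)
    fun i => (((T : ℤ) - 1) * z i).toNat
  have h2 := PLEquiv.add_sum hn (M := T * d) (by exact_mod_cast Nat.mul_pos hT hd0)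
    fun i => (-(((T : ℤ) - 1) * z i)).toNat
  have e : (d : ℝ) + ∑ i, ((((T : ℤ) - 1) * z i).toNat : ℝ) * ((n i : ℝ) - 1) =
      T * d + ∑ i, ((-(((T : ℤ) - 1) * z i)).toNat : ℝ) * ((n i : ℝ) - 1) := by
    have h3 : ∀ i, ((((T : ℤ) - 1) * z i).toNat : ℝ) * ((n i : ℝ) - 1) =
        ((-(((T : ℤ) - 1) * z i)).toNat : ℝ) * ((n i : ℝ) - 1) +
          (T - 1) * (z i * ((n i : ℝ) - 1)) := fun i => by
      have h4 := Int.toNat_sub_toNat_neg (((T : ℤ) - 1) * z i)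
      have h5 : ((((T : ℤ) - 1) * z i).toNat : ℝ) - ((-(((T : ℤ) - 1) * z i)).toNat : ℝ) =
          ((T : ℝ) - 1) * z i := by exact_mod_cast h4
      linear_combination ((n i : ℝ) - 1) * h5
    simp_rw [h3]
    rw [Finset.sum_add_distrib, ← Finset.mul_sum, ← hz']
    ring
  rw [e] at h1
  exact h1.trans hn (h2.symm hn)

/-- Every `n i` is congruent to 1 modulo `d`, hence so is every slope modulo `d A`. -/
theorem exists_slope_sub_one_eq (hn : ∀ i, 1 < n i) {d : ℕ}
    (hd : d = Finset.univ.gcd fun i => n i - 1) {β : ℝ} (hβ : β ∈ slopeGroup n) :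
    ∃ b ∈ breakRing n, β - 1 = d * b := by
  obtain ⟨k, rfl⟩ := hβ
  have hmul : ∀ x y : ℝ, x ∈ breakRing n → (∃ b ∈ breakRing n, x - 1 = d * b) →
      (∃ b ∈ breakRing n, y - 1 = d * b) → ∃ b ∈ breakRing n, x * y - 1 = d * b := by
    rintro x y hx ⟨b, hb, h⟩ ⟨c, hc, h'⟩
    exact ⟨x * c + b, add_mem (mul_mem hx hc) hb, by linear_combination x * h' + h⟩
  have hgen : ∀ i, ∃ b ∈ breakRing n, (n i : ℝ) - 1 = d * b := fun i => by
    have h1 : d ∣ n i - 1 := hd ▸ Finset.gcd_dvd (Finset.mem_univ i)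
    obtain ⟨m, hm⟩ := h1
    refine ⟨m, natCast_mem _ m, ?_⟩
    have h2 : ((n i - 1 : ℕ) : ℝ) = d * m := by rw [hm]; push_cast; ring
    rwa [Nat.cast_sub (hn i).le, Nat.cast_one] at h2
  have hinv : ∀ i, ∃ b ∈ breakRing n, (n i : ℝ)⁻¹ - 1 = d * b := fun i => by
    obtain ⟨b, hb, h⟩ := hgen i
    have hni : (n i : ℝ) ≠ 0 := by have := hn i; positivity
    refine ⟨-((n i : ℝ)⁻¹ * b), neg_mem (mul_mem (inv_mem_breakRing i) hb), ?_⟩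
    field_simp
    linear_combination -h
  have hpow : ∀ x : ℝ, x ∈ breakRing n → (∃ b ∈ breakRing n, x - 1 = d * b) → ∀ m : ℕ,
      ∃ b ∈ breakRing n, x ^ m - 1 = d * b := fun x hx h m => by
    induction m with
    | zero => exact ⟨0, zero_mem _, by simp⟩
    | succ m ih => rw [pow_succ']; exact hmul _ _ hx h ih
  have hzpow : ∀ i, ∃ b ∈ breakRing n, (n i : ℝ) ^ k i - 1 = d * b := fun i => by
    rcases k i with m | m
    · simpa using hpow _ (natCast_mem _ _) (hgen i) m
    · rw [zpow_negSucc, ← inv_pow]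
      exact hpow _ (inv_mem_breakRing i) (hinv i) _
  have key : ∀ s : Finset (Fin p), ∃ b ∈ breakRing n, ∏ i ∈ s, (n i : ℝ) ^ k i - 1 = d * b := by
    intro s
    induction s using Finset.induction_on with
    | empty => exact ⟨0, zero_mem _, by simp⟩
    | insert i s hi ih =>
      rw [Finset.prod_insert hi]
      exact hmul _ _ (slopeGroup_subset (slopeGroup_zpow hn (slopeGroup_gen i) _)) (hzpow i) ih
  exact key _

/-- Every quotient of logarithms of slopes is a rotation number in the group of length `d`. -/
theorem exists_rotationNumber_eq_log_div_log (hn : ∀ i, 1 < n i) (j : Fin p) {d : ℕ}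
    (hd : d = Finset.univ.gcd fun i => n i - 1) {α β : ℝ} (hα : α ∈ slopeGroup n)
    (hβ : β ∈ slopeGroup n) (hβ1 : β ≠ 1) :
    ∃ f ∈ thompsonStein n (d : ℝ), HasRotationNumber f (Real.log α / Real.log β) := by
  wlog hlt : 1 < β generalizing α β
  · have hβ0 := slopeGroup_pos hn hβ
    have h1 : β < 1 := lt_of_le_of_ne (not_lt.1 hlt) hβ1
    have := this (slopeGroup_inv hα) (slopeGroup_inv hβ) (by simpa using hβ1)
      ((one_lt_inv₀ hβ0).2 h1)
    rwa [Real.log_inv, Real.log_inv, neg_div_neg_eq] at this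
  have hd0 : 0 < d := by
    rw [hd, Nat.pos_iff_ne_zero, Ne, Finset.gcd_eq_zero_iff]
    intro h
    have h1 := h j (Finset.mem_univ j)
    have h2 := hn j
    omega
  have hd0' : (0 : ℝ) < d := by exact_mod_cast hd0
  obtain ⟨b, hb, hβb⟩ := exists_slope_sub_one_eq hn hd hβ
  obtain ⟨N, z, hz⟩ := exists_pow_mul_eq_int hn hb
  have hEΛ : (∏ i, (n i : ℝ)) ^ N ∈ slopeGroup n :=
    slopeGroup_pow hn ⟨fun _ => 1, by simp⟩ N
  -- `E` clears the denominator of `(β - 1) / d`, so that `(β - 1) E` is an integral multiple of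
  -- `d`. Being itself a slope, it lies in `A`, so that `(l - 1) E ∈ A` for every slope `l`.
  set E := (∏ i, (n i : ℝ)) ^ N with hE
  have hE0 : 0 < E := slopeGroup_pos hn hEΛ
  have hb0 : 0 < b := by
    have : 0 < (d : ℝ) * b := by rw [← hβb]; linarith
    exact pos_of_mul_pos_right this hd0'.le
  have hz0 : 0 < z := by
    have : (0 : ℝ) < z := by rw [← hz]; positivity
    exact_mod_cast this
  lift z to ℕ using hz0.le
  obtain ⟨ψ, hψ, -, hψ0, hψd⟩ := PLEquiv.gcd_mul hn hd hd0 (T := z) (by exact_mod_cast hz0)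
  obtain ⟨φ, -, hall⟩ := exists_multiplications hn hd0' (natCast_mem _ d) hβ hlt hE0 hψ hψ0 (by
    rw [hψd, hβb]
    push_cast at hz
    rw [← hz]
    ring)
  obtain ⟨f, hf, hrot, -⟩ := hall α hα
    (mul_mem (sub_mem (slopeGroup_subset hα) (one_mem _)) (slopeGroup_subset hEΛ))
  exact ⟨f, hf, hrot⟩

end Rescaling

/-! ### Closest return times and Denjoy's inequality -/

section Denjoy

variable {Φ : CircleDeg1Liftˣ}

theorem unit_zpow_add_apply (i j : ℤ) (x : ℝ) : (Φ ^ (i + j)) x = (Φ ^ i) ((Φ ^ j) x) := by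
  rw [zpow_add, Units.val_mul, CircleDeg1Lift.mul_apply]

/-- Orbits are weakly ordered like those of the rotation by the translation number. -/
theorem le_of_zpow_add_le {k k' s s' : ℤ} {x : ℝ} (h : (Φ ^ k) x + s ≤ (Φ ^ k') x + s') :
    k * CircleDeg1Lift.translationNumber Φ + s ≤ k' * CircleDeg1Lift.translationNumber Φ + s' := by
  have h1 : (Φ ^ (k - k')) ((Φ ^ k') x) ≤ (Φ ^ k') x + (s' - s : ℤ) := by
    rw [← unit_zpow_add_apply, sub_add_cancel]
    push_cast
    linarith
  have h2 := CircleDeg1Lift.translationNumber_le_of_le_add_int _ h1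
  rw [CircleDeg1Lift.translationNumber_zpow] at h2
  push_cast at h2
  linarith

/-- The intervals `Φ ^ i (lo, hi]`, `0 ≤ i < m`, being disjoint modulo `1`, they cover a point of
the circle at most once. -/
theorem sum_floor_sub_floor_le_one {lo hi : ℝ} (hlh : lo ≤ hi) (hlt : hi < lo + 1) {m : ℕ}
    (hdis : ∀ k : ℕ, 0 < k → k < m → ∀ s : ℤ, (Φ ^ (k : ℤ)) lo + s < hi →
      ¬ lo < (Φ ^ (k : ℤ)) hi + s) (c : ℝ) :
    0 ≤ ∑ i ∈ Finset.range m, (⌊(Φ ^ (i : ℤ)) hi - c⌋ - ⌊(Φ ^ (i : ℤ)) lo - c⌋) ∧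
    ∑ i ∈ Finset.range m, (⌊(Φ ^ (i : ℤ)) hi - c⌋ - ⌊(Φ ^ (i : ℤ)) lo - c⌋) ≤ 1 := by
  -- `D i` counts the points of `c + ℤ` in the `i`-th interval.
  set D : ℕ → ℤ := fun i => ⌊(Φ ^ (i : ℤ)) hi - c⌋ - ⌊(Φ ^ (i : ℤ)) lo - c⌋ with hD
  have hD0 : ∀ i, 0 ≤ D i := fun i => by
    have := (strictMono_unit (Φ ^ (i : ℤ))).monotone hlh
    exact sub_nonneg.2 (Int.floor_mono (by linarith))
  have hD1 : ∀ i, D i ≤ 1 := fun i => by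
    have h1 := strictMono_unit (Φ ^ (i : ℤ)) hlt
    rw [CircleDeg1Lift.map_add_one] at h1
    have h2 : ⌊(Φ ^ (i : ℤ)) hi - c⌋ ≤ ⌊(Φ ^ (i : ℤ)) lo - c + 1⌋ := Int.floor_mono (by linarith)
    rw [Int.floor_add_one] at h2
    simp only [hD]
    linarith
  have hex : ∀ i, D i ≠ 0 → ∃ L : ℤ, (Φ ^ (i : ℤ)) lo < c + L ∧ c + L ≤ (Φ ^ (i : ℤ)) hi := by
    intro i hi0
    refine ⟨⌊(Φ ^ (i : ℤ)) hi - c⌋, ?_, by linarith [Int.floor_le ((Φ ^ (i : ℤ)) hi - c)]⟩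
    have h1 : ⌊(Φ ^ (i : ℤ)) lo - c⌋ < ⌊(Φ ^ (i : ℤ)) hi - c⌋ := by
      have := lt_of_le_of_ne (hD0 i) hi0.symm
      simp only [hD] at this
      linarith
    have := Int.floor_lt.1 h1
    linarith
  -- Two intervals that both meet `c + ℤ` would, pulled back by `Φ ^ (-i)`, overlap modulo 1 at a
  -- time below `m`.
  have hno : ∀ i j, i < j → j < m → D i ≠ 0 → D j ≠ 0 → False := by
    intro i j hij hjm hi0 hj0
    obtain ⟨L, h1, h2⟩ := hex i hi0
    obtain ⟨L', h3, h4⟩ := hex j hj0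
    let z := (Φ ^ (-(i : ℤ))) (c + L)
    have hm := strictMono_unit (Φ ^ (-(i : ℤ)))
    have e0 : ∀ y, (Φ ^ (-(i : ℤ))) ((Φ ^ (i : ℤ)) y) = y := fun y => by
      rw [← unit_zpow_add_apply, neg_add_cancel]; rfl
    have e1 : ∀ y, (Φ ^ (-(i : ℤ))) ((Φ ^ (j : ℤ)) y) = (Φ ^ ((j - i : ℕ) : ℤ)) y := fun y => by
      rw [← unit_zpow_add_apply]
      congr 3
      push_cast [hij.le]
      ring
    have h1' : lo < z := by simpa only [e0] using hm h1
    have h2' : z ≤ hi := by simpa only [e0] using hm.monotone h2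
    have ez : (Φ ^ (-(i : ℤ))) (c + L') = z + (L' - L : ℤ) := by
      have : c + (L' : ℝ) = c + L + (L' - L : ℤ) := by push_cast; ring
      rw [this, CircleDeg1Lift.map_add_int]
    have h3' := hm h3
    have h4' := hm.monotone h4
    rw [e1, ez] at h3'
    rw [e1, ez] at h4'
    push_cast at h3' h4'
    refine hdis (j - i) (by omega) (by omega) (L - L') ?_ ?_
    · push_cast; linarith
    · push_cast; linarith
  refine ⟨Finset.sum_nonneg fun i _ => hD0 i, ?_⟩
  by_cases hall : ∀ i ∈ Finset.range m, D i = 0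
  · rw [Finset.sum_eq_zero hall]; exact zero_le_one
  · push Not at hall
    obtain ⟨i, hi, hi0⟩ := hall
    rw [Finset.sum_eq_single i]
    · exact hD1 i
    · intro j hj hji
      by_contra hj0
      rw [Finset.mem_range] at hi hj
      rcases lt_or_gt_of_ne hji with h | h
      · exact hno j i h hi hj0 hi0
      · exact hno i j h hj hi0 hj0
    · exact fun h => absurd hi h

/-- Return times `m` closer than all the previous ones exist beyond every bound. -/
theorem exists_best_approximation {ρ : ℝ} (hρ : ∀ k : ℕ, 0 < k → ∀ s : ℤ, (k : ℝ) * ρ + s ≠ 0)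
    (M : ℕ) : ∃ m > M, ∃ t : ℤ, |m * ρ - t| < 1 ∧
      ∀ k : ℕ, 0 < k → k < m → ∀ s : ℤ, |m * ρ - t| < |k * ρ + s| := by
  have hpos : ∀ k : ℕ, 0 < k → 0 < |k * ρ - round (k * ρ)| := fun k hk => by
    have := hρ k hk (-round (k * ρ))
    push_cast at this
    exact abs_pos.2 this
  -- No return up to time `M` is closer than `δ`. By Dirichlet some return is closer; the first such
  -- time exceeds `M` and beats all its predecessors.
  obtain ⟨δ, hδ0, hδ⟩ : ∃ δ > 0, ∀ k : ℕ, 0 < k → k ≤ M → δ ≤ |k * ρ - round (k * ρ)| := by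
    induction M with
    | zero => exact ⟨1, one_pos, fun k h1 h2 => by omega⟩
    | succ M ih =>
      obtain ⟨δ, h0, h⟩ := ih
      refine ⟨min δ |(M + 1 : ℕ) * ρ - round ((M + 1 : ℕ) * ρ)|,
        lt_min h0 (hpos _ (Nat.succ_pos M)), fun k h1 h2 => ?_⟩
      rcases Nat.le_succ_iff.1 h2 with h3 | h3
      · exact (min_le_left _ _).trans (h k h1 h3)
      · rw [h3]; exact min_le_right _ _
  have hex : ∃ k : ℕ, 0 < k ∧ |k * ρ - round (k * ρ)| < δ := by
    obtain ⟨N, hN⟩ := exists_nat_gt (1 / δ)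
    have hN0 : 0 < N := by
      have : (0 : ℝ) < N := (by positivity : (0 : ℝ) < 1 / δ).trans hN
      exact_mod_cast this
    obtain ⟨k, hk, -, h⟩ := Real.exists_nat_abs_mul_sub_round_le ρ hN0
    refine ⟨k, hk, h.trans_lt ?_⟩
    rw [div_lt_iff₀ hδ0] at hN
    rw [div_lt_iff₀ (by positivity)]
    linarith
  classical
  obtain ⟨hm0, hm⟩ := Nat.find_spec hex
  refine ⟨Nat.find hex, ?_, round (Nat.find hex * ρ), ?_, fun k hk hkm s => ?_⟩
  · by_contra hle
    exact absurd hm (hδ _ hm0 (not_lt.1 hle)).not_gt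
  · have := abs_sub_round ((Nat.find hex : ℝ) * ρ)
    linarith
  · have h1 := Nat.find_min hex hkm
    push Not at h1
    have h2 := round_le ((k : ℝ) * ρ) (-s)
    push_cast at h2
    rw [sub_neg_eq_add] at h2
    exact hm.trans_le ((h1 hk).trans h2)

variable {p : ℕ} {n : Fin p → ℕ} {r : ℝ} {f : AddCircle r ≃ₜ AddCircle r}

/-- All lifts differ by multiples of `r`, which lies in `A`, so one piecewise linear lift suffices.
-/
theorem IsUnitLift.isPL (hn : ∀ i, 1 < n i) (hr : 0 < r) (hrA : r ∈ breakRing n)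
    (hf : f ∈ thompsonStein n r) (hΦ : IsUnitLift f Φ) : IsPL n fun x => r * Φ (x / r) := by
  obtain ⟨F, hF, hPL⟩ := (mem_thompsonStein_iff hn hr hrA).1 hf
  obtain ⟨Ψ, hΨ, h⟩ := hF.exists_unit hr
  obtain ⟨k, hk⟩ := hΨ.exists_int hr hΦ
  convert (IsPL.affine (n := n) 1 (k * r) slopeGroup_one
    (mul_mem (intCast_mem _ k) hrA)).comp hn hPL using 1
  funext x
  have := h (x / r)
  rw [mul_div_cancel₀ _ hr.ne'] at this
  rw [Function.comp_apply, ← this, hk]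
  ring

/-- The logarithm of the right slope at `x` of the `k`-th iterate of `Φ`, rescaled by `r`. -/
noncomputable def logSlope (r : ℝ) (Φ : CircleDeg1Liftˣ) (k : ℤ) (x : ℝ) : ℝ :=
  Real.log (rs (fun y => r * (Φ ^ k) (y / r)) x)

theorem logSlope_add (hn : ∀ i, 1 < n i) (hr : 0 < r) (hrA : r ∈ breakRing n)
    (hf : f ∈ thompsonStein n r) (hΦ : IsUnitLift f Φ) (i j : ℤ) (x : ℝ) :
    logSlope r Φ (i + j) x = logSlope r Φ i (r * (Φ ^ j) (x / r)) + logSlope r Φ j x := by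
  have hmem : ∀ k : ℤ, f ^ k ∈ thompsonStein n r := fun k =>
    zpow_mem (show f ∈ thompsonSteinSubgroup hn hr hrA from hf) k
  have hPL : ∀ k : ℤ, IsPL n fun x => r * (Φ ^ k) (x / r) := fun k =>
    (hΦ.zpow k).isPL hn hr hrA (hmem k)
  have e : (fun y => r * (Φ ^ (i + j)) (y / r)) =
      (fun y => r * (Φ ^ i) (y / r)) ∘ fun y => r * (Φ ^ j) (y / r) := funext fun y => by
    rw [Function.comp_apply, mul_div_cancel_left₀ _ hr.ne', unit_zpow_add_apply]
  rw [logSlope, e, (hPL i).rs_comp hn (hPL j),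
    Real.log_mul ((hPL i).rs_pos hn _).ne' ((hPL j).rs_pos hn _).ne']
  rfl

theorem logSlope_zero (hr : 0 < r) (x : ℝ) : logSlope r Φ 0 x = 0 := by
  have e : (fun y => r * (Φ ^ (0 : ℤ)) (y / r)) = id := funext fun y => by
    rw [zpow_zero]
    exact mul_div_cancel₀ _ hr.ne'
  rw [logSlope, e]
  have : AffR (id : ℝ → ℝ) x 1 := Eventually.of_forall fun y => by simp
  rw [this.rs_eq, Real.log_one]

/-- Denjoy's inequality at the closest return times. -/
theorem exists_denjoy_bound (hn : ∀ i, 1 < n i) (hr : 0 < r) (hrA : r ∈ breakRing n)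
    (hf : f ∈ thompsonStein n r) (hΦ : IsUnitLift f Φ) :
    ∃ V : ℝ, ∀ (m : ℕ) (t : ℤ), |m * CircleDeg1Lift.translationNumber Φ - t| < 1 →
      (∀ k : ℕ, 0 < k → k < m → ∀ s : ℤ, |m * CircleDeg1Lift.translationNumber Φ - t| <
        |k * CircleDeg1Lift.translationNumber Φ + s|) →
      ∀ x, |logSlope r Φ m x + logSlope r Φ (-m) x| ≤ V := by
  set ρ := CircleDeg1Lift.translationNumber Φ with hρ
  have hlift := hΦ.isLift hr
  have hPL := hΦ.isPL hn hr hrA hf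
  set F : ℝ → ℝ := fun x => r * Φ (x / r) with hF
  obtain ⟨s, hs, hsfin, -, -⟩ := exists_jump hn hr hrA hlift hPL
  set B := hsfin.toFinset with hB
  have hmB : ∀ b, s b ≠ 0 → b ∈ B := fun b hb => by simpa [hB] using hb
  have hl1 : ∀ x, logSlope r Φ 1 x = Real.log (rs F x) := fun x => by
    rw [logSlope, zpow_one]
  -- the logarithm of the slope is a step function
  have hstep : ∀ x y, logSlope r Φ 1 x - logSlope r Φ 1 y = stepFun s B x - stepFun s B y := by
    intro x y
    have := eq_of_locally_const (κ := fun x => Real.log (rs F x) - stepFun s B x)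
      (fun x => by
        filter_upwards [(hPL.affL x).rs_eventually, stepFun_left hr s B hmB x] with y h1 h2
        rw [h1, h2, hs, jump]
        ring)
      (fun x => by
        filter_upwards [(hPL.affR x).rs_eventually, stepFun_right hr s B x] with y h1 h2
        rw [h1, h2]) x y
    rw [hl1, hl1]
    linarith
  have hsum : ∀ (m : ℕ) x, logSlope r Φ m x =
      ∑ i ∈ Finset.range m, logSlope r Φ 1 (r * (Φ ^ (i : ℤ)) (x / r)) := fun m x => by
    induction m with
    | zero => simpa using logSlope_zero hr x
    | succ m ih =>
      rw [Finset.sum_range_succ, ← ih, Nat.cast_succ, add_comm (m : ℤ),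
        logSlope_add hn hr hrA hf hΦ, add_comm]
  refine ⟨∑ b ∈ B, |s b|, fun m t h1 hbest x => ?_⟩
  set ξ := x / r with hξ
  have hx : x = r * ξ := by rw [hξ, mul_div_cancel₀ _ hr.ne']
  -- `η` is the representative of the `m`-th preimage close to `ξ`. The slope of the inverse iterate
  -- at `x` is the inverse of the slope of the `m`-th iterate at `r η`, so the sum to bound compares
  -- the orbits of `ξ` and `η` term by term.
  set η := (Φ ^ (-(m : ℤ))) ξ + t with hη
  have hback : logSlope r Φ (-m) x = -logSlope r Φ m (r * η) := by
    have h2 := logSlope_add hn hr hrA hf hΦ m (-m) x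
    rw [add_neg_cancel, logSlope_zero hr] at h2
    have h3 : logSlope r Φ m (r * η) = logSlope r Φ m (r * (Φ ^ (-(m : ℤ))) (x / r)) := by
      rw [hsum, hsum]
      refine Finset.sum_congr rfl fun i _ => ?_
      rw [mul_div_cancel_left₀ _ hr.ne', mul_div_cancel_left₀ _ hr.ne', hη,
        CircleDeg1Lift.map_add_int, hl1, hl1, mul_add, mul_comm r (t : ℝ)]
      have hper : Function.Periodic (rs F) r := fun y => (hPL.add_period hn hrA hlift y).1
      rw [hper.int_mul t]
    rw [h3]
    linarith
  have hC : ∀ c : ℝ, |((∑ i ∈ Finset.range m,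
      (⌊(Φ ^ (i : ℤ)) ξ - c⌋ - ⌊(Φ ^ (i : ℤ)) η - c⌋) : ℤ) : ℝ)| ≤ 1 := by
    intro c
    have e1 : ∀ k : ℕ, (Φ ^ (k : ℤ)) η = (Φ ^ ((k : ℤ) - m)) ξ + t := fun k => by
      rw [hη, CircleDeg1Lift.map_add_int, ← unit_zpow_add_apply, sub_eq_add_neg]
    have e2 : (Φ ^ (0 : ℤ)) ξ = ξ := rfl
    rw [abs_lt] at h1
    -- If the arc between `ξ` and `η` overlapped its `k`-th image, translation numbers would give
    -- `|k ρ + s| ≤ |m ρ - t|`, against the choice of `m`.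
    have hcon : ∀ k : ℕ, 0 < k → k < m → ∀ s : ℤ, (k : ℝ) * ρ + s ≤ |m * ρ - t| →
        -|m * ρ - t| ≤ (k : ℝ) * ρ + s → False := fun k hk hkm s h2 h3 =>
      (hbest k hk hkm s).not_ge (abs_le.2 ⟨h3, h2⟩)
    rcases le_total η ξ with hle | hle
    · have hlt : ξ < η + 1 := by
        by_contra! h2
        have h3 := le_of_zpow_add_le (Φ := Φ) (k := -m) (k' := 0) (s := t + 1) (s' := 0) (x := ξ)
          (by rw [e2]; push_cast; rw [hη] at h2; linarith)
        push_cast at h3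
        linarith
      obtain ⟨h2, h3⟩ := sum_floor_sub_floor_le_one (Φ := Φ) hle hlt (m := m)
        (fun k hk hkm s h4 h5 => by
          rw [e1] at h4
          have h6 := le_of_zpow_add_le (Φ := Φ) (k := k - m) (k' := 0) (s := t + s) (s' := 0) (x := ξ)
            (by rw [e2]; push_cast; linarith)
          have h7 := le_of_zpow_add_le (Φ := Φ) (k := -m) (k' := k) (s := t) (s' := s) (x := ξ)
            (by rw [hη] at h5; exact h5.le)
          push_cast at h6 h7
          refine hcon k hk hkm s ?_ ?_
          · have := le_abs_self (m * ρ - t)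
            linarith
          · have := le_abs_self (m * ρ - t)
            linarith) c
      rw [abs_le]
      constructor
      · have : (0 : ℝ) ≤ _ := Int.cast_nonneg h2
        linarith
      · exact_mod_cast h3
    · have hlt : η < ξ + 1 := by
        by_contra! h2
        have h3 := le_of_zpow_add_le (Φ := Φ) (k := 0) (k' := -m) (s := 1) (s' := t) (x := ξ)
          (by rw [e2]; push_cast; rw [hη] at h2; linarith)
        push_cast at h3
        linarith
      obtain ⟨h2, h3⟩ := sum_floor_sub_floor_le_one (Φ := Φ) hle hlt (m := m)
        (fun k hk hkm s h4 h5 => by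
          rw [e1] at h5
          have h6 := le_of_zpow_add_le (Φ := Φ) (k := 0) (k' := k - m) (s := 0) (s' := t + s) (x := ξ)
            (by rw [e2]; push_cast; linarith)
          have h7 := le_of_zpow_add_le (Φ := Φ) (k := k) (k' := -m) (s := s) (s' := t) (x := ξ)
            (by rw [hη] at h4; exact h4.le)
          push_cast at h6 h7
          refine hcon k hk hkm s ?_ ?_
          · have := neg_le_abs (m * ρ - t)
            linarith
          · have := neg_le_abs (m * ρ - t)
            linarith) c
      have e3 : ∑ i ∈ Finset.range m, (⌊(Φ ^ (i : ℤ)) ξ - c⌋ - ⌊(Φ ^ (i : ℤ)) η - c⌋) =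
          -∑ i ∈ Finset.range m, (⌊(Φ ^ (i : ℤ)) η - c⌋ - ⌊(Φ ^ (i : ℤ)) ξ - c⌋) := by
        rw [← Finset.sum_neg_distrib]
        exact Finset.sum_congr rfl fun i _ => by ring
      rw [e3, Int.cast_neg, abs_neg, abs_le]
      constructor
      · have : (0 : ℝ) ≤ _ := Int.cast_nonneg h2
        linarith
      · exact_mod_cast h3
  have hfl : ∀ (y : ℝ) (b : AddCircle r), (r * y - b.out) / r = y - b.out / r := fun y b => by
    field_simp
  -- Each break `b` contributes its jump times the signed number of its crossings by the `m` arcs,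
  -- which is at most one in absolute value.
  have hmain : logSlope r Φ m x + logSlope r Φ (-m) x = ∑ b ∈ B, s b *
      ((∑ i ∈ Finset.range m, (⌊(Φ ^ (i : ℤ)) ξ - b.out / r⌋ -
        ⌊(Φ ^ (i : ℤ)) η - b.out / r⌋) : ℤ) : ℝ) := by
    rw [hback, hsum, hsum, ← sub_eq_add_neg, ← Finset.sum_sub_distrib]
    simp_rw [hstep, mul_div_cancel_left₀ _ hr.ne', ← hξ, stepFun, hfl, ← Finset.sum_sub_distrib]
    rw [Finset.sum_comm]
    refine Finset.sum_congr rfl fun b _ => ?_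
    push_cast
    rw [Finset.mul_sum]
    exact Finset.sum_congr rfl fun i _ => by ring
  rw [hmain]
  refine (Finset.abs_sum_le_sum_abs _ _).trans (Finset.sum_le_sum fun b _ => ?_)
  rw [abs_mul]
  exact mul_le_of_le_one_right (abs_nonneg _) (hC _)

end Denjoy

/-! ### Denominators along orbits; periodic points for `p = 1` -/

section Heights

variable {N : ℕ} {x y : ℝ}

/-- `N ^ M * x` is an integer. -/
def IntAt (N M : ℕ) (x : ℝ) : Prop := ∃ z : ℤ, (N : ℝ) ^ M * x = z

theorem IntAt.mono {M M' : ℕ} (h : IntAt N M x) (hM : M ≤ M') : IntAt N M' x := by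
  obtain ⟨z, hz⟩ := h
  refine ⟨N ^ (M' - M) * z, ?_⟩
  push_cast
  rw [← hz, ← mul_assoc, ← pow_add, Nat.sub_add_cancel hM]

theorem IntAt.add {M : ℕ} (h : IntAt N M x) (h' : IntAt N M y) : IntAt N M (x + y) := by
  obtain ⟨z, hz⟩ := h
  obtain ⟨z', hz'⟩ := h'
  exact ⟨z + z', by push_cast; rw [mul_add, hz, hz']⟩

theorem IntAt.int_mul {M : ℕ} (h : IntAt N M x) (k : ℤ) : IntAt N M (k * x) := by
  obtain ⟨z, hz⟩ := h
  exact ⟨k * z, by push_cast; rw [← hz]; ring⟩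

theorem IntAt.finite_Icc (hN : 0 < N) (M : ℕ) (a b : ℝ) :
    {x ∈ Set.Icc a b | IntAt N M x}.Finite := by
  have hN' : (0 : ℝ) < (N : ℝ) ^ M := by positivity
  refine ((Set.finite_Icc ⌊(N : ℝ) ^ M * a⌋ ⌈(N : ℝ) ^ M * b⌉).image
    fun z : ℤ => (z : ℝ) / (N : ℝ) ^ M).subset ?_
  rintro x ⟨⟨h1, h2⟩, z, hz⟩
  refine ⟨z, ⟨Int.floor_le_iff.2 ?_, Int.le_ceil_iff.2 ?_⟩, ?_⟩
  · have := mul_le_mul_of_nonneg_left h1 hN'.le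
    linarith
  · have := mul_le_mul_of_nonneg_left h2 hN'.le
    linarith
  · simp only
    rw [← hz]
    field_simp

theorem exists_common_intAt {T : Set ℝ} (hT : T.Finite) (h : ∀ x ∈ T, ∃ M, IntAt N M x) :
    ∃ M, ∀ x ∈ T, IntAt N M x := by
  induction T, hT using Set.Finite.induction_on with
  | empty => exact ⟨0, fun x hx => absurd hx (Set.notMem_empty x)⟩
  | @insert a s _ _ ih =>
    obtain ⟨M, hM⟩ := ih fun x hx => h x (Set.mem_insert_of_mem a hx)
    obtain ⟨M', hM'⟩ := h a (Set.mem_insert a s)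
    refine ⟨max M M', fun x hx => ?_⟩
    rcases hx with rfl | hx
    · exact hM'.mono (le_max_right _ _)
    · exact (hM x hx).mono (le_max_left _ _)

/-- The least exponent `M` such that `N ^ M * x` is an integer. -/
noncomputable def height (N : ℕ) (x : ℝ) : ℕ := sInf {M | IntAt N M x}

theorem intAt_height (h : ∃ M, IntAt N M x) : IntAt N (height N x) x := Nat.sInf_mem h

theorem height_le {M : ℕ} (h : IntAt N M x) : height N x ≤ M := Nat.sInf_le h

/-- An affine map of slope `N ^ k` lowers large heights by `k`. -/
theorem height_affine (hN : 0 < N) {k : ℤ} {K M : ℕ} {b : ℝ} (hk : |k| ≤ K) (hb : IntAt N M b)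
    (hx : ∃ M, IntAt N M x) (hlarge : M + K < height N x) :
    (height N ((N : ℝ) ^ k * x + b) : ℤ) = height N x - k := by
  have hN0 : (N : ℝ) ≠ 0 := by positivity
  rw [abs_le] at hk
  -- The height exceeds `M + K` and `|k| ≤ K`, so `v` is a natural number above `M`. At levels from
  -- `M` on, `b` is integral and can be added or removed freely, so only the factor `N ^ k` matters.
  obtain ⟨v, hv⟩ : ∃ v : ℕ, (v : ℤ) = height N x - k := ⟨((height N x : ℤ) - k).toNat, by omega⟩
  have hvM : M < v := by omega
  have e : ∀ a c : ℕ, (c : ℤ) = a - k → (N : ℝ) ^ c * ((N : ℝ) ^ k * x) = (N : ℝ) ^ a * x := by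
    intro a c hac
    rw [← mul_assoc, ← zpow_natCast, hac, ← zpow_add₀ hN0, sub_add_cancel, zpow_natCast]
  rw [← hv, Nat.cast_inj]
  obtain ⟨z, hz⟩ := intAt_height hx
  have hmem : IntAt N v ((N : ℝ) ^ k * x) := ⟨z, by rw [e _ _ hv, hz]⟩
  refine le_antisymm (height_le (hmem.add (hb.mono hvM.le))) ?_
  by_contra! hlt
  have h1 := (intAt_height ⟨v, hmem.add (hb.mono hvM.le)⟩).mono (Nat.le_sub_one_of_lt hlt)
  have h2 := h1.add ((hb.mono (Nat.le_sub_one_of_lt hvM)).int_mul (-1))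
  have h3 : (N : ℝ) ^ k * x + b + ((-1 : ℤ) : ℝ) * b = (N : ℝ) ^ k * x := by push_cast; ring
  rw [h3] at h2
  obtain ⟨z', hz'⟩ := h2
  rw [e (height N x - 1) (v - 1) (by omega)] at hz'
  have := height_le ⟨z', hz'⟩
  omega

/-- Near each point a step function takes at most two values. Applied to slopes and intercepts, this
bounds exponents and denominators over one period. -/
theorem finite_image_Icc {Y : Type*} {g : ℝ → Y}
    (hr : ∀ x, ∀ᶠ y in 𝓝[>] x, g y = g x) (hl : ∀ x, ∃ a, ∀ᶠ y in 𝓝[<] x, g y = a) (a b : ℝ) :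
    (g '' Set.Icc a b).Finite := by
  refine (isCompact_Icc (a := a) (b := b)).induction_on (p := fun K => (g '' K).Finite) (by simp)
    (fun s t hst ht => ht.subset (Set.image_mono hst))
    (fun s t hs ht => by rw [Set.image_union]; exact hs.union ht) (fun x _ => ?_)
  obtain ⟨c, hc⟩ := hl x
  have h : ∀ᶠ y in 𝓝 x, g y = g x ∨ g y = c := eventually_nhds_of_sides (Or.inl rfl)
    (hc.mono fun y hy => Or.inr hy) ((hr x).mono fun y hy => Or.inl hy)
  refine ⟨_, mem_nhdsWithin_of_mem_nhds h, (Set.toFinite {g x, c}).subset ?_⟩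
  rintro _ ⟨y, hy, rfl⟩
  exact hy

variable {n : Fin 1 → ℕ} {r : ℝ} {f : AddCircle r ≃ₜ AddCircle r} {F : ℝ → ℝ}

theorem exists_intAt (hn : ∀ i, 1 < n i) (hx : x ∈ breakRing n) : ∃ M, IntAt (n 0) M x := by
  obtain ⟨M, z, h⟩ := exists_pow_mul_eq_int hn hx
  exact ⟨M, z, by simpa using h⟩

theorem exists_zpow_eq (hx : x ∈ slopeGroup n) : ∃ k : ℤ, x = (n 0 : ℝ) ^ k := by
  obtain ⟨k, rfl⟩ := hx
  exact ⟨k 0, by simp⟩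

/-- At points of large height, the slope is the exponential of the drop of the height. -/
theorem exists_log_rs_eq_height (hn : ∀ i, 1 < n i) (hr : 0 < r) (hrA : r ∈ breakRing n)
    (hf : IsLift f F) (hF : IsPL n F) :
    ∃ L : ℕ, ∀ x ∈ breakRing n, L < height (n 0) x →
      Real.log (rs F x) = ((height (n 0) x : ℝ) - height (n 0) (F x)) * Real.log (n 0) := by
  have hfin1 : (rs F '' Set.Icc 0 r).Finite :=
    finite_image_Icc (fun x => (hF.affR x).rs_eventually)
      (fun x => ⟨_, (hF.affL x).rs_eventually⟩) 0 r
  have hfin2 : ((fun x => F x - rs F x * x) '' Set.Icc 0 r).Finite := by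
    refine finite_image_Icc (fun x => ?_) (fun x => ⟨F x - ls F x * x, ?_⟩) 0 r
    · filter_upwards [(hF.affR x).rs_eventually,
        (hF.affR x).filter_mono (nhdsWithin_mono x Set.Ioi_subset_Ici_self)] with y h1 h2
      rw [h1, h2]; ring
    · filter_upwards [(hF.affL x).rs_eventually,
        (hF.affL x).filter_mono (nhdsWithin_mono x Set.Iio_subset_Iic_self)] with y h1 h2
      rw [h1, h2]; ring
  obtain ⟨M₁, hM₁⟩ := exists_common_intAt (N := n 0) hfin2 (by
    rintro _ ⟨x, -, rfl⟩
    exact exists_intAt hn (hF.sub_rs_mul_mem x))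
  obtain ⟨M₂, hM₂⟩ := exists_common_intAt (N := n 0) (hfin1.image fun c => r * (1 - c)) (by
    rintro _ ⟨_, ⟨x, -, rfl⟩, rfl⟩
    exact exists_intAt hn (mul_mem hrA (sub_mem (one_mem _) (slopeGroup_subset (hF.rs_mem x)))))
  choose! κ hκ using fun (x : ℝ) (hx : x ∈ slopeGroup n) => exists_zpow_eq hx
  obtain ⟨K, hK⟩ : ∃ K : ℕ, ∀ x ∈ Set.Icc 0 r, |κ (rs F x)| ≤ K := by
    obtain ⟨K, hK⟩ := ((hfin1.image κ).image fun k => k.natAbs).bddAbove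
    refine ⟨K, fun x hx => ?_⟩
    have := hK ⟨_, ⟨_, ⟨x, hx, rfl⟩, rfl⟩, rfl⟩
    rw [Int.abs_eq_natAbs]
    exact_mod_cast this
  refine ⟨max M₁ M₂ + K, fun x hx hlarge => ?_⟩
  have hper : Function.Periodic (rs F) r := fun y => (hF.add_period hn hrA hf y).1
  set j := ⌊x / r⌋ with hj
  set x₀ := x - j * r with hx₀
  have hx₀m : x₀ ∈ Set.Icc 0 r := ⟨Int.sub_floor_div_mul_nonneg x hr,
    (Int.sub_floor_div_mul_lt x hr).le⟩
  have hxx : x = x₀ + j * r := by rw [hx₀]; ring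
  have hrs : rs F x = rs F x₀ := by rw [hx₀]; exact (hper.sub_int_mul_eq j).symm
  -- Moving by `j` periods changes the intercept by an integer multiple of `r (1 - slope)`, so a
  -- single exponent works on the whole line.
  have hb : IntAt (n 0) (max M₁ M₂) (F x - rs F x * x) := by
    have e : F x - rs F x * x = (F x₀ - rs F x₀ * x₀) + j * (r * (1 - rs F x₀)) := by
      rw [hrs]
      nth_rw 1 [hxx]
      rw [hf.map_add_int_mul, hxx]
      ring
    rw [e]
    exact ((hM₁ _ ⟨x₀, hx₀m, rfl⟩).mono (le_max_left _ _)).add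
      (((hM₂ _ ⟨_, ⟨x₀, hx₀m, rfl⟩, rfl⟩).mono (le_max_right _ _)).int_mul j)
  have hslope := hκ _ (hF.rs_mem x)
  have h1 := height_affine (zero_lt_one.trans (hn 0)) (hrs ▸ hK x₀ hx₀m) hb (exists_intAt hn hx)
    hlarge
  rw [← hslope, add_sub_cancel] at h1
  have h2 : (height (n 0) (F x) : ℝ) = height (n 0) x - κ (rs F x) := by exact_mod_cast h1
  rw [h2]
  nth_rw 1 [hslope]
  rw [Real.log_zpow]
  ring

/-- With a single slope generator, every element has a periodic point. -/
theorem exists_periodicPoint (hn : ∀ i, 1 < n i) (hr : 0 < r) (hrA : r ∈ breakRing n)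
    (hf : f ∈ thompsonStein n r) : ∃ (i : ℤ) (x : AddCircle r), i ≠ 0 ∧ (f ^ i) x = x := by
  by_contra! hper
  obtain ⟨F', hF', -⟩ := (mem_thompsonStein_iff hn hr hrA).1 hf
  obtain ⟨Φ, hΦ, -⟩ := hF'.exists_unit hr
  have hlift := hΦ.isLift hr
  have hPL := hΦ.isPL hn hr hrA hf
  set F : ℝ → ℝ := fun x => r * Φ (x / r) with hF
  obtain ⟨L, hL⟩ := exists_log_rs_eq_height hn hr hrA hlift hPL
  obtain ⟨V, hV⟩ := exists_denjoy_bound hn hr hrA hf hΦ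
  have hmem : ∀ k : ℤ, f ^ k ∈ thompsonStein n r := fun k =>
    zpow_mem (show f ∈ thompsonSteinSubgroup hn hr hrA from hf) k
  -- the orbit of the base point
  let o : ℤ → ℝ := fun i => r * (Φ ^ i) (0 / r)
  have hoA : ∀ i, o i ∈ breakRing n := fun i =>
    (((hΦ.zpow i).isPL hn hr hrA (hmem i)).mem_iff hn).2 (zero_mem _)
  have hof : ∀ i, ((o i : ℝ) : AddCircle r) = (f ^ i) ((0 : ℝ) : AddCircle r) := fun i => by
    have := hΦ.zpow i (0 / r)
    rwa [mul_div_cancel₀ _ hr.ne'] at this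
  have hinj : Function.Injective fun i => ((o i : ℝ) : AddCircle r) := fun i j hij => by
    simp only [hof] at hij
    by_contra hne
    refine hper (i - j) ((0 : ℝ) : AddCircle r) (sub_ne_zero.2 hne) ?_
    rw [sub_eq_neg_add, zpow_add, zpow_neg]
    change (f ^ j).symm ((f ^ i) ((0 : ℝ) : AddCircle r)) = _
    rw [hij, Homeomorph.symm_apply_apply]
  -- Only finitely many points of a period have a bounded denominator, and the orbit visits each
  -- point of the circle at most once.
  have hfin : ∀ M : ℕ, {i | height (n 0) (o i) ≤ M}.Finite := by
    intro M
    obtain ⟨Mr, hMr⟩ := exists_intAt hn hrA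
    refine Set.Finite.subset (((IntAt.finite_Icc (zero_lt_one.trans (hn 0)) (max M Mr) 0 r).image
      fun x : ℝ => (x : AddCircle r)).preimage hinj.injOn) fun i hi => ?_
    have h1 : IntAt (n 0) (max M Mr) (o i) :=
      (intAt_height (exists_intAt hn (hoA i))).mono (le_trans hi (le_max_left _ _))
    refine ⟨o i - ⌊o i / r⌋ * r, ⟨⟨Int.sub_floor_div_mul_nonneg _ hr,
      (Int.sub_floor_div_mul_lt _ hr).le⟩, ?_⟩, ?_⟩
    · have := h1.add ((hMr.mono (le_max_right M Mr)).int_mul (-⌊o i / r⌋))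
      convert this using 1
      push_cast
      ring
    · exact (coe_eq_coe_iff _ _).2 ⟨⌊o i / r⌋, by ring⟩
  have hbound : ∀ M : ℕ, ∃ I : ℕ, ∀ i : ℤ, (I : ℤ) ≤ |i| → M < height (n 0) (o i) := fun M => by
    obtain ⟨I, hI⟩ := ((hfin M).image Int.natAbs).bddAbove
    refine ⟨I + 1, fun i hi => ?_⟩
    by_contra hle
    have := hI ⟨i, not_lt.1 hle, rfl⟩
    rw [Int.abs_eq_natAbs] at hi
    omega
  have hlogN : 0 < Real.log (n 0) := Real.log_pos (by exact_mod_cast hn 0)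
  -- A quantity conserved along the orbit wherever the height is large, hence eventually constant in
  -- each direction.
  let g : ℤ → ℝ := fun i => logSlope r Φ i 0 + height (n 0) (o i) * Real.log (n 0)
  have hg : ∀ i, L < height (n 0) (o i) → g (i + 1) = g i := fun i hi => by
    have h1 := hL _ (hoA i) hi
    have h2 := logSlope_add hn hr hrA hf hΦ 1 i 0
    have h3 : logSlope r Φ 1 (o i) = Real.log (rs F (o i)) := by rw [logSlope, zpow_one]
    have h4 : F (o i) = o (i + 1) := by
      simp only [hF, o]
      rw [mul_div_cancel_left₀ _ hr.ne', add_comm, unit_zpow_add_apply, zpow_one]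
    have h5 : logSlope r Φ (i + 1) 0 = Real.log (rs F (o i)) + logSlope r Φ i 0 := by
      rw [add_comm i, h2, ← h3]
    simp only [g]
    rw [h5, h1, h4]
    ring
  obtain ⟨I, hI⟩ := hbound L
  have hgp : ∀ k : ℕ, g (I + k) = g I := fun k => by
    induction k with
    | zero => simp
    | succ k ih =>
      rw [← ih, Nat.cast_succ, ← add_assoc]
      exact hg _ (hI _ (by rw [abs_of_nonneg (by omega)]; omega))
  have hgn : ∀ k : ℕ, g (-(I + k)) = g (-I) := fun k => by
    induction k with
    | zero => simp
    | succ k ih =>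
      rw [← ih, Nat.cast_succ]
      have e : (-((I : ℤ) + k)) = -(I + (k + 1)) + 1 := by ring
      rw [e]
      exact (hg _ (hI _ (by rw [abs_neg, abs_of_nonneg (by omega)]; omega))).symm
  obtain ⟨Q, hQ⟩ := exists_nat_gt ((V + g I + g (-I)) / Real.log (n 0))
  rw [div_lt_iff₀ hlogN] at hQ
  obtain ⟨J, hJ⟩ := hbound Q
  obtain ⟨m, hm, t, ht1, ht2⟩ := exists_best_approximation
    (ρ := CircleDeg1Lift.translationNumber Φ) (fun k hk s h0 => by
      have h1 : CircleDeg1Lift.translationNumber ((Φ ^ (k : ℤ) : CircleDeg1Liftˣ) : CircleDeg1Lift) =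
          ((-s : ℤ) : ℝ) := by
        rw [CircleDeg1Lift.translationNumber_zpow]
        push_cast
        linarith
      obtain ⟨x, hx⟩ := (CircleDeg1Lift.translationNumber_eq_int_iff _ (continuous_unit _)).1 h1
      refine hper k ((r * x : ℝ) : AddCircle r) (by exact_mod_cast hk.ne') ?_
      rw [← hΦ.zpow k x, hx, eq_comm, coe_eq_coe_iff]
      exact ⟨-s, by ring⟩) (max I J)
  have hmI : I < m := (le_max_left _ _).trans_lt hm
  have hmJ : J < m := (le_max_right _ _).trans_lt hm
  have h1 := (abs_le.1 (hV m t ht1 ht2 0)).1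
  obtain ⟨k, hk⟩ := Nat.exists_eq_add_of_le hmI.le
  have h2 := hgp k
  have h3 := hgn k
  have hk' : (I : ℤ) + k = m := by omega
  rw [hk'] at h2 h3
  have h4 : (Q : ℝ) < height (n 0) (o m) := by
    exact_mod_cast hJ m (by rw [abs_of_nonneg (by omega)]; omega)
  have h5 : (0 : ℝ) ≤ height (n 0) (o (-m)) * Real.log (n 0) := by positivity
  have h6 := mul_lt_mul_of_pos_right h4 hlogN
  simp only [g] at h2 h3 hQ
  linarith

/-- Some nonzero power of a generator has a fixed point, so freeness would make the generator a
torsion element. -/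
theorem not_containsFreeAction_one (hn : ∀ i, 1 < n i) (hr : 0 < r) (hrA : r ∈ breakRing n) :
    ¬ ContainsFreeAction (thompsonStein n r) 1 := by
  rintro ⟨H, hH, ⟨e⟩, hfree⟩
  let b : Multiplicative (Fin 1 → ℤ) := Multiplicative.ofAdd (Pi.single 0 1)
  obtain ⟨i, x, hi, hx⟩ := exists_periodicPoint hn hr hrA (hH (e.symm b).2)
  have h1 := hfree _ (zpow_mem (e.symm b).2 i) x hx
  have h2 : e.symm (b ^ i) = 1 := by
    rw [map_zpow]
    exact Subtype.ext h1
  rw [MulEquiv.map_eq_one_iff] at h2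
  have h3 : i • (Pi.single 0 1 : Fin 1 → ℤ) = 0 := h2
  have h4 := congrFun h3 0
  simp at h4
  exact hi h4

end Heights

end ThompsonStein

/-! ### The main theorem -/

theorem theorem2 (p : ℕ) (hp : 1 ≤ p) (n : Fin p → ℕ) (hn : ∀ i, 1 < n i)
    (hind : LinearIndependent ℚ (fun i => Real.log (n i)))
    (d : ℕ) (hd : d = Finset.univ.gcd (fun i => n i - 1)) :
    -- the statements about `G = T_{r,(n_i)}` for every length `r > 0` in `ℤ[1/n₁, …, 1/n_p]`
    (∀ r : ℝ, 0 < r → r ∈ ThompsonStein.breakRing n →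
      -- A
      (ThompsonStein.ContainsFreeAction (ThompsonStein.thompsonStein n r) (p - 1) ∧
        ThompsonStein.ContainsIndependentRotations (ThompsonStein.thompsonStein n r) (p - 1) ∧
        ∀ k : ℕ, ThompsonStein.ContainsFreeAction (ThompsonStein.thompsonStein n r) k ↔
          ThompsonStein.ContainsIndependentRotations (ThompsonStein.thompsonStein n r) k) ∧
      -- B
      ¬ ThompsonStein.ContainsFreeAction (ThompsonStein.thompsonStein n r) p ∧
      -- C
      (∀ H : Subgroup (AddCircle r ≃ₜ AddCircle r),
        (H : Set (AddCircle r ≃ₜ AddCircle r)) ⊆ ThompsonStein.thompsonStein n r →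
        ThompsonStein.IsFreeAbelianOfRank H 2 →
        ∀ f ∈ H, ∃ α ∈ ThompsonStein.slopeGroup n, ∃ β ∈ ThompsonStein.slopeGroup n,
          β ≠ 1 ∧ ThompsonStein.HasRotationNumber f (Real.log α / Real.log β))) ∧
    -- C'
    (∀ α ∈ ThompsonStein.slopeGroup n, ∀ β ∈ ThompsonStein.slopeGroup n, β ≠ 1 →
      0 ≤ Real.log α / Real.log β → Real.log α / Real.log β < 1 →
      ∃ f ∈ ThompsonStein.thompsonStein n (d : ℝ),
        ThompsonStein.HasRotationNumber f (Real.log α / Real.log β)) := by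
  open ThompsonStein in
  obtain ⟨m, rfl⟩ : ∃ m, p = m + 1 := Nat.exists_eq_add_one.2 hp
  refine ⟨fun r hr hrA => ?_, fun α hα β hβ hβ1 _ _ =>
    exists_rotationNumber_eq_log_div_log hn 0 hd hα hβ hβ1⟩
  have hiff : ∀ k, ContainsFreeAction (thompsonStein n r) k ↔
      ContainsIndependentRotations (thompsonStein n r) k :=
    containsFreeAction_iff hr (thompsonSteinSubgroup hn hr hrA)
      fun f hf => hf.imp fun F hF => hF.1
  have hrot : ContainsIndependentRotations (thompsonStein n r) (m + 1 - 1) :=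
    containsIndependentRotations hn hind hr hrA
  refine ⟨⟨(hiff _).2 hrot, hrot, hiff⟩, ?_, fun H hH hrk f hf =>
    exists_log_of_rank_two hn hr hrA 0 hH hrk hf⟩
  -- With a single generator no pair of rank two is at hand for the coboundary argument; heights and
  -- Denjoy's inequality take its place.
  cases m with
  | zero => exact not_containsFreeAction_one hn hr hrA
  | succ m => exact not_containsFreeAction_of_two_le hn hr hrA (by omega)
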